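/- **Setting.** Let $d\ge 1$ be an integer and let $q,\zeta,u,z\in\mathbb C\setminus\{0\}$. For $n\ge 0$ let $B_n$ be the braid group with generators $\sigma_1,\dots,\sigma_{n-1}$, and for $\alpha\in B_n$ let $\epsilon(\alpha)\in\mathbb Z$ be the sum of the exponents of the generators in $\alpha$. *Algebras.* $\mathcal H_n(q)$ is the Iwahori–Hecke algebra: the unital associative $\mathbb C$-algebra generated by $G_1,\dots,G_{n-1}$ with the braid relations and $G_i^2=(q-1)G_i+q$. $\mathrm Y_{d,n}(u)$ is the Yokonuma–Hecke algebra: the unital associative $\mathbb C$-algebra generated by $g_1,\dots,g_{n-1},t_1,\dots,t_n$ with the braid relations for the $g_i$, and $t_it_j=t_jt_i$, $t_jg_i=g_it_{s_i(j)}$ with $s_i=(i,i+1)$, $t_j^d=1$ and $$g_i^2=1+(u-1)e_i+(u-1)e_ig_i,\qquad e_i=\frac1d\sum_{s=0}^{d-1}t_i^s\,t_{i+1}^{\,d-s}.$$ Let $\pi:\mathbb CB_n\to\mathcal H_n(q)$, $\sigma_i\mapsto G_i$, and $\delta:\mathbb CB_n\to\mathrm Y_{d,n}(u)$, $\sigma_i\mapsto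 g_i$. *Traces.* The Ocneanu trace $\tau$ with parameter $\zeta$ is the unique family of linear maps $\mathcal H_n(q)\to\mathbb C$ $(n\ge0)$, compatible with the natural homomorphisms $\mathcal H_n(q)\to\mathcal H_{n+1}(q)$, such that $\tau(hh')=\tau(h'h)$, $\tau(1)=1$ and $\tau(hG_n)=\zeta\,\tau(h)$ for $h,h'\in\mathcal H_n(q)$. For $x_1,\dots,x_{d-1}\in\mathbb C$, the Juyumaya trace with parameters $z,x_1,\dots,x_{d-1}$ is the unique family of linear maps $\mathrm Y_{d,n}(u)\to\mathbb C$ $(n\ge 0)$, compatible with the natural homomorphisms $\mathrm Y_{d,n}(u)\to\mathrm Y_{d,n+1}(u)$, such that $\mathrm{tr}(ab)=\mathrm{tr}(ba)$, $\mathrm{tr}(1)=1$, $\mathrm{tr}(ag_n)=z\,\mathrm{tr}(a)$ and $\mathrm{tr}(at_{n+1}^m)=x_m\,\mathrm{tr}(a)$ $(1\le m\le d-1)$ for $a,b\in\mathrm Y_{d,n}(u)$. (Both exist.) *E-system.* Let $X_S=\{x_1,\dots,x_{d-1}\}$ be a solution of the E-system, that is, with indices modulo $d$ and $x_0:=1$,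 $$\sum_{s=0}^{d-1}x_{m+s}x_{d-s}=x_m\sum_{s=0}^{d-1}x_sx_{d-s}\qquad(1\le m\le d-1).$$ Let $\mathrm{tr}_S$ be the Juyumaya trace with parameters $z,x_1,\dots,x_{d-1}$, and set $E=\frac1d\sum_{s=0}^{d-1}x_sx_{d-s}$. *Invariants.* Put $$\lambda_{\mathcal H}=\frac{\zeta+(1-q)}{q\zeta},\qquad \lambda_{\mathrm Y}=\frac{z+(1-u)E}{uz},$$ and suppose that $\lambda_{\mathcal H}\ne0$ and $\lambda_{\mathrm Y}\ne0$. Given square roots $\sqrt{\lambda_{\mathcal H}}$ and $\sqrt{\lambda_{\mathrm Y}}$, the HOMFLYPT polynomial $P$ and the invariant $\Delta_S$ take on the closure $\widehat\alpha$ of a braid $\alpha\in B_n$ $(n\ge1)$ the values $$P(\widehat\alpha)=\Big(\frac1{\zeta\sqrt{\lambda_{\mathcal H}}}\Big)^{n-1}\big(\sqrt{\lambda_{\mathcal H}}\big)^{\epsilon(\alpha)}\,\tau(\pi(\alpha)),\qquad \Delta_S(\widehat\alpha)=\Big(\frac1{z\sqrt{\lambda_{\mathrm Y}}}\Big)^{n-1}\big(\sqrt{\lambda_{\mathrm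 Y}}\big)^{\epsilon(\alpha)}\,\mathrm{tr}_S(\delta(\alpha)).$$ **Theorem.** (a) $\mathrm{tr}_S(e_i)=E$ for all $n$ and all $1\le i\le n-1$. (b) There are square roots $\sqrt{\lambda_{\mathcal H}}$, $\sqrt{\lambda_{\mathrm Y}}$ for which $P=\Delta_S$, that is, $P(\widehat\alpha)=\Delta_S(\widehat\alpha)$ for all $n\ge1$ and all $\alpha\in B_n$, if and only if $(q,\zeta,u,z,E)$ lies in at least one of the following 14 cases: 1. $q=1$, $\zeta=z$, $u=1$; 2. $q=1$, $\zeta=-z$, $u=1$; 3. $\zeta=q$, $u=1$, $z=1$; 4. $\zeta=q$, $u=1$, $z=-1$; 5. $\zeta=-1$, $u=1$, $z=1$; 6. $\zeta=-1$, $u=1$, $z=-1$; 7. $q=1$, $\zeta=E$, $z=-E$; 8. $q=1$, $\zeta=-E$, $z=-E$; 9. $\zeta=q$, $z=-1$, $E=1$; 10. $\zeta=q$, $z=u$, $E=1$; 11. $\zeta=-1$, $z=-1$, $E=1$; 12. $\zeta=-1$, $z=u$, $E=1$; 13. $q=u$, $\zeta=z$, $E=1$; 14. $q=1/u$, $\zeta=-z/u$,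 $E=1$. (c) In each of these cases, and for any choice of the two square roots, $P=\Delta_S$ if and only if $\zeta\sqrt{\lambda_{\mathcal H}}=z\sqrt{\lambda_{\mathrm Y}}$. (d) In each of these cases $u=1$ or $q=1$ or $E=1$. -/

import Mathlib

set_option linter.unusedSimpArgs false
set_option linter.unusedSectionVars false

namespace YokonumaHecke

noncomputable section

/-- The element `(1/d) ∑_{s=0}^{d-1} a^s b^{d-s}`. -/
def avgIdem {A : Type*} [Ring A] [Algebra ℂ A] (d : ℕ) (a b : A) : A :=
  (1 / (d : ℂ)) • ∑ s ∈ Finset.range d, a ^ s * b ^ (d - s)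

section AvgIdem

variable {A : Type*} [Ring A] [Algebra ℂ A] {d : ℕ} {a b c g : A}

lemma avgIdem_conj {a' b' : A} (h1 : a * g = g * a') (h2 : b * g = g * b') :
    avgIdem d a b * g = g * avgIdem d a' b' := by
  have key : ∀ s : ℕ, a ^ s * b ^ (d - s) * g = g * (a' ^ s * b' ^ (d - s)) := by
    intro s
    have e1 : ∀ k : ℕ, a ^ k * g = g * a' ^ k := fun k => (SemiconjBy.pow_right
      (show SemiconjBy g a' a from h1.symm) k).eq.symm
    have e2 : ∀ k : ℕ, b ^ k * g = g * b' ^ k := fun k => (SemiconjBy.pow_right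
      (show SemiconjBy g b' b from h2.symm) k).eq.symm
    rw [mul_assoc, e2, ← mul_assoc, e1, mul_assoc]
  simp only [avgIdem, smul_mul_assoc, mul_smul_comm, Finset.sum_mul, Finset.mul_sum, key]

lemma avgIdem_commute (h1 : a * g = g * a) (h2 : b * g = g * b) :
    avgIdem d a b * g = g * avgIdem d a b := avgIdem_conj h1 h2

/-- `a * e = b * e`. -/
lemma mul_avgIdem (hab : a * b = b * a) (ha : a ^ d = 1) (hb : b ^ d = 1) :
    a * avgIdem d a b = b * avgIdem d a b := by
  simp only [avgIdem, mul_smul_comm, Finset.mul_sum]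
  congr 1
  rcases Nat.eq_zero_or_pos d with rfl | hd
  · simp
  obtain ⟨d, rfl⟩ : ∃ k, d = k + 1 := ⟨d - 1, by omega⟩
  have hba : ∀ k l : ℕ, b * (a ^ k * b ^ l) = a ^ k * b ^ (l + 1) := by
    intro k l
    have : Commute b (a ^ k) := (show Commute b a from hab.symm).pow_right k
    rw [← mul_assoc, this.eq, mul_assoc, ← pow_succ']
  rw [Finset.sum_range_succ, Finset.sum_range_succ']
  simp only [hba, ← mul_assoc, ← pow_succ']
  congr 1
  · refine Finset.sum_congr rfl fun s hs => ?_
    have := Finset.mem_range.mp hs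
    congr 2
    omega
  · rw [ha, show d + 1 - d = 1 by omega]
    simp [pow_succ b (d+1), hb]

lemma mul_avgIdem_pow (hab : a * b = b * a) (ha : a ^ d = 1) (hb : b ^ d = 1) (k : ℕ) :
    a ^ k * avgIdem d a b = b ^ k * avgIdem d a b := by
  induction k with
  | zero => simp
  | succ k ih =>
    rw [pow_succ', mul_assoc, ih, ← mul_assoc,
      ((show Commute a b from hab).pow_right k).eq, mul_assoc, mul_avgIdem hab ha hb, ← mul_assoc,
      ← pow_succ]

/-- Replacing `a` by `b` next to the idempotent of `a` and `b`. -/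
lemma avgIdem_mul_swap (hab : a * b = b * a) (ha : a ^ d = 1) (hb : b ^ d = 1)
    (hca : c * a = a * c) (hcb : c * b = b * c) :
    avgIdem d a c * avgIdem d a b = avgIdem d b c * avgIdem d a b := by
  rw [avgIdem, avgIdem.eq_1 d b c]
  simp only [smul_mul_assoc, Finset.sum_mul]
  congr 1
  refine Finset.sum_congr rfl fun s _ => ?_
  rw [((show Commute a c from hca.symm).pow_pow s _).eq,
    ((show Commute b c from hcb.symm).pow_pow s _).eq, mul_assoc, mul_assoc,
    mul_avgIdem_pow hab ha hb]

lemma avgIdem_symm (hab : a * b = b * a) (ha : a ^ d = 1) (hb : b ^ d = 1) :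
    avgIdem d a b = avgIdem d b a := by
  simp only [avgIdem]
  congr 1
  rcases Nat.eq_zero_or_pos d with rfl | hd
  · simp
  obtain ⟨d, rfl⟩ : ∃ k, d = k + 1 := ⟨d - 1, by omega⟩
  rw [Finset.sum_range_succ', Finset.sum_range_succ', ← Finset.sum_range_reflect]
  congr 1
  · refine Finset.sum_congr rfl fun s hs => ?_
    have := Finset.mem_range.mp hs
    rw [((show Commute a b from hab).pow_pow _ _).eq]
    congr 2 <;> omega
  · simp [ha, hb]

lemma avgIdem_self [NeZero d] (ha : a ^ d = 1) : avgIdem d a a = 1 := by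
  have : ∀ s ∈ Finset.range d, a ^ s * a ^ (d - s) = 1 := by
    intro s hs
    have := Finset.mem_range.mp hs
    rw [← pow_add, show s + (d - s) = d by omega, ha]
  rw [avgIdem, Finset.sum_congr rfl this]
  have hd : (d : ℂ) ≠ 0 := by exact_mod_cast NeZero.ne d
  simp only [Finset.sum_const, Finset.card_range, one_div]
  rw [← Nat.cast_smul_eq_nsmul ℂ, smul_smul, inv_mul_cancel₀ hd, one_smul]

lemma avgIdem_mul_self [NeZero d] (hab : a * b = b * a) (ha : a ^ d = 1) (hb : b ^ d = 1) :
    avgIdem d a b * avgIdem d a b = avgIdem d a b := by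
  rw [avgIdem_mul_swap hab ha hb hab.symm rfl, avgIdem_self hb, one_mul]

lemma map_avgIdem {B : Type*} [Ring B] [Algebra ℂ B] (f : A →ₐ[ℂ] B) :
    f (avgIdem d a b) = avgIdem d (f a) (f b) := by
  simp [avgIdem, map_sum]

end AvgIdem

/-! ### Braid groups, Iwahori-Hecke algebras, Yokonuma-Hecke algebras -/

/-- The braid relations on `n` strands. The generators `σ_1, …, σ_{n-1}` are indexed
by `Fin (n - 1)`, starting from `0`. -/
def braidRels (n : ℕ) : Set (FreeGroup (Fin (n - 1))) :=
  {r | (∃ i j : Fin (n - 1), (i : ℕ) + 1 < j ∧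
      r = FreeGroup.of i * FreeGroup.of j * (FreeGroup.of j * FreeGroup.of i)⁻¹) ∨
    (∃ i j : Fin (n - 1), (j : ℕ) = i + 1 ∧
      r = FreeGroup.of j * FreeGroup.of i * FreeGroup.of j *
        (FreeGroup.of i * FreeGroup.of j * FreeGroup.of i)⁻¹)}

/-- The Artin braid group `B_n`. -/
abbrev BraidGroup (n : ℕ) : Type := PresentedGroup (braidRels n)

/-- The defining relations of the Iwahori-Hecke algebra `H_n(q)`. -/
inductive HeckeRel (q : ℂ) (n : ℕ) :
    FreeAlgebra ℂ (Fin (n - 1)) → FreeAlgebra ℂ (Fin (n - 1)) → Prop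
  | far (i j : Fin (n - 1)) (h : (i : ℕ) + 1 < j) :
      HeckeRel q n (FreeAlgebra.ι ℂ i * FreeAlgebra.ι ℂ j) (FreeAlgebra.ι ℂ j * FreeAlgebra.ι ℂ i)
  | braid (i j : Fin (n - 1)) (h : (j : ℕ) = i + 1) :
      HeckeRel q n (FreeAlgebra.ι ℂ j * FreeAlgebra.ι ℂ i * FreeAlgebra.ι ℂ j)
        (FreeAlgebra.ι ℂ i * FreeAlgebra.ι ℂ j * FreeAlgebra.ι ℂ i)
  | quad (i : Fin (n - 1)) :
      HeckeRel q n (FreeAlgebra.ι ℂ i ^ 2) ((q - 1) • FreeAlgebra.ι ℂ i + q • 1)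

/-- The Iwahori-Hecke algebra `H_n(q)` of type `A`. -/
def Hecke (q : ℂ) (n : ℕ) : Type := RingQuot (HeckeRel q n)

instance (q : ℂ) (n : ℕ) : Ring (Hecke q n) := inferInstanceAs (Ring (RingQuot (HeckeRel q n)))

instance (q : ℂ) (n : ℕ) : Algebra ℂ (Hecke q n) :=
  inferInstanceAs (Algebra ℂ (RingQuot (HeckeRel q n)))

/-- The generator `G_i` of `H_n(q)`. -/
def Hecke.G {q : ℂ} {n : ℕ} (i : Fin (n - 1)) : Hecke q n :=
  RingQuot.mkAlgHom ℂ (HeckeRel q n) (FreeAlgebra.ι ℂ i)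

/-- The left one of the two neighbouring strands on which the `i`-th generator acts. -/
def strandL {n : ℕ} (i : Fin (n - 1)) : Fin n := ⟨i, by omega⟩

/-- The right one of the two neighbouring strands on which the `i`-th generator acts. -/
def strandR {n : ℕ} (i : Fin (n - 1)) : Fin n := ⟨i + 1, by omega⟩

/-- The free generator `g_i`. -/
def freeG {n : ℕ} (i : Fin (n - 1)) : FreeAlgebra ℂ (Fin (n - 1) ⊕ Fin n) :=
  FreeAlgebra.ι ℂ (Sum.inl i)

/-- The free generator `t_j`. -/
def freeT {n : ℕ} (j : Fin n) : FreeAlgebra ℂ (Fin (n - 1) ⊕ Fin n) :=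
  FreeAlgebra.ι ℂ (Sum.inr j)

/-- The defining relations of the Yokonuma-Hecke algebra `Y_{d,n}(u)`. -/
inductive YokonumaRel (d : ℕ) (u : ℂ) (n : ℕ) :
    FreeAlgebra ℂ (Fin (n - 1) ⊕ Fin n) → FreeAlgebra ℂ (Fin (n - 1) ⊕ Fin n) → Prop
  | far (i j : Fin (n - 1)) (h : (i : ℕ) + 1 < j) :
      YokonumaRel d u n (freeG i * freeG j) (freeG j * freeG i)
  | braid (i j : Fin (n - 1)) (h : (j : ℕ) = i + 1) :
      YokonumaRel d u n (freeG i * freeG j * freeG i) (freeG j * freeG i * freeG j)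
  | tt (i j : Fin n) : YokonumaRel d u n (freeT i * freeT j) (freeT j * freeT i)
  | tg (i : Fin (n - 1)) (j : Fin n) : YokonumaRel d u n (freeT j * freeG i)
      (freeG i * freeT (Equiv.swap (strandL i) (strandR i) j))
  | tpow (j : Fin n) : YokonumaRel d u n (freeT j ^ d) 1
  | quad (i : Fin (n - 1)) : YokonumaRel d u n (freeG i ^ 2)
      (1 + (u - 1) • avgIdem d (freeT (strandL i)) (freeT (strandR i)) +
        (u - 1) • (avgIdem d (freeT (strandL i)) (freeT (strandR i)) * freeG i))

/-- The Yokonuma-Hecke algebra `Y_{d,n}(u)`. -/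
def Yokonuma (d : ℕ) (u : ℂ) (n : ℕ) : Type := RingQuot (YokonumaRel d u n)

instance (d : ℕ) (u : ℂ) (n : ℕ) : Ring (Yokonuma d u n) :=
  inferInstanceAs (Ring (RingQuot (YokonumaRel d u n)))

instance (d : ℕ) (u : ℂ) (n : ℕ) : Algebra ℂ (Yokonuma d u n) :=
  inferInstanceAs (Algebra ℂ (RingQuot (YokonumaRel d u n)))

namespace Yokonuma

variable {d : ℕ} {u : ℂ} {n : ℕ}

/-- The quotient map from the free algebra. -/
def mk (d : ℕ) (u : ℂ) (n : ℕ) : FreeAlgebra ℂ (Fin (n - 1) ⊕ Fin n) →ₐ[ℂ] Yokonuma d u n :=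
  RingQuot.mkAlgHom ℂ (YokonumaRel d u n)

/-- The braiding generator `g_i` of `Y_{d,n}(u)`. -/
def g (i : Fin (n - 1)) : Yokonuma d u n := mk d u n (freeG i)

/-- The framing generator `t_j` of `Y_{d,n}(u)`. -/
def t (j : Fin n) : Yokonuma d u n := mk d u n (freeT j)

/-- The idempotent `e_i = (1/d) ∑_{s=0}^{d-1} t_i^s t_{i+1}^{-s}` of `Y_{d,n}(u)`. -/
def e (i : Fin (n - 1)) : Yokonuma d u n := avgIdem d (t (strandL i)) (t (strandR i))

end Yokonuma

/-- The elements `g 0, …, g (n-2)` and `t 0, …, t (n-1)` satisfy the defining relations of the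
Yokonuma-Hecke algebra `Y_{d,n}(u)` (an auxiliary predicate). -/
structure IsYok (d : ℕ) (u : ℂ) (n : ℕ) {A : Type*} [Ring A] [Algebra ℂ A] (g t : ℕ → A) :
    Prop where
  far : ∀ i j, i + 1 < j → j + 1 < n → g i * g j = g j * g i
  braid : ∀ i, i + 2 < n → g i * g (i + 1) * g i = g (i + 1) * g i * g (i + 1)
  tcomm : ∀ i j, i < n → j < n → t i * t j = t j * t i
  tg1 : ∀ i, i + 1 < n → t i * g i = g i * t (i + 1)
  tg2 : ∀ i, i + 1 < n → t (i + 1) * g i = g i * t i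
  tg3 : ∀ i j, i + 1 < n → j < n → j ≠ i → j ≠ i + 1 → t j * g i = g i * t j
  tpow : ∀ j, j < n → t j ^ d = 1
  quad : ∀ i, i + 1 < n → g i * g i = 1 + (u - 1) • avgIdem d (t i) (t (i + 1)) +
    (u - 1) • (avgIdem d (t i) (t (i + 1)) * g i)

lemma IsYok.mono {d : ℕ} {u : ℂ} {n m : ℕ} {A : Type*} [Ring A] [Algebra ℂ A] {g t : ℕ → A}
    (h : IsYok d u m g t) (hnm : n ≤ m) : IsYok d u n g t where
  far i j h1 h2 := h.far i j h1 (by omega)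
  braid i h1 := h.braid i (by omega)
  tcomm i j h1 h2 := h.tcomm i j (by omega) (by omega)
  tg1 i h1 := h.tg1 i (by omega)
  tg2 i h1 := h.tg2 i (by omega)
  tg3 i j h1 h2 := h.tg3 i j (by omega) (by omega)
  tpow j h1 := h.tpow j (by omega)
  quad i h1 := h.quad i (by omega)

lemma IsYok.map {d : ℕ} {u : ℂ} {n : ℕ} {A B : Type*} [Ring A] [Algebra ℂ A] [Ring B] [Algebra ℂ B]
    {g t : ℕ → A} (h : IsYok d u n g t) (f : A →ₐ[ℂ] B) :
    IsYok d u n (fun i => f (g i)) (fun i => f (t i)) where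
  far i j h1 h2 := by simp only [← map_mul, h.far i j h1 h2]
  braid i h1 := by simp only [← map_mul, h.braid i h1]
  tcomm i j h1 h2 := by simp only [← map_mul, h.tcomm i j h1 h2]
  tg1 i h1 := by simp only [← map_mul, h.tg1 i h1]
  tg2 i h1 := by simp only [← map_mul, h.tg2 i h1]
  tg3 i j h1 h2 h3 h4 := by simp only [← map_mul, h.tg3 i j h1 h2 h3 h4]
  tpow j h1 := by simp only [← map_pow, h.tpow j h1, map_one]
  quad i h1 := by
    rw [← map_mul, h.quad i h1]
    simp only [map_add, map_one, map_smul, map_mul, map_avgIdem]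

section Rows

variable {d : ℕ} {u : ℂ} {n : ℕ} {A : Type*} [Ring A] [Algebra ℂ A]

/-- Right multiplication of a row by a diagonal matrix. -/
def opD (D : ℕ → A) : Module.End A (ℕ → A) where
  toFun f c := f c * D c
  map_add' f f' := by funext c; simp [add_mul]
  map_smul' a f := by funext c; simp [mul_assoc]

/-- The diagonal matrix of `t j`. -/
def diagT (n : ℕ) (T : ℕ → A) (τ : A) (j : ℕ) (c : ℕ) : A :=
  if n < c then 1 else if c = j then τ else if j < c then T j else T (j - 1)

/-- Right multiplication of a row by the matrix of `g j`. -/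
def opG (d : ℕ) (u : ℂ) (n : ℕ) (G T : ℕ → A) (τ : A) (j : ℕ) : Module.End A (ℕ → A) where
  toFun f c :=
    if n < c then - f c else if c < j then f c * G (j - 1)
    else if c = j then f j * ((u - 1) • avgIdem d (T j) τ) + f (j + 1)
    else if c = j + 1 then f j * (1 + (u - 1) • avgIdem d (T j) τ)
    else f c * G j
  map_add' f f' := by
    funext c
    simp only [Pi.add_apply]
    split_ifs
    all_goals simp only [add_mul, neg_add]
    abel
  map_smul' a f := by
    funext c
    simp only [Pi.smul_apply, smul_eq_mul, RingHom.id_apply]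
    split_ifs <;> simp [mul_assoc, mul_add]

lemma opD_apply {A : Type*} [Ring A] (D f : ℕ → A) (c : ℕ) : opD D f c = f c * D c := rfl

/-- Diagonal matrices as an algebra homomorphism. -/
def diagHom : (ℕ → A) →ₐ[ℂ] (Module.End A (ℕ → A))ᵐᵒᵖ where
  toFun D := MulOpposite.op (opD D)
  map_one' := by
    apply MulOpposite.unop_injective; ext1 f; funext c; simp [opD_apply]
  map_mul' D D' := by
    apply MulOpposite.unop_injective; ext1 f; funext c; simp [opD_apply, mul_assoc]
  map_zero' := by
    apply MulOpposite.unop_injective; ext1 f; funext c; simp [opD_apply]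
  map_add' D D' := by
    apply MulOpposite.unop_injective; ext1 f; funext c; simp [opD_apply, mul_add]
  commutes' r := by
    apply MulOpposite.unop_injective; ext1 f; funext c
    simp [opD_apply, Algebra.algebraMap_eq_smul_one]

lemma avgIdem_apply (D D' : ℕ → A) (c : ℕ) : avgIdem d D D' c = avgIdem d (D c) (D' c) := by
  simp [avgIdem]

lemma diagHom_unop (D : ℕ → A) : (diagHom D).unop = opD D := rfl

section Entries
variable {G T : ℕ → A} {τ : A} {f : ℕ → A} {j c : ℕ}

lemma opG_out (h : n < c) : opG d u n G T τ j f c = - f c := by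
  simp [opG, h]

lemma opG_lt (h : c ≤ n) (h1 : c < j) : opG d u n G T τ j f c = f c * G (j - 1) := by
  simp [opG, h1, not_lt.mpr h]

lemma opG_eq (h : c ≤ n) (h1 : c = j) :
    opG d u n G T τ j f c = (u - 1) • (f j * avgIdem d (T j) τ) + f (j + 1) := by
  subst h1
  simp [opG, not_lt.mpr h]

lemma opG_succ (h : c ≤ n) (h1 : c = j + 1) :
    opG d u n G T τ j f c = f j + (u - 1) • (f j * avgIdem d (T j) τ) := by
  subst h1
  simp [opG, not_lt.mpr h, mul_add]

lemma opG_gt (h : c ≤ n) (h1 : j + 1 < c) : opG d u n G T τ j f c = f c * G j := by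
  have h2 : ¬ c < j := by omega
  have h3 : c ≠ j := by omega
  have h4 : c ≠ j + 1 := by omega
  simp [opG, not_lt.mpr h, h2, h3, h4]
end Entries

section DiagEntries
variable {A : Type*} [Ring A] {n : ℕ} {T : ℕ → A} {τ : A} {j c : ℕ}

lemma diagT_out (h : n < c) : diagT n T τ j c = 1 := by
  simp [diagT, h]

lemma diagT_eq (h : c ≤ n) (h1 : c = j) : diagT n T τ j c = τ := by
  simp [diagT, h1, not_lt.mpr (h1 ▸ h)]

lemma diagT_gt (h : c ≤ n) (h1 : j < c) : diagT n T τ j c = T j := by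
  simp [diagT, h1, not_lt.mpr h, h1.ne']

lemma diagT_lt (h : c ≤ n) (h1 : c < j) : diagT n T τ j c = T (j - 1) := by
  simp [diagT, h1.not_gt, not_lt.mpr h, h1.ne]
end DiagEntries

/-- The row representation: `g j` and `t j` for one more strand. -/
lemma isYok_rows [NeZero d] {G T : ℕ → A} {τ : A} (h : IsYok d u n G T)
    (hτ : ∀ a, τ * a = a * τ) (hτd : τ ^ d = 1) :
    IsYok d u (n + 1) (fun j => MulOpposite.op (opG d u n G T τ j))
      (fun j => diagHom (diagT n T τ j)) := by
  have hE : ∀ j < n, ∀ f, f * T j = T j * f → f * avgIdem d (T j) τ = avgIdem d (T j) τ * f :=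
    fun j hj f hf => (avgIdem_commute hf.symm (hτ f)).symm
  have hE1 : ∀ j, j + 1 < n → avgIdem d (T j) τ * G j = G j * avgIdem d (T (j + 1)) τ :=
    fun j hj => avgIdem_conj (h.tg1 j hj) (hτ _)
  have hE2 : ∀ j, j + 1 < n → avgIdem d (T (j + 1)) τ * G j = G j * avgIdem d (T j) τ :=
    fun j hj => avgIdem_conj (h.tg2 j hj) (hτ _)
  have hE3 : ∀ i j, i + 1 < n → j < n → j ≠ i → j ≠ i + 1 →
      avgIdem d (T j) τ * G i = G i * avgIdem d (T j) τ :=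
    fun i j hi hj h1 h2 => avgIdem_conj (h.tg3 i j hi hj h1 h2) (hτ _)
  have hTE : ∀ i j, i < n → j < n → T i * avgIdem d (T j) τ = avgIdem d (T j) τ * T i :=
    fun i j hi hj => hE j hj _ (h.tcomm i j hi hj)
  have hEE : ∀ i j, i < n → j < n →
      avgIdem d (T i) τ * avgIdem d (T j) τ = avgIdem d (T j) τ * avgIdem d (T i) τ :=
    fun i j hi hj => (avgIdem_commute (hTE i j hi hj) (hτ _))
  have hTτ : ∀ j < n, T j * avgIdem d (T j) τ = τ * avgIdem d (T j) τ :=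
    fun j hj => mul_avgIdem (hτ _).symm (h.tpow j hj) hτd
  have hee : ∀ j < n, avgIdem d (T j) τ * avgIdem d (T j) τ = avgIdem d (T j) τ :=
    fun j hj => avgIdem_mul_self (hτ _).symm (h.tpow j hj) hτd
  have heE : ∀ j, j + 1 < n → avgIdem d (T j) (T (j + 1)) * avgIdem d (T j) τ =
      avgIdem d (T j) τ * avgIdem d (T (j+1)) τ := by
    intro j hj
    rw [avgIdem_mul_swap (c := T (j+1)) (hτ _).symm (h.tpow j (by omega)) hτd
      (h.tcomm _ _ hj (by omega)) (hτ _).symm,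
      avgIdem_symm (hτ _) hτd (h.tpow (j+1) hj), hEE _ _ hj (by omega)]
  have ext_op : ∀ {x y : (Module.End A (ℕ → A))ᵐᵒᵖ},
      (∀ (f : ℕ → A) (c : ℕ), x.unop f c = y.unop f c) → x = y := fun hxy =>
    MulOpposite.unop_injective (LinearMap.ext fun f => funext fun c => hxy f c)
  refine ⟨?_, ?_, ?_, ?_, ?_, ?_, ?_, ?_⟩
  · intro i j hij hj
    refine ext_op fun f c => ?_
    simp only [MulOpposite.unop_mul, MulOpposite.unop_op, Module.End.mul_apply]
    obtain ⟨j, rfl⟩ : ∃ k, j = k + 1 := ⟨j - 1, by omega⟩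
    have e1 := h.far i j
    have e2 := h.far i (j + 1)
    have e3 := h.far (i - 1) j
    have e4 := hE3 j i (by omega) (by omega) (by omega) (by omega)
    have e5 := fun h' => hE3 i (j + 1) (by omega) h' (by omega) (by omega)
    rcases lt_or_ge n c with hc | hc
    · simp (disch := omega) only [opG_out]
    have hcases : c < i ∨ c = i ∨ c = i + 1 ∨ (i + 1 < c ∧ c < j + 1) ∨ c = j + 1 ∨ c = j + 2 ∨
      j + 2 < c := by omega
    rcases hcases with h1 | h1 | h1 | h1 | h1 | h1 | h1
    all_goals
      simp (disch := omega) only [opG_lt, opG_eq, opG_succ, opG_gt, Nat.add_sub_cancel]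
      simp only [mul_assoc, add_mul, smul_mul_assoc]
    · rw [e3 (by omega) (by omega)]
    · rw [e4]
    · rw [e4]
    · rw [e1 (by omega) (by omega)]
    · rw [e5 (by omega)]
    · rw [e5 (by omega)]
    · rw [e2 (by omega) (by omega)]
  · intro i hi
    refine ext_op fun f c => ?_
    simp only [MulOpposite.unop_mul, MulOpposite.unop_op, Module.End.mul_apply]
    rcases lt_or_ge n c with hc | hc
    · simp (disch := omega) only [opG_out]
    have hcases : c < i ∨ c = i ∨ c = i + 1 ∨ c = i + 2 ∨ i + 2 < c := by omega
    have e1 := hE1 i (by omega)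
    have e2 := hE2 i (by omega)
    have e3 := hEE (i + 1) i (by omega) (by omega)
    have e5 := heE i (by omega)
    have e1r : ∀ x, avgIdem d (T i) τ * (G i * x) = G i * (avgIdem d (T (i + 1)) τ * x) := by
      intro x; rw [← mul_assoc, e1, mul_assoc]
    have e2r : ∀ x, avgIdem d (T (i + 1)) τ * (G i * x) = G i * (avgIdem d (T i) τ * x) := by
      intro x; rw [← mul_assoc, e2, mul_assoc]
    have e6 : avgIdem d (T i) (T (i + 1)) * avgIdem d (T (i + 1)) τ =
        avgIdem d (T i) τ * avgIdem d (T (i + 1)) τ := by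
      rw [avgIdem_symm (h.tcomm _ _ (by omega) (by omega)) (h.tpow _ (by omega))
        (h.tpow _ (by omega)), avgIdem_mul_swap (hτ _).symm (h.tpow _ (by omega)) hτd
        (h.tcomm _ _ (by omega) (by omega)) (hτ _).symm,
        avgIdem_symm (hτ _) hτd (h.tpow i (by omega))]
    have e7 : avgIdem d (T i) (T (i + 1)) * G i = G i * avgIdem d (T i) (T (i + 1)) := by
      rw [avgIdem_conj (h.tg1 i (by omega)) (h.tg2 i (by omega)),
        avgIdem_symm (h.tcomm _ _ (by omega) (by omega)) (h.tpow _ (by omega))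
        (h.tpow _ (by omega))]
    have w : G i * (G i * avgIdem d (T (i + 1)) τ) = avgIdem d (T (i + 1)) τ +
        (u - 1) • (avgIdem d (T i) τ * avgIdem d (T (i + 1)) τ) +
        (u - 1) • (G i * (avgIdem d (T i) τ * avgIdem d (T (i + 1)) τ)) := by
      rw [← mul_assoc, h.quad i (by omega), e7]
      simp only [add_mul, one_mul, smul_mul_assoc, mul_assoc, e6]
    rcases hcases with h1 | h1 | h1 | h1 | h1
    all_goals
      simp (disch := omega) only [opG_lt, opG_eq, opG_succ, opG_gt, Nat.add_sub_cancel]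
    · obtain ⟨i, rfl⟩ : ∃ k, i = k + 1 := ⟨i - 1, by omega⟩
      have := h.braid i (by omega)
      simp only [Nat.add_sub_cancel, mul_assoc] at this ⊢
      rw [this]
    · simp only [add_mul, mul_add, smul_mul_assoc, mul_smul_comm, mul_assoc, smul_add, e1, e1r, e2,
        e2r, e3, w]
      module
    · simp only [add_mul, mul_add, smul_mul_assoc, mul_smul_comm, mul_assoc, smul_add, e1, e1r, e2,
        e2r, e3, w]
      module
    · simp only [add_mul, mul_add, smul_mul_assoc, mul_smul_comm, mul_assoc, smul_add, e1, e1r, e2,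
        e2r, e3, w]
      module
    · have := h.braid i (by omega)
      simp only [mul_assoc] at this ⊢
      rw [this]
  · intro i j hi hj
    rw [← map_mul, ← map_mul]
    congr 1
    funext c
    simp only [Pi.mul_apply, diagT]
    split_ifs
    all_goals first
      | rfl
      | omega
      | exact hτ _
      | exact (hτ _).symm
      | exact h.tcomm _ _ (by omega) (by omega)
  · intro i hi
    refine ext_op fun f c => ?_
    simp only [MulOpposite.unop_mul, MulOpposite.unop_op, Module.End.mul_apply, diagHom_unop]
    have e1 : avgIdem d (T i) τ * τ = avgIdem d (T i) τ * T i := by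
      rw [← hTE i i (by omega) (by omega), hTτ i (by omega), hτ]
    rcases lt_or_ge n c with hc | hc
    · simp (disch := omega) only [opG_out, opD_apply, diagT_out, mul_one]
    have hcases : c < i ∨ c = i ∨ c = i + 1 ∨ i + 1 < c := by omega
    rcases hcases with h1 | h1 | h1 | h1
    all_goals
      simp (disch := omega) only [opG_lt, opG_eq, opG_succ, opG_gt, opD_apply, diagT_lt, diagT_eq,
        diagT_gt, Nat.add_sub_cancel]
      simp only [mul_assoc, add_mul, smul_mul_assoc]
    · obtain ⟨i, rfl⟩ : ∃ k, i = k + 1 := ⟨i - 1, by omega⟩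
      simp only [Nat.add_sub_cancel]
      rw [h.tg1 i (by omega)]
    · rw [hτ (avgIdem d (T i) τ), e1]
    · rw [hτ, e1]
    · rw [h.tg1 i (by omega)]
  · intro i hi
    refine ext_op fun f c => ?_
    simp only [MulOpposite.unop_mul, MulOpposite.unop_op, Module.End.mul_apply, diagHom_unop]
    have e1 : avgIdem d (T i) τ * T i = avgIdem d (T i) τ * τ := by
      rw [← hTE i i (by omega) (by omega), hTτ i (by omega), hτ]
    rcases lt_or_ge n c with hc | hc
    · simp (disch := omega) only [opG_out, opD_apply, diagT_out, mul_one]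
    have hcases : c < i ∨ c = i ∨ c = i + 1 ∨ i + 1 < c := by omega
    rcases hcases with h1 | h1 | h1 | h1
    all_goals
      simp (disch := omega) only [opG_lt, opG_eq, opG_succ, opG_gt, opD_apply, diagT_lt, diagT_eq,
        diagT_gt, Nat.add_sub_cancel]
      simp only [mul_assoc, add_mul, smul_mul_assoc]
    · obtain ⟨i, rfl⟩ : ∃ k, i = k + 1 := ⟨i - 1, by omega⟩
      simp only [Nat.add_sub_cancel]
      rw [h.tg2 i (by omega)]
    · rw [hTE i i (by omega) (by omega), e1]
    · rw [hTE i i (by omega) (by omega), e1]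
    · rw [h.tg2 i (by omega)]
  · intro i j hi hj h1 h2
    refine ext_op fun f c => ?_
    simp only [MulOpposite.unop_mul, MulOpposite.unop_op, Module.End.mul_apply, diagHom_unop]
    rcases lt_or_ge n c with hc | hc
    · simp (disch := omega) only [opG_out, opD_apply, diagT_out, mul_one]
    have e1 : ∀ k, k < n → avgIdem d (T i) τ * T k = T k * avgIdem d (T i) τ :=
      fun k hk => (hTE k i hk (by omega)).symm
    have hcases : (c < i ∨ c = i ∨ c = i + 1 ∨ i + 1 < c) ∧ (c < j ∨ c = j ∨ j < c) := by omega
    have e2 := fun k => h.tg3 i k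
    have e3 := fun k => h.tg3 (i - 1) k
    rcases hcases with ⟨h3 | h3 | h3 | h3, h4 | h4 | h4⟩
    all_goals first
      | omega
      | skip
    all_goals
      simp (disch := omega) only [opG_lt, opG_eq, opG_succ, opG_gt, opD_apply, diagT_lt, diagT_eq,
        diagT_gt, Nat.add_sub_cancel]
      simp only [mul_assoc, add_mul, smul_mul_assoc, hτ]
    all_goals first
      | rw [e1 _ (by omega)]
      | rw [e2 _ (by omega) (by omega) (by omega) (by omega)]
      | rw [e3 _ (by omega) (by omega) (by omega) (by omega)]
  · intro j hj
    rw [← map_pow, ← map_one diagHom]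
    congr 1
    funext c
    simp only [Pi.pow_apply, diagT, Pi.one_apply]
    split_ifs
    all_goals first
      | exact one_pow _
      | exact hτd
      | exact h.tpow _ (by omega)
  · intro i hi
    refine ext_op fun f c => ?_
    rw [← map_avgIdem (diagHom (A := A))]
    simp only [MulOpposite.unop_mul, MulOpposite.unop_op, Module.End.mul_apply, diagHom_unop,
      MulOpposite.unop_add, MulOpposite.unop_one, MulOpposite.unop_smul, LinearMap.add_apply,
      Module.End.one_apply, LinearMap.smul_apply, Pi.add_apply, Pi.smul_apply]
    have e1 := hee i (by omega)
    have e2 := avgIdem_symm (hτ (T i)) hτd (h.tpow i (by omega))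
    rcases lt_or_ge n c with hc | hc
    · simp (disch := omega) only [opG_out, opD_apply, avgIdem_apply, diagT_out, avgIdem_self, one_pow]
      simp
    have hcases : c < i ∨ c = i ∨ c = i + 1 ∨ i + 1 < c := by omega
    rcases hcases with h1 | h1 | h1 | h1
    all_goals
      simp (disch := omega) only [opG_lt, opG_eq, opG_succ, opG_gt, opD_apply, avgIdem_apply,
        diagT_lt, diagT_eq, diagT_gt, Nat.add_sub_cancel]
      simp only [mul_assoc, add_mul, smul_mul_assoc, smul_add, h1]
    · obtain ⟨i, rfl⟩ : ∃ k, i = k + 1 := ⟨i - 1, by omega⟩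
      simp only [Nat.add_sub_cancel]
      rw [h.quad i (by omega)]
      simp only [mul_add, mul_one, mul_smul_comm]
    · simp only [e1, e2]
      module
    · simp only [e1, e2]
      module
    · rw [h.quad i (by omega)]
      simp only [mul_add, mul_one, mul_smul_comm]

end Rows

namespace Yokonuma

variable {d : ℕ} {u : ℂ} {n : ℕ}

/-- `g i` for a natural number `i`, with a default value out of range. -/
def gN (d : ℕ) (u : ℂ) (n : ℕ) (i : ℕ) : Yokonuma d u n := if h : i < n - 1 then g ⟨i, h⟩ else 0

/-- `t j` for a natural number `j`, with a default value out of range. -/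
def tN (d : ℕ) (u : ℂ) (n : ℕ) (j : ℕ) : Yokonuma d u n := if h : j < n then t ⟨j, h⟩ else 1

lemma gN_of {i : ℕ} (h : i < n - 1) : gN d u n i = g ⟨i, h⟩ := dif_pos h
lemma tN_of {j : ℕ} (h : j < n) : tN d u n j = t ⟨j, h⟩ := dif_pos h

lemma mk_rel {a b : FreeAlgebra ℂ (Fin (n - 1) ⊕ Fin n)} (h : YokonumaRel d u n a b) :
    mk d u n a = mk d u n b := RingQuot.mkAlgHom_rel ℂ h

lemma tN_mul_g (i : Fin (n - 1)) (j : Fin n) :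
    (t j * g i : Yokonuma d u n) = g i * t (Equiv.swap (strandL i) (strandR i) j) := by
  simpa [g, t] using mk_rel (YokonumaRel.tg (d := d) (u := u) i j)

lemma isYok (d : ℕ) (u : ℂ) (n : ℕ) : IsYok d u n (gN d u n) (tN d u n) where
  far i j h1 h2 := by
    rw [gN_of (by omega), gN_of (by omega)]
    simpa [g] using mk_rel (YokonumaRel.far (d := d) (u := u) (n := n) ⟨i, by omega⟩ ⟨j, by omega⟩ h1)
  braid i h := by
    rw [gN_of (by omega), gN_of (by omega)]
    simpa [g] using mk_rel (YokonumaRel.braid (d := d) (u := u) (n := n) ⟨i, by omega⟩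
      ⟨i + 1, by omega⟩ rfl)
  tcomm i j h1 h2 := by
    rw [tN_of (by omega), tN_of (by omega)]
    simpa [t] using mk_rel (YokonumaRel.tt (d := d) (u := u) (n := n) ⟨i, by omega⟩ ⟨j, by omega⟩)
  tg1 i h := by
    rw [gN_of (by omega), tN_of (by omega), tN_of (by omega)]
    exact (tN_mul_g (⟨i, by omega⟩ : Fin (n - 1)) ⟨i, by omega⟩).trans
      (by rw [show (⟨i, by omega⟩ : Fin n) = strandL ⟨i, by omega⟩ from rfl,
        Equiv.swap_apply_left]; rfl)
  tg2 i h := by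
    rw [gN_of (by omega), tN_of (by omega), tN_of (by omega)]
    exact (tN_mul_g (⟨i, by omega⟩ : Fin (n - 1)) ⟨i + 1, by omega⟩).trans
      (by rw [show (⟨i + 1, by omega⟩ : Fin n) = strandR ⟨i, by omega⟩ from rfl,
        Equiv.swap_apply_right]; rfl)
  tg3 i j h h1 h2 h3 := by
    rw [gN_of (by omega), tN_of (by omega)]
    exact (tN_mul_g (⟨i, by omega⟩ : Fin (n - 1)) ⟨j, by omega⟩).trans
      (by rw [Equiv.swap_apply_of_ne_of_ne (by simp [strandL, Fin.ext_iff, h2])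
        (by simp [strandR, Fin.ext_iff, h3])])
  tpow j h := by
    rw [tN_of (by omega)]
    simpa [t] using mk_rel (YokonumaRel.tpow (d := d) (u := u) (n := n) ⟨j, by omega⟩)
  quad i h := by
    rw [gN_of (by omega), tN_of (by omega), tN_of (by omega)]
    have := mk_rel (YokonumaRel.quad (d := d) (u := u) (n := n) ⟨i, by omega⟩)
    simp only [map_pow, map_add, map_one, map_smul, map_mul, map_avgIdem] at this
    rw [← sq]
    exact this

/-- The universal property of `Y_{d,n}(u)`. -/
def lift {A : Type*} [Ring A] [Algebra ℂ A] {G T : ℕ → A} (h : IsYok d u n G T) :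
    Yokonuma d u n →ₐ[ℂ] A :=
  RingQuot.liftAlgHom ℂ ⟨FreeAlgebra.lift ℂ (Sum.elim (fun i => G i) (fun j => T j)), by
    intro a b hab
    have hG : ∀ i : Fin (n - 1), FreeAlgebra.lift ℂ (Sum.elim (fun i : Fin (n - 1) => G i)
      (fun j : Fin n => T j)) (freeG i) = G i := fun i => by simp [freeG]
    have hT : ∀ i : Fin n, FreeAlgebra.lift ℂ (Sum.elim (fun i : Fin (n - 1) => G i)
      (fun j : Fin n => T j)) (freeT i) = T i := fun i => by simp [freeT]
    induction hab with
    | far i j hij => simp only [map_mul, hG]; exact h.far _ _ hij (by omega)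
    | braid i j hij => simp only [map_mul, hG, hij]; exact h.braid _ (by omega)
    | tt i j => simp only [map_mul, hT]; exact h.tcomm _ _ i.2 j.2
    | tg i j =>
      simp only [map_mul, hG, hT]
      by_cases h1 : j = strandL i
      · subst h1; rw [Equiv.swap_apply_left]; exact h.tg1 i (by omega)
      by_cases h2 : j = strandR i
      · subst h2; rw [Equiv.swap_apply_right]; exact h.tg2 i (by omega)
      rw [Equiv.swap_apply_of_ne_of_ne h1 h2]
      exact h.tg3 _ _ (by omega) j.2 (fun h3 => h1 (Fin.ext h3)) (fun h3 => h2 (Fin.ext h3))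
    | tpow j => simp only [map_pow, hT, map_one]; exact h.tpow _ j.2
    | quad i =>
      simp only [map_pow, map_add, map_one, map_smul, map_mul, map_avgIdem, hT, hG, sq]
      exact h.quad _ (by omega)⟩

lemma lift_g {A : Type*} [Ring A] [Algebra ℂ A] {G T : ℕ → A} (h : IsYok d u n G T)
    (i : Fin (n - 1)) : lift h (g i) = G i := by
  refine (RingQuot.liftAlgHom_mkAlgHom_apply ℂ _ _ _).trans ?_
  simp [freeG]

lemma lift_t {A : Type*} [Ring A] [Algebra ℂ A] {G T : ℕ → A} (h : IsYok d u n G T)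
    (j : Fin n) : lift h (t j) = T j := by
  refine (RingQuot.liftAlgHom_mkAlgHom_apply ℂ _ _ _).trans ?_
  simp [freeT]

lemma lift_gN {A : Type*} [Ring A] [Algebra ℂ A] {G T : ℕ → A} (h : IsYok d u n G T)
    {i : ℕ} (hi : i + 1 < n) : lift h (gN d u n i) = G i := by
  rw [gN_of (by omega), lift_g]

lemma lift_tN {A : Type*} [Ring A] [Algebra ℂ A] {G T : ℕ → A} (h : IsYok d u n G T)
    {j : ℕ} (hj : j < n) : lift h (tN d u n j) = T j := by
  rw [tN_of hj, lift_t]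

/-- Induction for subalgebras: the generators generate. -/
lemma subalgebra_eq_top (S : Subalgebra ℂ (Yokonuma d u n)) (hg : ∀ i, i + 1 < n → gN d u n i ∈ S)
    (ht : ∀ j, j < n → tN d u n j ∈ S) : S = ⊤ := by
  rw [eq_top_iff]
  rintro y -
  obtain ⟨a, rfl⟩ := RingQuot.mkAlgHom_surjective ℂ (YokonumaRel d u n) y
  induction a using FreeAlgebra.induction with
  | grade0 r => exact (AlgHom.commutes (RingQuot.mkAlgHom ℂ (YokonumaRel d u n)) r).symm ▸
      S.algebraMap_mem r
  | grade1 x =>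
    rcases x with i | j
    · have := hg i (by omega)
      rwa [gN_of i.2] at this
    · have := ht j (by omega)
      rwa [tN_of j.2] at this
  | add a b ha hb => rw [map_add]; exact S.add_mem ha hb
  | mul a b ha hb => rw [map_mul]; exact S.mul_mem ha hb

/-- A subspace that contains `1` and is stable under right multiplication by the generators
is everything. -/
lemma right_induction (P : Submodule ℂ (Yokonuma d u n)) (h1 : 1 ∈ P)
    (hg : ∀ i, i + 1 < n → ∀ y ∈ P, y * gN d u n i ∈ P)
    (ht : ∀ j, j < n → ∀ y ∈ P, y * tN d u n j ∈ P) (y : Yokonuma d u n) : y ∈ P := by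
  let S : Subalgebra ℂ (Yokonuma d u n) :=
    { carrier := {a | ∀ y ∈ P, y * a ∈ P}
      mul_mem' := fun {a b} ha hb y hy => by rw [← mul_assoc]; exact hb _ (ha _ hy)
      add_mem' := fun {a b} ha hb y hy => by rw [mul_add]; exact P.add_mem (ha _ hy) (hb _ hy)
      algebraMap_mem' := fun r y hy => by
        rw [← Algebra.commutes, ← Algebra.smul_def]; exact P.smul_mem r hy }
  have hS : S = ⊤ := subalgebra_eq_top S hg ht
  have hy : y ∈ S := hS ▸ Algebra.mem_top
  simpa using hy 1 h1

/-- The natural homomorphism `Y_{d,n}(u) → Y_{d,n+1}(u)`. -/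
def incl (d : ℕ) (u : ℂ) (n : ℕ) : Yokonuma d u n →ₐ[ℂ] Yokonuma d u (n + 1) :=
  lift ((isYok d u (n + 1)).mono n.le_succ)

lemma incl_gN {i : ℕ} (hi : i + 1 < n) : incl d u n (gN d u n i) = gN d u (n + 1) i := lift_gN _ hi
lemma incl_tN {j : ℕ} (hj : j < n) : incl d u n (tN d u n j) = tN d u (n + 1) j := lift_tN _ hj

end Yokonuma

section Expansion

variable {d : ℕ} [NeZero d] {u : ℂ} {R B : Type*} [Ring R] [Algebra ℂ R] [Ring B] [Algebra ℂ B]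

/-- The linear map `∑ r_k τ^k ↦ ∑ θ(r_k) y_k`. -/
def evalRow (θ : R →ₐ[ℂ] B) (y : ZMod d → B) : AddMonoidAlgebra R (ZMod d) →ₗ[ℂ] B where
  toFun a := ∑ k, θ (a.coeff k) * y k
  map_add' a b := by simp [add_mul, Finset.sum_add_distrib]
  map_smul' c a := by simp [Finset.smul_sum]

/-- The inclusion of coefficients. -/
abbrev coefHom (d : ℕ) (R : Type*) [Ring R] [Algebra ℂ R] : R →ₐ[ℂ] AddMonoidAlgebra R (ZMod d) :=
  AddMonoidAlgebra.singleZeroAlgHom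

/-- The formal framing generator of the last strand. -/
abbrev tau (d : ℕ) (R : Type*) [Ring R] : AddMonoidAlgebra R (ZMod d) :=
  AddMonoidAlgebra.single 1 1

lemma coefHom_apply (r : R) : coefHom d R r = AddMonoidAlgebra.single 0 r := rfl

lemma tau_comm (a : AddMonoidAlgebra R (ZMod d)) : tau d R * a = a * tau d R := by
  induction a using AddMonoidAlgebra.induction_linear with
  | zero => simp
  | add a b ha hb => rw [mul_add, add_mul, ha, hb]
  | single k r => simp [AddMonoidAlgebra.single_mul_single, add_comm]

lemma tau_pow (k : ℕ) : tau d R ^ k = AddMonoidAlgebra.single (k : ZMod d) 1 := by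
  induction k with
  | zero => simp [AddMonoidAlgebra.one_def]
  | succ k ih => rw [pow_succ, ih, AddMonoidAlgebra.single_mul_single]; simp

lemma tau_pow_d : tau d R ^ d = 1 := by
  rw [tau_pow]; simp [AddMonoidAlgebra.one_def]

lemma evalRow_single (θ : R →ₐ[ℂ] B) (y : ZMod d → B) (k : ZMod d) (r : R) :
    evalRow θ y (AddMonoidAlgebra.single k r) = θ r * y k := by
  show ∑ l, θ ((AddMonoidAlgebra.single k r).coeff l) * y l = _
  rw [Finset.sum_eq_single k]
  · simp
  · intro l _ hl; simp [hl.symm]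
  · simp

lemma evalRow_coef_mul (θ : R →ₐ[ℂ] B) (y : ZMod d → B) (r : R) (a : AddMonoidAlgebra R (ZMod d)) :
    evalRow θ y (coefHom d R r * a) = θ r * evalRow θ y a := by
  induction a using AddMonoidAlgebra.induction_linear with
  | zero => simp
  | add a b ha hb => rw [mul_add, map_add, map_add, ha, hb, mul_add]
  | single k s =>
    rw [coefHom_apply, AddMonoidAlgebra.single_mul_single, evalRow_single, evalRow_single, zero_add,
      map_mul, mul_assoc]

lemma evalRow_mul_coef {θ : R →ₐ[ℂ] B} {y : ZMod d → B} {r : R} {c : B}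
    (h : ∀ k, θ r * y k = y k * c) (a : AddMonoidAlgebra R (ZMod d)) :
    evalRow θ y (a * coefHom d R r) = evalRow θ y a * c := by
  induction a using AddMonoidAlgebra.induction_linear with
  | zero => simp
  | add a b ha hb => rw [add_mul, map_add, map_add, ha, hb, add_mul]
  | single k s =>
    rw [coefHom_apply, AddMonoidAlgebra.single_mul_single, evalRow_single, evalRow_single, add_zero,
      map_mul, mul_assoc, h, mul_assoc]

lemma evalRow_mul_tau {θ : R →ₐ[ℂ] B} {y : ZMod d → B} {c : B}
    (h : ∀ k, y (k + 1) = y k * c) (a : AddMonoidAlgebra R (ZMod d)) :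
    evalRow θ y (a * tau d R) = evalRow θ y a * c := by
  induction a using AddMonoidAlgebra.induction_linear with
  | zero => simp
  | add a b ha hb => rw [add_mul, map_add, map_add, ha, hb, add_mul]
  | single k s =>
    rw [AddMonoidAlgebra.single_mul_single, evalRow_single, evalRow_single, mul_one, h, mul_assoc]

lemma evalRow_mul_right {θ : R →ₐ[ℂ] B} {y y' : ZMod d → B} {c : B} (h : ∀ k, y k * c = y' k)
    (a : AddMonoidAlgebra R (ZMod d)) : evalRow θ y a * c = evalRow θ y' a := by
  show (∑ k, θ (a.coeff k) * y k) * c = ∑ k, θ (a.coeff k) * y' k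
  simp only [Finset.sum_mul, mul_assoc, h]

lemma evalRow_mul_avg {L : AddMonoidAlgebra R (ZMod d) →ₗ[ℂ] B}
    {p q : AddMonoidAlgebra R (ZMod d)} {a b : B} (hp : ∀ f, L (f * p) = L f * a)
    (hq : ∀ f, L (f * q) = L f * b) (f : AddMonoidAlgebra R (ZMod d)) :
    L (f * avgIdem d p q) = L f * avgIdem d a b := by
  have hp' : ∀ (k : ℕ) (f), L (f * p ^ k) = L f * a ^ k := by
    intro k
    induction k with
    | zero => simp
    | succ k ih => intro f; rw [pow_succ, ← mul_assoc, hp, ih, mul_assoc, ← pow_succ]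
  have hq' : ∀ (k : ℕ) (f), L (f * q ^ k) = L f * b ^ k := by
    intro k
    induction k with
    | zero => simp
    | succ k ih => intro f; rw [pow_succ, ← mul_assoc, hq, ih, mul_assoc, ← pow_succ]
  simp only [avgIdem, mul_smul_comm, map_smul, Finset.mul_sum, map_sum, ← mul_assoc, hq', hp']

/-- The product `g_{m-1} g_{m-2} ⋯ g_i`. -/
def desc (g : ℕ → B) (m i : ℕ) : B := ((List.range' i (m - i)).reverse.map g).prod

lemma desc_self (g : ℕ → B) (m : ℕ) : desc g m m = 1 := by simp [desc]

lemma desc_step (g : ℕ → B) {m i : ℕ} (h : i < m) : desc g m i = desc g m (i + 1) * g i := by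
  obtain ⟨k, rfl⟩ : ∃ k, m = i + k + 1 := ⟨m - i - 1, by omega⟩
  simp only [desc]
  rw [show i + k + 1 - i = k + 1 by omega, show i + k + 1 - (i + 1) = k by omega]
  simp [List.range'_succ]

lemma desc_top (g : ℕ → B) {m i : ℕ} (h : i ≤ m) : desc g (m + 1) i = g m * desc g m i := by
  induction h using Nat.decreasingInduction with
  | self => rw [desc_step g (Nat.lt_succ_self m), desc_self, desc_self, one_mul, mul_one]
  | of_succ k hk ih => rw [desc_step g (by omega), ih, desc_step g hk, mul_assoc]

section Desc

variable {g t : ℕ → B} {m : ℕ}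

lemma desc_mul_t_of_lt (h : IsYok d u (m + 1) g t) {i j : ℕ} (hi : i ≤ m) (hj : j < i) :
    desc g m i * t j = t j * desc g m i := by
  induction hi using Nat.decreasingInduction with
  | self => simp [desc_self]
  | of_succ k hk ih =>
    rw [desc_step g hk, mul_assoc, ← h.tg3 k j (by omega) (by omega) (by omega) (by omega),
      ← mul_assoc, ih (by omega), mul_assoc]

lemma desc_mul_t_of_gt (h : IsYok d u (m + 1) g t) {i j : ℕ} (hi : i ≤ m) (hj : i < j) (hjm : j ≤ m) :
    desc g m i * t j = t (j - 1) * desc g m i := by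
  induction hi using Nat.decreasingInduction with
  | self => omega
  | of_succ k hk ih =>
    rw [desc_step g hk, mul_assoc]
    rcases Nat.lt_or_ge (k + 1) j with h1 | h1
    · rw [← h.tg3 k j (by omega) (by omega) (by omega) (by omega), ← mul_assoc, ih h1, mul_assoc]
    · obtain rfl : j = k + 1 := by omega
      rw [← h.tg1 k (by omega), ← mul_assoc, desc_mul_t_of_lt h (by omega) (by omega), mul_assoc,
        Nat.add_sub_cancel]

lemma desc_mul_g_of_lt (h : IsYok d u (m + 1) g t) {i j : ℕ} (hi : i ≤ m) (hj : j + 1 < i) :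
    desc g m i * g j = g j * desc g m i := by
  induction hi using Nat.decreasingInduction with
  | self => simp [desc_self]
  | of_succ k hk ih =>
    rw [desc_step g hk, mul_assoc, ← h.far j k (by omega) (by omega), ← mul_assoc, ih (by omega),
      mul_assoc]

lemma desc_mul_g_of_gt (h : IsYok d u (m + 1) g t) {i j : ℕ} (hi : i ≤ m) (hj : i < j) (hjm : j < m) :
    desc g m i * g j = g (j - 1) * desc g m i := by
  induction hi using Nat.decreasingInduction with
  | self => omega
  | of_succ k hk ih =>
    rcases Nat.lt_or_ge (k + 1) j with h1 | h1
    · rw [desc_step g hk, mul_assoc, h.far k j (by omega) (by omega), ← mul_assoc, ih h1, mul_assoc]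
    · obtain rfl : j = k + 1 := by omega
      have := h.braid k (by omega)
      rw [desc_step g hk, desc_step g hjm]
      simp only [Nat.add_sub_cancel, mul_assoc] at this ⊢
      rw [← this, ← mul_assoc, desc_mul_g_of_lt h (by omega) (by omega), mul_assoc]

/-- The element `g_{m-1} ⋯ g_i t_i^k`. -/
def bvec (d : ℕ) (g t : ℕ → B) (m i : ℕ) (k : ZMod d) : B := desc g m i * t i ^ k.val

lemma pow_val_succ {p : B} (hp : p ^ d = 1) (k : ZMod d) : p ^ (k + 1).val = p ^ k.val * p := by
  have : (k + 1).val % d = (k.val + 1) % d := by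
    rw [Nat.mod_eq_of_lt (ZMod.val_lt _)]
    conv_lhs => rw [← ZMod.natCast_zmod_val k]
    rw [← Nat.cast_one, ← Nat.cast_add, ZMod.val_natCast]
  rw [← pow_succ, pow_eq_pow_mod (k + 1).val hp, this, ← pow_eq_pow_mod _ hp]

/-- The element of `B` with given row of coefficients. -/
def rowSum (θ : R →ₐ[ℂ] B) (g t : ℕ → B) (m : ℕ) :
    (ℕ → AddMonoidAlgebra R (ZMod d)) →ₗ[ℂ] B :=
  ∑ i ∈ Finset.range (m + 1), (evalRow θ (bvec d g t m i)) ∘ₗ LinearMap.proj i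

lemma rowSum_apply (θ : R →ₐ[ℂ] B) (f : ℕ → AddMonoidAlgebra R (ZMod d)) :
    rowSum θ g t m f = ∑ i ∈ Finset.range (m + 1), evalRow θ (bvec d g t m i) (f i) := by
  simp [rowSum]

lemma rowSum_opD (h : IsYok d u (m + 1) g t) {θ : R →ₐ[ℂ] B} {T : ℕ → R} {n : ℕ}
    (hmn : m ≤ n) (hT : ∀ j, j < m → θ (T j) = t j) {j : ℕ} (hj : j ≤ m)
    (f : ℕ → AddMonoidAlgebra R (ZMod d)) :
    rowSum θ g t m (opD (diagT n (fun i => coefHom d R (T i)) (tau d R) j) f) =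
      rowSum θ g t m f * t j := by
  rw [rowSum_apply, rowSum_apply, Finset.sum_mul]
  refine Finset.sum_congr rfl fun i hi => ?_
  have hi' := Finset.mem_range.mp hi
  rw [opD_apply]
  have hc : ∀ k : ℕ, t i ^ k * t j = t j * t i ^ k := fun k =>
    ((show Commute (t i) (t j) from h.tcomm i j (by omega) (by omega)).pow_left k).eq
  rcases lt_trichotomy i j with h1 | h1 | h1
  · rw [diagT_lt (by omega) h1]
    refine evalRow_mul_coef (fun k => ?_) _
    rw [hT _ (by omega), bvec, mul_assoc, hc, ← mul_assoc, ← mul_assoc,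
      desc_mul_t_of_gt h (by omega) h1 hj]
  · rw [diagT_eq (by omega) h1]
    refine evalRow_mul_tau (fun k => ?_) _
    rw [bvec, bvec, pow_val_succ (h.tpow i (by omega)), mul_assoc, h1]
  · rw [diagT_gt (by omega) h1]
    refine evalRow_mul_coef (fun k => ?_) _
    rw [hT _ (by omega), bvec, mul_assoc, hc, ← mul_assoc, ← mul_assoc,
      desc_mul_t_of_lt h (by omega) h1]

lemma rowSum_opG (h : IsYok d u (m + 1) g t) {θ : R →ₐ[ℂ] B} {G T : ℕ → R} {n : ℕ}
    (hmn : m ≤ n) (hG : ∀ i, i + 1 < m → θ (G i) = g i) (hT : ∀ j, j < m → θ (T j) = t j)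
    {j : ℕ} (hj : j < m) (f : ℕ → AddMonoidAlgebra R (ZMod d)) :
    rowSum θ g t m (opG d u n (fun i => coefHom d R (G i)) (fun i => coefHom d R (T i))
      (tau d R) j f) = rowSum θ g t m f * g j := by
  rw [rowSum_apply, rowSum_apply, Finset.sum_mul]
  have hjs : j ∈ Finset.range (m + 1) := Finset.mem_range.mpr (by omega)
  have hjs' : j + 1 ∈ (Finset.range (m + 1)).erase j :=
    Finset.mem_erase.mpr ⟨by omega, Finset.mem_range.mpr (by omega)⟩
  rw [← Finset.add_sum_erase _ _ hjs, ← Finset.add_sum_erase _ _ hjs',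
    ← Finset.add_sum_erase _ _ hjs, ← Finset.add_sum_erase _ _ hjs', ← add_assoc, ← add_assoc]
  congr 1
  · set L := evalRow θ (bvec d g t m j) with hL
    set L' := evalRow θ (bvec d g t m (j + 1)) with hL'
    rw [opG_eq (by omega) rfl, opG_succ (by omega) rfl]
    have e1 : ∀ a, L' a * g j = L a := evalRow_mul_right fun k => by
      rw [bvec, bvec, mul_assoc, ((show SemiconjBy (g j) (t j) (t (j+1)) from
        (h.tg2 j (by omega)).symm).pow_right _).eq.symm, ← mul_assoc, ← desc_step g hj]
    have e2 : ∀ a, L (a * tau d R) = L a * t j := evalRow_mul_tau fun k => by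
      rw [bvec, bvec, pow_val_succ (h.tpow j (by omega)), mul_assoc]
    have e3 : ∀ a, L (a * coefHom d R (T j)) = L a * t (j + 1) := evalRow_mul_coef fun k => by
      rw [hT _ hj, bvec, mul_assoc, ((show Commute (t j) (t (j + 1)) from
        h.tcomm _ _ (by omega) (by omega)).pow_left _).eq, ← mul_assoc, ← mul_assoc,
        desc_mul_t_of_gt h (by omega) (by omega) (by omega), Nat.add_sub_cancel]
    have e4 : ∀ a, L' (a * tau d R) = L' a * t (j + 1) := evalRow_mul_tau fun k => by
      rw [bvec, bvec, pow_val_succ (h.tpow (j + 1) (by omega)), mul_assoc]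
    have e5 : ∀ a, L' (a * coefHom d R (T j)) = L' a * t j := evalRow_mul_coef fun k => by
      rw [hT _ hj, bvec, mul_assoc, ((show Commute (t (j + 1)) (t j) from
        h.tcomm _ _ (by omega) (by omega)).pow_left _).eq, ← mul_assoc, ← mul_assoc,
        desc_mul_t_of_lt h (by omega) (by omega)]
    have e6 := evalRow_mul_avg e3 e2
    have e7 := evalRow_mul_avg e5 e4
    have hs : avgIdem d (t (j + 1)) (t j) = avgIdem d (t j) (t (j + 1)) :=
      avgIdem_symm (h.tcomm _ _ (by omega) (by omega)) (h.tpow _ (by omega)) (h.tpow _ (by omega))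
    have hge : avgIdem d (t j) (t (j + 1)) * g j = g j * avgIdem d (t j) (t (j + 1)) := by
      rw [avgIdem_conj (h.tg1 j (by omega)) (h.tg2 j (by omega)), hs]
    have e8 : L (f j) * g j = L' (f j) + (u - 1) • (L' (f j) * avgIdem d (t j) (t (j + 1))) +
        (u - 1) • (L (f j) * avgIdem d (t j) (t (j + 1))) := by
      rw [← e1 (f j), mul_assoc, h.quad j (by omega), mul_add, mul_add, mul_one, mul_smul_comm,
        mul_smul_comm, hge, ← mul_assoc (L' (f j)) (g j)]
    simp only [map_add, map_smul]
    rw [e6, e7, e1, e8, hs]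
    abel
  · refine Finset.sum_congr rfl fun i hi => ?_
    simp only [Finset.mem_erase, Finset.mem_range] at hi
    have hc : i ≠ j → i ≠ j + 1 → ∀ k : ℕ, t i ^ k * g j = g j * t i ^ k := fun h1 h2 k =>
      ((show SemiconjBy (g j) (t i) (t i) from
        (h.tg3 j i (by omega) (by omega) h1 h2).symm).pow_right k).eq.symm
    rcases lt_or_gt_of_ne hi.2.1 with h1 | h1
    · rw [opG_lt (by omega) h1]
      refine evalRow_mul_coef (fun k => ?_) _
      rw [hG _ (by omega), bvec, mul_assoc, hc (by omega) (by omega), ← mul_assoc, ← mul_assoc,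
        desc_mul_g_of_gt h (by omega) h1 hj]
    · rw [opG_gt (by omega) (by omega)]
      refine evalRow_mul_coef (fun k => ?_) _
      rw [hG _ (by omega), bvec, mul_assoc, hc (by omega) (by omega), ← mul_assoc, ← mul_assoc,
        desc_mul_g_of_lt h (by omega) (by omega)]

end Desc

end Expansion

namespace Yokonuma

section Tower

variable {d : ℕ} [NeZero d] {u : ℂ} {n : ℕ}

/-- The action of `Y_{d,n+1}(u)` on rows with entries in the group algebra over `Y_{d,n}(u)`. -/
def rowHom (d : ℕ) [NeZero d] (u : ℂ) (n : ℕ) : Yokonuma d u (n + 1) →ₐ[ℂ]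
    (Module.End (AddMonoidAlgebra (Yokonuma d u n) (ZMod d))
      (ℕ → AddMonoidAlgebra (Yokonuma d u n) (ZMod d)))ᵐᵒᵖ :=
  lift (isYok_rows ((isYok d u n).map (coefHom d (Yokonuma d u n))) tau_comm tau_pow_d)

/-- The action of `y` on the row `f`. -/
def act (y : Yokonuma d u (n + 1)) (f : ℕ → AddMonoidAlgebra (Yokonuma d u n) (ZMod d)) :
    ℕ → AddMonoidAlgebra (Yokonuma d u n) (ZMod d) := (rowHom d u n y).unop f

variable {f f' : ℕ → AddMonoidAlgebra (Yokonuma d u n) (ZMod d)}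

lemma act_mul (y y' : Yokonuma d u (n + 1)) : act (y * y') f = act y' (act y f) := by
  simp [act]

lemma act_one : act (1 : Yokonuma d u (n + 1)) f = f := by
  simp [act]

lemma act_smul (a : AddMonoidAlgebra (Yokonuma d u n) (ZMod d)) (y : Yokonuma d u (n + 1)) :
    act y (a • f) = a • act y f := by
  simp [act]

lemma act_gN {j : ℕ} (hj : j < n) : act (gN d u (n + 1) j) f =
    opG d u n (fun i => coefHom d _ (gN d u n i)) (fun i => coefHom d _ (tN d u n i)) (tau d _) j f := by
  rw [act, rowHom, lift_gN _ (by omega)]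
  rfl

lemma act_tN {j : ℕ} (hj : j ≤ n) : act (tN d u (n + 1) j) f =
    opD (diagT n (fun i => coefHom d _ (tN d u n i)) (tau d _) j) f := by
  rw [act, rowHom, lift_tN _ (by omega)]
  rfl

/-- The row of coefficients of `y`. -/
def row (d : ℕ) [NeZero d] (u : ℂ) (n : ℕ) : Yokonuma d u (n + 1) →ₗ[ℂ]
    (ℕ → AddMonoidAlgebra (Yokonuma d u n) (ZMod d)) where
  toFun y := act y (Pi.single n 1)
  map_add' a b := by simp [act]
  map_smul' c a := by simp [act]

lemma row_mul (y y' : Yokonuma d u (n + 1)) : row d u n (y * y') = act y' (row d u n y) :=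
  act_mul y y'

lemma row_one : row d u n 1 = Pi.single n 1 := act_one

lemma row_expand (y : Yokonuma d u (n + 1)) :
    rowSum (incl d u n) (gN d u (n + 1)) (tN d u (n + 1)) n (row d u n y) = y := by
  refine right_induction (LinearMap.eqLocus ((rowSum (incl d u n) (gN d u (n + 1))
    (tN d u (n + 1)) n).comp (row d u n)) LinearMap.id) ?_ ?_ ?_ y
  · show rowSum _ _ _ _ (row d u n 1) = 1
    rw [row_one, rowSum_apply, Finset.sum_eq_single n]
    · rw [Pi.single_eq_same, AddMonoidAlgebra.one_def, evalRow_single]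
      simp [bvec, desc_self]
    · intro i _ hi
      rw [Pi.single_eq_of_ne hi, map_zero]
    · simp
  · intro i hi y hy
    have hy : rowSum (incl d u n) (gN d u (n + 1)) (tN d u (n + 1)) n (row d u n y) = y := hy
    show rowSum (incl d u n) (gN d u (n + 1)) (tN d u (n + 1)) n (row d u n (y * _)) = y * _
    rw [row_mul, act_gN (by omega), rowSum_opG (isYok d u (n + 1)) le_rfl (fun i hi => incl_gN hi)
      (fun j hj => incl_tN hj) (by omega), hy]
  · intro j hj y hy
    have hy : rowSum (incl d u n) (gN d u (n + 1)) (tN d u (n + 1)) n (row d u n y) = y := hy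
    show rowSum (incl d u n) (gN d u (n + 1)) (tN d u (n + 1)) n (row d u n (y * _)) = y * _
    rw [row_mul, act_tN (by omega), rowSum_opD (isYok d u (n + 1)) le_rfl
      (fun j hj => incl_tN hj) (by omega), hy]

/-- `Y_{d,n+1}(u)` is spanned by the elements `w t_{n+1}^k` and `w g_n v`. -/
lemma span_induction (P : Submodule ℂ (Yokonuma d u (n + 1)))
    (h1 : ∀ (w : Yokonuma d u n) (k : ℕ), incl d u n w * tN d u (n + 1) n ^ k ∈ P)
    (h2 : 0 < n → ∀ w v : Yokonuma d u n,
      incl d u n w * gN d u (n + 1) (n - 1) * incl d u n v ∈ P)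
    (y : Yokonuma d u (n + 1)) : y ∈ P := by
  rw [← row_expand y, rowSum_apply]
  refine P.sum_mem fun i hi => ?_
  have hi' := Finset.mem_range.mp hi
  show ∑ k, _ ∈ P
  refine P.sum_mem fun k _ => ?_
  rcases Nat.lt_or_ge i n with h | h
  · obtain ⟨m, rfl⟩ : ∃ m, n = m + 1 := ⟨n - 1, by omega⟩
    have key : ∀ i ≤ m, desc (gN d u (m + 1 + 1)) m i =
        incl d u (m + 1) (desc (gN d u (m + 1)) m i) := by
      intro i hi
      induction hi using Nat.decreasingInduction with
      | self => simp [desc_self]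
      | of_succ k hk ih => rw [desc_step _ hk, desc_step _ hk, ih, map_mul, incl_gN (by omega)]
    rw [bvec, desc_top _ (by omega), key i (by omega), ← incl_tN (by omega), ← map_pow, mul_assoc,
      ← map_mul, ← mul_assoc]
    exact h2 (by omega) _ _
  · obtain rfl : i = n := by omega
    rw [bvec, desc_self, one_mul]
    exact h1 _ _

lemma row_incl (w : Yokonuma d u n) :
    row d u n (incl d u n w) = coefHom d _ w • (Pi.single n 1) := by
  refine right_induction (LinearMap.eqLocus ((row d u n).comp (incl d u n).toLinearMap)
    ((LinearMap.toSpanSingleton (AddMonoidAlgebra (Yokonuma d u n) (ZMod d)) _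
      (Pi.single n 1 : ℕ → AddMonoidAlgebra (Yokonuma d u n) (ZMod d))).restrictScalars ℂ ∘ₗ
      (coefHom d (Yokonuma d u n)).toLinearMap)) ?_ ?_ ?_ w
  · show row d u n (incl d u n 1) = coefHom d (Yokonuma d u n) 1 • (Pi.single n 1)
    rw [map_one (incl d u n), row_one, map_one, one_smul]
  · intro i hi y hy
    have hy : row d u n (incl d u n y) = coefHom d _ y • (Pi.single n 1) := hy
    show row d u n (incl d u n (y * _)) = coefHom d _ (y * _) • (Pi.single n 1)
    rw [map_mul, row_mul, hy, act_smul, map_mul, mul_smul, incl_gN hi, act_gN (by omega)]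
    congr 1
    funext c
    rcases lt_trichotomy c n with hc | rfl | hc
    · have : ∀ c' < n, (Pi.single n 1 : ℕ → AddMonoidAlgebra (Yokonuma d u n) (ZMod d)) c' = 0 :=
        fun c' hc' => Pi.single_eq_of_ne (by omega) _
      simp only [Pi.smul_apply]
      rw [this c hc, smul_zero]
      have hcases : c < i ∨ c = i ∨ c = i + 1 ∨ i + 1 < c := by omega
      rcases hcases with h | h | h | h
      · rw [opG_lt (by omega) h, this c hc, zero_mul]
      · rw [opG_eq (by omega) h, this i (by omega), this (i + 1) (by omega)]; simp
      · rw [opG_succ (by omega) h, this i (by omega)]; simp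
      · rw [opG_gt (by omega) h, this c hc, zero_mul]
    · rw [opG_gt le_rfl (by omega)]; simp
    · rw [opG_out hc, Pi.single_eq_of_ne (by omega)]
      simp [Pi.single_eq_of_ne (show c ≠ n by omega)]
  · intro j hj y hy
    have hy : row d u n (incl d u n y) = coefHom d _ y • (Pi.single n 1) := hy
    show row d u n (incl d u n (y * _)) = coefHom d _ (y * _) • (Pi.single n 1)
    rw [map_mul, row_mul, hy, act_smul, map_mul, mul_smul, incl_tN hj, act_tN (by omega)]
    congr 1
    funext c
    rw [opD_apply]
    rcases eq_or_ne c n with rfl | hc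
    · rw [diagT_gt le_rfl hj]; simp
    · simp [Pi.single_eq_of_ne hc]

variable (z : ℂ) (x : ZMod d → ℂ)

/-- The part of the conditional expectation that involves `g_n`. -/
def condG (d : ℕ) [NeZero d] (u : ℂ) : (n : ℕ) →
    (ℕ → AddMonoidAlgebra (Yokonuma d u n) (ZMod d)) →ₗ[ℂ] Yokonuma d u n
  | 0 => 0
  | m + 1 => rowSum (AlgHom.id ℂ _) (gN d u (m + 1)) (tN d u (m + 1)) m

/-- The conditional expectation `Y_{d,n+1}(u) → Y_{d,n}(u)` with `w g_n v ↦ z w v` and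
`w t_{n+1}^k ↦ x_k w`. -/
def condExp (d : ℕ) [NeZero d] (u z : ℂ) (x : ZMod d → ℂ) (n : ℕ) :
    Yokonuma d u (n + 1) →ₗ[ℂ] Yokonuma d u n :=
  (evalRow (AlgHom.id ℂ _) (fun k => algebraMap ℂ _ (x k)) ∘ₗ LinearMap.proj n + z • condG d u n) ∘ₗ
    row d u n

lemma condExp_apply (y : Yokonuma d u (n + 1)) : condExp d u z x n y =
    evalRow (AlgHom.id ℂ _) (fun k => algebraMap ℂ _ (x k)) (row d u n y n) +
      z • condG d u n (row d u n y) := rfl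

lemma condG_smul (w : Yokonuma d u n) (f : ℕ → AddMonoidAlgebra (Yokonuma d u n) (ZMod d)) :
    condG d u n (coefHom d _ w • f) = w * condG d u n f := by
  cases n with
  | zero => simp [condG]
  | succ m =>
    rw [condG, rowSum_apply, rowSum_apply, Finset.mul_sum]
    exact Finset.sum_congr rfl fun i _ => evalRow_coef_mul _ _ _ _

lemma condExp_left (w : Yokonuma d u n) (y : Yokonuma d u (n + 1)) :
    condExp d u z x n (incl d u n w * y) = w * condExp d u z x n y := by
  have : row d u n (incl d u n w * y) = coefHom d _ w • row d u n y := by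
    rw [row_mul, row_incl, act_smul]; rfl
  rw [condExp_apply, condExp_apply, this, condG_smul, mul_add, mul_smul_comm]
  congr 1
  exact evalRow_coef_mul _ _ _ _

lemma condExp_right (y : Yokonuma d u (n + 1)) (v : Yokonuma d u n) :
    condExp d u z x n (y * incl d u n v) = condExp d u z x n y * v := by
  have hx : ∀ (a : AddMonoidAlgebra (Yokonuma d u n) (ZMod d)) (r : Yokonuma d u n),
      evalRow (AlgHom.id ℂ _) (fun k => algebraMap ℂ (Yokonuma d u n) (x k)) (a * coefHom d _ r) =
      evalRow (AlgHom.id ℂ _) (fun k => algebraMap ℂ _ (x k)) a * r := fun a r =>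
    evalRow_mul_coef (fun k => (Algebra.commutes _ _).symm) a
  revert y
  let P : Submodule ℂ (Yokonuma d u n) :=
    { carrier := {v | ∀ y, condExp d u z x n (y * incl d u n v) = condExp d u z x n y * v}
      zero_mem' := by simp
      add_mem' := fun {a b} ha hb y => by
        rw [map_add, mul_add, map_add, ha, hb, mul_add]
      smul_mem' := fun c a ha y => by
        rw [map_smul, mul_smul_comm, map_smul, ha, mul_smul_comm] }
  refine right_induction P ?_ ?_ ?_ v
  · intro y; simp
  · intro i hi v hv y
    rw [map_mul (incl d u n), ← mul_assoc, ← mul_assoc, ← hv y]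
    generalize y * incl d u n v = y'
    rw [condExp_apply, condExp_apply, row_mul, incl_gN hi, act_gN (by omega), add_mul,
      smul_mul_assoc]
    congr 2
    · rw [opG_gt le_rfl (by omega), hx]
    · obtain ⟨m, rfl⟩ : ∃ m, n = m + 1 := ⟨n - 1, by omega⟩
      exact rowSum_opG (isYok d u (m + 1)) (by omega) (fun _ _ => rfl) (fun _ _ => rfl) (by omega) _
  · intro i hi v hv y
    rw [map_mul (incl d u n), ← mul_assoc, ← mul_assoc, ← hv y]
    generalize y * incl d u n v = y'
    rw [condExp_apply, condExp_apply, row_mul, incl_tN hi, act_tN (by omega), add_mul,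
      smul_mul_assoc]
    congr 2
    · rw [opD_apply, diagT_gt le_rfl hi, hx]
    · obtain ⟨m, rfl⟩ : ∃ m, n = m + 1 := ⟨n - 1, by omega⟩
      exact rowSum_opD (isYok d u (m + 1)) (by omega) (fun _ _ => rfl) (by omega) _

lemma row_t_pow (k : ℕ) : row d u n (tN d u (n + 1) n ^ k) =
    tau d (Yokonuma d u n) ^ k • (Pi.single n 1 : ℕ → AddMonoidAlgebra (Yokonuma d u n) (ZMod d)) := by
  induction k with
  | zero => rw [pow_zero, pow_zero, row_one, one_smul]
  | succ k ih =>
    rw [pow_succ, row_mul, ih, act_smul, act_tN le_rfl, pow_succ, mul_smul]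
    congr 1
    funext c
    rw [opD_apply]
    rcases eq_or_ne c n with rfl | hc
    · rw [diagT_eq le_rfl rfl]; simp
    · simp [Pi.single_eq_of_ne hc]

lemma condG_tau_smul (k : ℕ) : condG d u n (tau d (Yokonuma d u n) ^ k •
    (Pi.single n 1 : ℕ → AddMonoidAlgebra (Yokonuma d u n) (ZMod d))) = 0 := by
  cases n with
  | zero => rfl
  | succ m =>
    rw [condG, rowSum_apply]
    refine Finset.sum_eq_zero fun i hi => ?_
    rw [Pi.smul_apply, Pi.single_eq_of_ne (by have := Finset.mem_range.mp hi; omega), smul_zero,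
      map_zero]

lemma condExp_t_pow (k : ℕ) :
    condExp d u z x n (tN d u (n + 1) n ^ k) = algebraMap ℂ _ (x k) := by
  rw [condExp_apply, row_t_pow, condG_tau_smul, smul_zero, add_zero, Pi.smul_apply,
    Pi.single_eq_same, smul_eq_mul, mul_one, tau_pow, evalRow_single]
  simp

lemma condExp_g : condExp d u z x (n + 1) (gN d u (n + 2) n) = algebraMap ℂ _ z := by
  have h : row d u (n + 1) (gN d u (n + 2) n) = Pi.single n 1 := by
    rw [← one_mul (gN d u (n + 2) n), row_mul, row_one, act_gN (by omega)]
    funext c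
    have hs : ∀ c' ≠ n + 1,
        (Pi.single (n + 1) 1 : ℕ → AddMonoidAlgebra (Yokonuma d u (n + 1)) (ZMod d)) c' = 0 :=
      fun c' hc' => Pi.single_eq_of_ne hc' _
    have hcases : c < n ∨ c = n ∨ c = n + 1 ∨ n + 1 < c := by omega
    rcases hcases with h | h | h | h
    · rw [opG_lt (by omega) h, hs c (by omega), Pi.single_eq_of_ne (by omega), zero_mul]
    · rw [opG_eq (by omega) h, h, hs n (by omega)]; simp
    · rw [opG_succ (by omega) h, hs n (by omega), Pi.single_eq_of_ne (by omega)]; simp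
    · rw [opG_out h, hs c (by omega), Pi.single_eq_of_ne (by omega), neg_zero]
  rw [condExp_apply, h, Pi.single_eq_of_ne (by omega), map_zero, zero_add, condG, rowSum_apply,
    Finset.sum_eq_single n]
  · rw [Pi.single_eq_same, AddMonoidAlgebra.one_def, evalRow_single]
    simp [bvec, desc_self, Algebra.algebraMap_eq_smul_one]
  · intro i _ hi
    rw [Pi.single_eq_of_ne hi, map_zero]
  · simp

/-- The Juyumaya trace with parameters `z` and `x_1, …, x_{d-1}`, strand by strand. -/
def traceAux (d : ℕ) [NeZero d] (u z : ℂ) (x : ZMod d → ℂ) : (n : ℕ) → Yokonuma d u n →ₗ[ℂ] ℂ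
  | 0 => (lift (G := fun _ => 0) (T := fun _ => 0) (by constructor <;> intros <;> omega) :
      Yokonuma d u 0 →ₐ[ℂ] ℂ).toLinearMap
  | n + 1 => traceAux d u z x n ∘ₗ condExp d u z x n

end Tower

end Yokonuma

namespace Yokonuma

section TraceProperty

variable {d : ℕ} [NeZero d] {u z : ℂ} {x : ZMod d → ℂ} {n : ℕ}

/-- The value of the conditional expectation on `g_n t_n^k g_n`, as a polynomial in `p = t_n`. -/
def sPoly (d : ℕ) (u z : ℂ) (x : ZMod d → ℂ) {B : Type*} [Ring B] [Algebra ℂ B] (k : ℕ) (p : B) :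
    B :=
  x k • 1 + (u - 1) • ((1 / (d : ℂ)) • ∑ s ∈ Finset.range d, x (k - s) • p ^ s) +
    ((u - 1) * z) • p ^ k

lemma sPoly_mul {B : Type*} [Ring B] [Algebra ℂ B] (k : ℕ) {p p' c : B} (h : p * c = c * p') :
    sPoly d u z x k p * c = c * sPoly d u z x k p' := by
  have key : ∀ j : ℕ, p ^ j * c = c * p' ^ j := fun j => (SemiconjBy.pow_right
    (show SemiconjBy c p' p from h.symm) j).eq.symm
  simp only [sPoly, add_mul, mul_add, smul_mul_assoc, mul_smul_comm, Finset.sum_mul, Finset.mul_sum,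
    key, one_mul, mul_one]

lemma g_comm_incl (a : Yokonuma d u n) : gN d u (n + 2) n * incl d u (n + 1) (incl d u n a) =
    incl d u (n + 1) (incl d u n a) * gN d u (n + 2) n := by
  have h := isYok d u (n + 2)
  have : (Subalgebra.centralizer ℂ {gN d u (n + 2) n}).comap
      ((incl d u (n + 1)).comp (incl d u n)) = ⊤ := by
    refine subalgebra_eq_top _ (fun i hi => ?_) (fun j hj => ?_)
    · rw [Subalgebra.mem_comap, Subalgebra.mem_centralizer_iff]
      rintro _ rfl
      rw [AlgHom.comp_apply, incl_gN hi, incl_gN (by omega), h.far i n (by omega) (by omega)]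
    · rw [Subalgebra.mem_comap, Subalgebra.mem_centralizer_iff]
      rintro _ rfl
      rw [AlgHom.comp_apply, incl_tN hj, incl_tN (by omega),
        h.tg3 n j (by omega) (by omega) (by omega) (by omega)]
  have ha : a ∈ (Subalgebra.centralizer ℂ {gN d u (n + 2) n}).comap
      ((incl d u (n + 1)).comp (incl d u n)) := this ▸ Algebra.mem_top
  rw [Subalgebra.mem_comap, Subalgebra.mem_centralizer_iff] at ha
  exact ha _ rfl

lemma t_comm_incl (a : Yokonuma d u n) : tN d u (n + 1) n * incl d u n a =
    incl d u n a * tN d u (n + 1) n := by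
  have h := isYok d u (n + 1)
  have : (Subalgebra.centralizer ℂ {tN d u (n + 1) n}).comap (incl d u n) = ⊤ := by
    refine subalgebra_eq_top _ (fun i hi => ?_) (fun j hj => ?_)
    · rw [Subalgebra.mem_comap, Subalgebra.mem_centralizer_iff]
      rintro _ rfl
      rw [incl_gN hi, h.tg3 i n (by omega) (by omega) (by omega) (by omega)]
    · rw [Subalgebra.mem_comap, Subalgebra.mem_centralizer_iff]
      rintro _ rfl
      rw [incl_tN hj, h.tcomm _ _ (by omega) (by omega)]
  have ha : a ∈ (Subalgebra.centralizer ℂ {tN d u (n + 1) n}).comap (incl d u n) :=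
    this ▸ Algebra.mem_top
  rw [Subalgebra.mem_comap, Subalgebra.mem_centralizer_iff] at ha
  exact ha _ rfl

lemma t_pow_comm_incl (a : Yokonuma d u n) (k : ℕ) : tN d u (n + 1) n ^ k * incl d u n a =
    incl d u n a * tN d u (n + 1) n ^ k :=
  ((show Commute (tN d u (n + 1) n) (incl d u n a) from t_comm_incl a).pow_left k).eq

/-- The compression of `w` by `g_{n+1}`. -/
def comp (d : ℕ) [NeZero d] (u z : ℂ) (x : ZMod d → ℂ) (n : ℕ) :
    Yokonuma d u (n + 1) →ₗ[ℂ] Yokonuma d u (n + 1) :=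
  condExp d u z x (n + 1) ∘ₗ LinearMap.mulLeft ℂ (gN d u (n + 2) n) ∘ₗ
    LinearMap.mulRight ℂ (gN d u (n + 2) n) ∘ₗ (incl d u (n + 1)).toLinearMap

lemma comp_apply (w : Yokonuma d u (n + 1)) : comp d u z x n w =
    condExp d u z x (n + 1) (gN d u (n + 2) n * (incl d u (n + 1) w * gN d u (n + 2) n)) := rfl

lemma comp_left (a : Yokonuma d u n) (w : Yokonuma d u (n + 1)) :
    comp d u z x n (incl d u n a * w) = incl d u n a * comp d u z x n w := by
  rw [comp_apply, comp_apply, map_mul (incl d u (n + 1)), ← condExp_left z x (incl d u n a)]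
  congr 1
  simp only [← mul_assoc]
  rw [g_comm_incl]

lemma comp_right (a : Yokonuma d u n) (w : Yokonuma d u (n + 1)) :
    comp d u z x n (w * incl d u n a) = comp d u z x n w * incl d u n a := by
  rw [comp_apply, comp_apply, map_mul (incl d u (n + 1)), ← condExp_right z x _ (incl d u n a)]
  congr 1
  simp only [mul_assoc]
  rw [g_comm_incl]

lemma condExp_mul_t_pow (w : Yokonuma d u n) (k : ℕ) :
    condExp d u z x n (incl d u n w * tN d u (n + 1) n ^ k) = x k • w := by
  rw [condExp_left, condExp_t_pow, ← Algebra.commutes, Algebra.smul_def]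

lemma condExp_mul_g_mul (w v : Yokonuma d u (n + 1)) :
    condExp d u z x (n + 1) (incl d u (n + 1) w * gN d u (n + 2) n * incl d u (n + 1) v) =
      z • (w * v) := by
  rw [condExp_right, condExp_left, condExp_g, ← Algebra.commutes, Algebra.smul_def, mul_assoc]

lemma comp_t_pow (k : ℕ) : comp d u z x n (tN d u (n + 1) n ^ k) =
    sPoly d u z x k (tN d u (n + 1) n) := by
  have h := isYok d u (n + 2)
  have hd : (d : ℂ) ≠ 0 := by exact_mod_cast NeZero.ne d
  have e1 : ∀ j : ℕ, tN d u (n + 2) n ^ j * gN d u (n + 2) n =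
      gN d u (n + 2) n * tN d u (n + 2) (n + 1) ^ j := fun j => (SemiconjBy.pow_right
    (show SemiconjBy (gN d u (n + 2) n) _ _ from (h.tg1 n (by omega)).symm) j).eq.symm
  have e2 : ∀ j : ℕ, tN d u (n + 2) (n + 1) ^ j * gN d u (n + 2) n =
      gN d u (n + 2) n * tN d u (n + 2) n ^ j := fun j => (SemiconjBy.pow_right
    (show SemiconjBy (gN d u (n + 2) n) _ _ from (h.tg2 n (by omega)).symm) j).eq.symm
  have hi : ∀ j : ℕ, tN d u (n + 2) n ^ j = incl d u (n + 1) (tN d u (n + 1) n ^ j) := fun j => by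
    rw [map_pow, incl_tN (by omega)]
  rw [comp_apply, map_pow, incl_tN (by omega), e1, ← mul_assoc, h.quad n (by omega), add_mul,
    add_mul, one_mul, map_add, map_add, smul_mul_assoc, smul_mul_assoc, map_smul, map_smul, sPoly]
  congr 1
  · congr 1
    · rw [condExp_t_pow, Algebra.algebraMap_eq_smul_one]
    · congr 1
      rw [avgIdem, smul_mul_assoc, map_smul, Finset.sum_mul, map_sum]
      congr 1
      refine Finset.sum_congr rfl fun s hs => ?_
      have hs' := Finset.mem_range.mp hs
      rw [mul_assoc, ← pow_add, hi, condExp_mul_t_pow]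
      congr 2
      rw [Nat.cast_add, Nat.cast_sub hs'.le]
      simp [sub_eq_neg_add, add_comm]
  · rw [mul_smul]
    congr 1
    have : ∀ s ∈ Finset.range d, condExp d u z x (n + 1)
        (tN d u (n + 2) n ^ s * tN d u (n + 2) (n + 1) ^ (d - s) *
          (gN d u (n + 2) n * tN d u (n + 2) (n + 1) ^ k)) = z • tN d u (n + 1) n ^ k := by
      intro s hs
      have hs' := Finset.mem_range.mp hs
      have hc : tN d u (n + 2) (n + 1) ^ (d - s) * tN d u (n + 2) n ^ k =
        tN d u (n + 2) n ^ k * tN d u (n + 2) (n + 1) ^ (d - s) :=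
        ((show Commute _ _ from h.tcomm (n + 1) n (by omega) (by omega)).pow_pow _ _).eq
      rw [← e1, mul_assoc, ← mul_assoc _ (tN d u (n + 2) n ^ k), hc, mul_assoc, e2, hi, hi, hi,
        ← mul_assoc, ← mul_assoc, ← map_mul, condExp_mul_g_mul, ← pow_add, ← pow_add,
        show s + k + (d - s) = d + k by omega, pow_add, (isYok d u (n + 1)).tpow n (by omega),
        one_mul]
    rw [avgIdem, smul_mul_assoc, smul_mul_assoc, map_smul, Finset.sum_mul, Finset.sum_mul, map_sum]
    simp only [mul_assoc] at this ⊢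
    rw [Finset.sum_congr rfl this, Finset.sum_const, Finset.card_range, ← Nat.cast_smul_eq_nsmul ℂ,
      smul_smul, one_div, inv_mul_cancel₀ hd, one_smul]

lemma comp_g : comp d u z x (n + 1) (gN d u (n + 2) n) =
    z • (gN d u (n + 2) n * gN d u (n + 2) n) := by
  have h := (isYok d u (n + 3)).braid n (by omega)
  rw [comp_apply, incl_gN (by omega), ← mul_assoc, ← h, ← incl_gN (by omega), condExp_mul_g_mul]

lemma trace_succ (y : Yokonuma d u (n + 1)) : traceAux d u z x (n + 1) y = traceAux d u z x n (condExp d u z x n y) := rfl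

lemma trace_mul_t_pow (w : Yokonuma d u n) (k : ℕ) :
    traceAux d u z x (n + 1) (incl d u n w * tN d u (n + 1) n ^ k) = x k * traceAux d u z x n w := by
  rw [trace_succ, condExp_mul_t_pow, map_smul, smul_eq_mul]

lemma trace_mul_g_mul (w v : Yokonuma d u (n + 1)) :
    traceAux d u z x (n + 2) (incl d u (n + 1) w * gN d u (n + 2) n * incl d u (n + 1) v) =
      z * traceAux d u z x (n + 1) (w * v) := by
  rw [trace_succ, condExp_mul_g_mul, map_smul, smul_eq_mul]

/-- The trace of `s_k(t) t^l` is symmetric in `k` and `l`. -/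
lemma trace_sPoly_symm (w : Yokonuma d u n) (k l : ℕ) :
    traceAux d u z x (n + 1) (incl d u n w * (sPoly d u z x k (tN d u (n + 1) n) * tN d u (n + 1) n ^ l)) =
    traceAux d u z x (n + 1) (incl d u n w * (tN d u (n + 1) n ^ k * sPoly d u z x l (tN d u (n + 1) n))) := by
  simp only [sPoly, add_mul, mul_add, smul_mul_assoc, mul_smul_comm, one_mul, mul_one, map_add,
    map_smul, Finset.sum_mul, Finset.mul_sum, map_sum, ← pow_add, trace_mul_t_pow, smul_eq_mul,
    Nat.cast_add]
  have : ∑ s ∈ Finset.range d, x (k - s) * (x (s + l) * traceAux d u z x n w) =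
      ∑ s ∈ Finset.range d, x (l - s) * (x (k + s) * traceAux d u z x n w) := by
    have hr : ∀ F : ZMod d → ℂ, ∑ s ∈ Finset.range d, F s = ∑ s : ZMod d, F s := by
      intro F
      refine Finset.sum_bij (fun s _ => (s : ZMod d)) (fun _ _ => Finset.mem_univ _) ?_ ?_ ?_
      · intro a ha b hb hab
        have := congrArg ZMod.val hab
        rwa [ZMod.val_natCast, ZMod.val_natCast, Nat.mod_eq_of_lt (Finset.mem_range.mp ha),
          Nat.mod_eq_of_lt (Finset.mem_range.mp hb)] at this
      · intro b _
        exact ⟨b.val, Finset.mem_range.mpr (ZMod.val_lt b), ZMod.natCast_zmod_val b⟩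
      · intros; rfl
    rw [hr (fun s => x (k - s) * (x (s + l) * traceAux d u z x n w)),
      hr (fun s => x (l - s) * (x (k + s) * traceAux d u z x n w))]
    rw [← Equiv.sum_comp (Equiv.neg (ZMod d))]
    refine Finset.sum_congr rfl fun s _ => ?_
    simp only [Equiv.neg_apply, sub_neg_eq_add]
    rw [show -s + (l : ZMod d) = l - s by ring]
    ring
  have h1 : ∀ (c c' : ℂ) (F : ℕ → ℂ), ∑ s ∈ Finset.range d, c * (c' * F s) =
      c * (c' * ∑ s ∈ Finset.range d, F s) := fun c c' F => by rw [Finset.mul_sum, Finset.mul_sum]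
  rw [h1, h1, this]
  ring

/-- Comparison of `s_k(t) h` and `z t^k h^2` under the trace. -/
lemma trace_sPoly_g (a b : Yokonuma d u (n + 1)) (k : ℕ) :
    traceAux d u z x (n + 2) (incl d u (n + 1) a * (sPoly d u z x k (tN d u (n + 2) (n + 1)) *
      gN d u (n + 2) n) * incl d u (n + 1) b) =
    z * traceAux d u z x (n + 2) (incl d u (n + 1) a * (tN d u (n + 2) (n + 1) ^ k *
      (gN d u (n + 2) n * gN d u (n + 2) n)) * incl d u (n + 1) b) := by
  have h := isYok d u (n + 2)
  have hp := h.tg2 n (by omega)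
  have e2 : tN d u (n + 2) (n + 1) ^ k * gN d u (n + 2) n =
      gN d u (n + 2) n * tN d u (n + 2) n ^ k := (SemiconjBy.pow_right
    (show SemiconjBy (gN d u (n + 2) n) _ _ from hp.symm) k).eq.symm
  rw [sPoly_mul k hp, ← mul_assoc (tN d u (n + 2) (n + 1) ^ k), e2, ← incl_tN (by omega)]
  have hs : sPoly d u z x k (incl d u (n + 1) (tN d u (n + 1) n)) =
      incl d u (n + 1) (sPoly d u z x k (tN d u (n + 1) n)) := by
    simp only [sPoly, map_add, map_smul, map_one, map_sum, map_pow]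
  rw [hs, ← mul_assoc, mul_assoc _ (incl d u (n + 1) _) (incl d u (n + 1) b), ← map_mul,
    trace_mul_g_mul, ← comp_t_pow, trace_succ (n := n + 1), condExp_right, condExp_left,
    mul_assoc a, comp_apply, map_pow, mul_assoc (gN d u (n + 2) n)]

end TraceProperty

end Yokonuma

namespace Yokonuma

section Cyclic

variable {d : ℕ} [NeZero d] {u z : ℂ} {x : ZMod d → ℂ} {n : ℕ}

lemma t_pow_mul_g (j : ℕ) : tN d u (n + 2) n ^ j * gN d u (n + 2) n =
    gN d u (n + 2) n * tN d u (n + 2) (n + 1) ^ j := (SemiconjBy.pow_right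
  (show SemiconjBy (gN d u (n + 2) n) _ _ from ((isYok d u (n + 2)).tg1 n (by omega)).symm) j).eq.symm

lemma t_pow_mul_g' (j : ℕ) : tN d u (n + 2) (n + 1) ^ j * gN d u (n + 2) n =
    gN d u (n + 2) n * tN d u (n + 2) n ^ j := (SemiconjBy.pow_right
  (show SemiconjBy (gN d u (n + 2) n) _ _ from ((isYok d u (n + 2)).tg2 n (by omega)).symm) j).eq.symm

/-- The values on `p h m h^2` and `p h^2 m h`. -/
lemma trace_hh (hc : ∀ a b : Yokonuma d u (n + 2),
      traceAux d u z x (n + 2) (a * b) = traceAux d u z x (n + 2) (b * a))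
    (p m : Yokonuma d u (n + 1)) :
    traceAux d u z x (n + 2) (incl d u (n + 1) p * gN d u (n + 2) n * incl d u (n + 1) m *
      (gN d u (n + 2) n * gN d u (n + 2) n)) =
    traceAux d u z x (n + 2) (incl d u (n + 1) p * (gN d u (n + 2) n * gN d u (n + 2) n) *
      incl d u (n + 1) m * gN d u (n + 2) n) := by
  have h := isYok d u (n + 2)
  have hi : ∀ j : ℕ, tN d u (n + 2) n ^ j = incl d u (n + 1) (tN d u (n + 1) n ^ j) := fun j => by
    rw [map_pow, incl_tN (by omega)]
  have hb := fun (j : ℕ) (w : Yokonuma d u (n + 1)) => t_pow_comm_incl (d := d) (u := u) w j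
  have hsym : avgIdem d (tN d u (n + 2) n) (tN d u (n + 2) (n + 1)) =
      avgIdem d (tN d u (n + 2) (n + 1)) (tN d u (n + 2) n) :=
    avgIdem_symm (h.tcomm n (n + 1) (by omega) (by omega)) (h.tpow n (by omega))
      (h.tpow (n + 1) (by omega))
  have z1 : traceAux d u z x (n + 2) (incl d u (n + 1) p * gN d u (n + 2) n * incl d u (n + 1) m) =
      traceAux d u z x (n + 2) (incl d u (n + 1) p * incl d u (n + 1) m * gN d u (n + 2) n) := by
    rw [trace_mul_g_mul, ← map_mul, ← mul_one (_ * gN d u (n + 2) n), ← map_one (incl d u (n + 1)),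
      trace_mul_g_mul, mul_one]
  have z2 : traceAux d u z x (n + 2) (incl d u (n + 1) p * gN d u (n + 2) n * incl d u (n + 1) m *
      avgIdem d (tN d u (n + 2) n) (tN d u (n + 2) (n + 1))) =
      traceAux d u z x (n + 2) (incl d u (n + 1) p *
        avgIdem d (tN d u (n + 2) n) (tN d u (n + 2) (n + 1)) * incl d u (n + 1) m *
          gN d u (n + 2) n) := by
    conv_lhs => rw [hsym]
    simp only [avgIdem, mul_smul_comm, smul_mul_assoc, map_smul, Finset.mul_sum, Finset.sum_mul,
      map_sum]
    congr 1
    refine Finset.sum_congr rfl fun s _ => ?_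
    have e1 : incl d u (n + 1) p * gN d u (n + 2) n * incl d u (n + 1) m *
        (tN d u (n + 2) (n + 1) ^ s * tN d u (n + 2) n ^ (d - s)) =
        incl d u (n + 1) (p * tN d u (n + 1) n ^ s) * gN d u (n + 2) n *
          incl d u (n + 1) (m * tN d u (n + 1) n ^ (d - s)) := by
      rw [map_mul, map_mul, ← hi, ← hi]
      simp only [mul_assoc]
      rw [← mul_assoc (incl d u (n + 1) m), ← hb]
      simp only [mul_assoc]
      rw [← mul_assoc (gN d u (n + 2) n), ← t_pow_mul_g]
      simp only [mul_assoc]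
    have e2 : incl d u (n + 1) p * (tN d u (n + 2) n ^ s * tN d u (n + 2) (n + 1) ^ (d - s)) *
        incl d u (n + 1) m * gN d u (n + 2) n =
        incl d u (n + 1) (p * tN d u (n + 1) n ^ s * m) * gN d u (n + 2) n *
          incl d u (n + 1) (tN d u (n + 1) n ^ (d - s)) := by
      rw [map_mul, map_mul, ← hi, ← hi]
      simp only [mul_assoc]
      rw [← t_pow_mul_g', ← mul_assoc (tN d u (n + 2) (n + 1) ^ (d - s)), hb]
      simp only [mul_assoc]
    rw [e1, e2, trace_mul_g_mul, trace_mul_g_mul]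
    simp only [mul_assoc]
  have z3 : traceAux d u z x (n + 2) (incl d u (n + 1) p * gN d u (n + 2) n * incl d u (n + 1) m *
      (avgIdem d (tN d u (n + 2) n) (tN d u (n + 2) (n + 1)) * gN d u (n + 2) n)) =
      traceAux d u z x (n + 2) (incl d u (n + 1) p *
        (avgIdem d (tN d u (n + 2) n) (tN d u (n + 2) (n + 1)) * gN d u (n + 2) n) *
          incl d u (n + 1) m * gN d u (n + 2) n) := by
    conv_rhs => rw [hsym]
    simp only [avgIdem, mul_smul_comm, smul_mul_assoc, map_smul, Finset.mul_sum, Finset.sum_mul,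
      map_sum]
    congr 1
    refine Finset.sum_congr rfl fun s _ => ?_
    have e1 : incl d u (n + 1) p * gN d u (n + 2) n * incl d u (n + 1) m *
        (tN d u (n + 2) n ^ s * tN d u (n + 2) (n + 1) ^ (d - s) * gN d u (n + 2) n) =
        incl d u (n + 1) p * tN d u (n + 2) n ^ (d - s) * gN d u (n + 2) n *
          incl d u (n + 1) m * gN d u (n + 2) n * tN d u (n + 2) (n + 1) ^ s := by
      have hab : tN d u (n + 2) n ^ s * tN d u (n + 2) (n + 1) ^ (d - s) =
          tN d u (n + 2) (n + 1) ^ (d - s) * tN d u (n + 2) n ^ s :=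
        ((show Commute _ _ from h.tcomm n (n + 1) (by omega) (by omega)).pow_pow _ _).eq
      rw [hab]
      simp only [mul_assoc]
      rw [t_pow_mul_g, ← mul_assoc (incl d u (n + 1) m), ← hb]
      simp only [mul_assoc]
      rw [← mul_assoc (gN d u (n + 2) n), ← t_pow_mul_g]
      simp only [mul_assoc]
    have e2 : tN d u (n + 2) (n + 1) ^ s * (incl d u (n + 1) p * tN d u (n + 2) n ^ (d - s) *
        gN d u (n + 2) n * incl d u (n + 1) m * gN d u (n + 2) n) =
        incl d u (n + 1) p * (tN d u (n + 2) (n + 1) ^ s * tN d u (n + 2) n ^ (d - s) *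
          gN d u (n + 2) n) * incl d u (n + 1) m * gN d u (n + 2) n := by
      simp only [mul_assoc]
      rw [← mul_assoc (tN d u (n + 2) (n + 1) ^ s), hb]
      simp only [mul_assoc]
    rw [e1, hc, e2]
  rw [h.quad n (by omega)]
  simp only [mul_add, add_mul, mul_one, one_mul, mul_smul_comm, smul_mul_assoc, map_add, map_smul]
  rw [z1, z2, z3]

/-- The compression by `g_{n+1}` is self-adjoint. -/
lemma trace_comp_comm (hc : ∀ a b : Yokonuma d u (n + 1),
      traceAux d u z x (n + 1) (a * b) = traceAux d u z x (n + 1) (b * a))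
    (w v : Yokonuma d u (n + 1)) :
    traceAux d u z x (n + 1) (w * comp d u z x n v) =
      traceAux d u z x (n + 1) (v * comp d u z x n w) := by
  have hsub : ∀ w₀ : Yokonuma d u (n + 1), ∃ P : Submodule ℂ (Yokonuma d u (n + 1)), ∀ v,
      v ∈ P ↔ traceAux d u z x (n + 1) (w₀ * comp d u z x n v) =
        traceAux d u z x (n + 1) (v * comp d u z x n w₀) := fun w₀ =>
    ⟨LinearMap.eqLocus (traceAux d u z x (n + 1) ∘ₗ LinearMap.mulLeft ℂ w₀ ∘ₗ comp d u z x n)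
      (traceAux d u z x (n + 1) ∘ₗ LinearMap.mulRight ℂ (comp d u z x n w₀)), fun v => Iff.rfl⟩
  have hcl : ∀ (q : Yokonuma d u n) (k : ℕ), comp d u z x n (incl d u n q * tN d u (n + 1) n ^ k) =
      incl d u n q * sPoly d u z x k (tN d u (n + 1) n) := fun q k => by rw [comp_left, comp_t_pow]
  have hsc : ∀ (q : Yokonuma d u n) (k : ℕ), sPoly d u z x k (tN d u (n + 1) n) * incl d u n q =
      incl d u n q * sPoly d u z x k (tN d u (n + 1) n) := fun q k => sPoly_mul k (t_comm_incl q)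
  have key : ∀ w v : Yokonuma d u (n + 1), (∃ p k, w = incl d u n p * tN d u (n + 1) n ^ k) →
      traceAux d u z x (n + 1) (w * comp d u z x n v) =
        traceAux d u z x (n + 1) (v * comp d u z x n w) := by
    rintro _ v ⟨p, k, rfl⟩
    obtain ⟨P, hP⟩ := hsub (incl d u n p * tN d u (n + 1) n ^ k)
    rw [← hP]
    refine span_induction P (fun q l => ?_) (fun hn q r => ?_) v
    · rw [hP, hcl, hcl, hc (incl d u n q * _)]
      rw [mul_assoc, ← mul_assoc _ (incl d u n q), t_pow_comm_incl, mul_assoc, ← mul_assoc,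
        ← map_mul, ← trace_sPoly_symm, mul_assoc (incl d u n p), ← mul_assoc _ (incl d u n q), hsc,
        mul_assoc (incl d u n q), ← mul_assoc (incl d u n p), ← map_mul]
    · obtain ⟨m, rfl⟩ : ∃ m, n = m + 1 := ⟨n - 1, by omega⟩
      rw [hP, hcl, hc (_ * _ * incl d u (m + 1) r)]
      simp only [Nat.add_sub_cancel]
      rw [comp_right, comp_left, comp_g]
      have e1 : incl d u (m + 1) p * tN d u (m + 1 + 1) (m + 1) ^ k * (incl d u (m + 1) q *
          (z • (gN d u (m + 2) m * gN d u (m + 2) m)) * incl d u (m + 1) r) =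
          z • (incl d u (m + 1) (p * q) * (tN d u (m + 2) (m + 1) ^ k *
            (gN d u (m + 2) m * gN d u (m + 2) m)) * incl d u (m + 1) r) := by
        simp only [mul_smul_comm, smul_mul_assoc, map_mul, mul_assoc]
        rw [← mul_assoc (tN d u (m + 1 + 1) (m + 1) ^ k), t_pow_comm_incl, mul_assoc]
      have e2 : incl d u (m + 1) p * sPoly d u z x k (tN d u (m + 1 + 1) (m + 1)) *
          (incl d u (m + 1) q * gN d u (m + 1 + 1) m * incl d u (m + 1) r) =
          incl d u (m + 1) (p * q) * (sPoly d u z x k (tN d u (m + 2) (m + 1)) *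
            gN d u (m + 2) m) * incl d u (m + 1) r := by
        simp only [map_mul, mul_assoc]
        rw [← mul_assoc (sPoly d u z x k _), hsc, mul_assoc]
      rw [e1, e2, map_smul, smul_eq_mul, trace_sPoly_g]
  obtain ⟨P, hP⟩ := hsub w
  rw [← hP]
  refine span_induction P (fun q l => ?_) (fun hn r s => ?_) v
  · rw [hP]
    exact (key _ _ ⟨q, l, rfl⟩).symm
  · rw [hP]
    obtain ⟨P', hP'⟩ := hsub (incl d u n r * gN d u (n + 1) (n - 1) * incl d u n s)
    rw [eq_comm, ← hP']
    refine span_induction P' (fun q l => ?_) (fun _ p q => ?_) w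
    · rw [hP']
      exact (key _ _ ⟨q, l, rfl⟩).symm
    · obtain ⟨m, rfl⟩ : ∃ m, n = m + 1 := ⟨n - 1, by omega⟩
      rw [hP']
      simp only [Nat.add_sub_cancel]
      rw [comp_right, comp_left, comp_g, comp_right, comp_left, comp_g]
      have e1 : incl d u (m + 1) r * gN d u (m + 1 + 1) m * incl d u (m + 1) s *
          (incl d u (m + 1) p * (z • (gN d u (m + 2) m * gN d u (m + 2) m)) *
            incl d u (m + 1) q) =
          z • (incl d u (m + 1) r * gN d u (m + 2) m * incl d u (m + 1) (s * p) *
            (gN d u (m + 2) m * gN d u (m + 2) m) * incl d u (m + 1) q) := by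
        simp only [mul_smul_comm, smul_mul_assoc, map_mul, mul_assoc]
      have e2 : incl d u (m + 1) p * gN d u (m + 1 + 1) m * incl d u (m + 1) q *
          (incl d u (m + 1) r * (z • (gN d u (m + 2) m * gN d u (m + 2) m)) *
            incl d u (m + 1) s) =
          z • (incl d u (m + 1) p * gN d u (m + 2) m * (incl d u (m + 1) (q * r) *
            (gN d u (m + 2) m * gN d u (m + 2) m) * incl d u (m + 1) s)) := by
        simp only [mul_smul_comm, smul_mul_assoc, map_mul, mul_assoc]
      have e3 : incl d u (m + 1) q * (incl d u (m + 1) r * gN d u (m + 2) m *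
          incl d u (m + 1) (s * p) * (gN d u (m + 2) m * gN d u (m + 2) m)) =
          incl d u (m + 1) (q * r) * gN d u (m + 2) m * incl d u (m + 1) (s * p) *
            (gN d u (m + 2) m * gN d u (m + 2) m) := by
        simp only [map_mul, mul_assoc]
      have e4 : incl d u (m + 1) (q * r) * (gN d u (m + 2) m * gN d u (m + 2) m) *
          incl d u (m + 1) s * (incl d u (m + 1) p * gN d u (m + 2) m) =
          incl d u (m + 1) (q * r) * (gN d u (m + 2) m * gN d u (m + 2) m) *
            incl d u (m + 1) (s * p) * gN d u (m + 2) m := by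
        simp only [map_mul, mul_assoc]
      rw [e1, e2, map_smul, map_smul, hc _ (incl d u (m + 1) q), e3,
        hc (incl d u (m + 1) p * gN d u (m + 2) m), e4, trace_hh hc]

lemma traceAux_comm (n : ℕ) : ∀ a b : Yokonuma d u n,
    traceAux d u z x n (a * b) = traceAux d u z x n (b * a) := by
  induction n with
  | zero =>
    intro a b
    show AlgHom.toLinearMap _ _ = AlgHom.toLinearMap _ _
    simp only [AlgHom.toLinearMap_apply, map_mul]
    exact mul_comm _ _
  | succ n ih =>
    let S : Subalgebra ℂ (Yokonuma d u (n + 1)) :=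
      { carrier := {b | ∀ a, traceAux d u z x (n + 1) (a * b) = traceAux d u z x (n + 1) (b * a)}
        mul_mem' := fun {b c} hb hc a => by
          rw [← mul_assoc, hc, ← mul_assoc, hb, mul_assoc]
        add_mem' := fun {b c} hb hc a => by
          rw [mul_add, add_mul, map_add, map_add, hb, hc]
        algebraMap_mem' := fun r a => by rw [Algebra.commutes] }
    have hincl : ∀ v : Yokonuma d u n, incl d u n v ∈ S := fun v a => by
      rw [trace_succ, trace_succ, condExp_right, condExp_left, ih]
    have hS : S = ⊤ := by
      refine subalgebra_eq_top S (fun i hi => ?_) (fun j hj => ?_)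
      · rcases Nat.lt_or_ge (i + 1) n with hin | hin
        · rw [← incl_gN hin]; exact hincl _
        obtain ⟨rfl⟩ : n = i + 1 := by omega
        intro y
        let P : Submodule ℂ (Yokonuma d u (i + 1 + 1)) :=
          LinearMap.eqLocus
            (traceAux d u z x (i + 1 + 1) ∘ₗ LinearMap.mulRight ℂ (gN d u (i + 1 + 1) i))
            (traceAux d u z x (i + 1 + 1) ∘ₗ LinearMap.mulLeft ℂ (gN d u (i + 1 + 1) i))
        refine span_induction P (fun w k => ?_) (fun _ w v => ?_) y
        · show traceAux d u z x (i + 2) (_ * gN d u (i + 2) i) =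
            traceAux d u z x (i + 2) (gN d u (i + 2) i * _)
          have e1 : incl d u (i + 1) w * tN d u (i + 2) (i + 1) ^ k * gN d u (i + 2) i =
              incl d u (i + 1) w * gN d u (i + 2) i * incl d u (i + 1) (tN d u (i + 1) i ^ k) := by
            rw [map_pow, incl_tN (by omega), mul_assoc, t_pow_mul_g', mul_assoc]
          have e2 : gN d u (i + 2) i * (incl d u (i + 1) w * tN d u (i + 2) (i + 1) ^ k) =
              incl d u (i + 1) (tN d u (i + 1) i ^ k) * gN d u (i + 2) i * incl d u (i + 1) w := by
            rw [map_pow, incl_tN (by omega), ← t_pow_comm_incl, ← mul_assoc, t_pow_mul_g]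
          rw [e1, e2, trace_mul_g_mul, trace_mul_g_mul, ih]
        · show traceAux d u z x (i + 2) (_ * gN d u (i + 2) i) =
            traceAux d u z x (i + 2) (gN d u (i + 2) i * _)
          have e1 : incl d u (i + 1) w * gN d u (i + 2) i * incl d u (i + 1) v * gN d u (i + 2) i =
              incl d u (i + 1) w *
                (gN d u (i + 2) i * (incl d u (i + 1) v * gN d u (i + 2) i)) := by
            simp only [mul_assoc]
          have e2 : gN d u (i + 2) i * (incl d u (i + 1) w * gN d u (i + 2) i *
              incl d u (i + 1) v) =
              gN d u (i + 2) i * (incl d u (i + 1) w * gN d u (i + 2) i) *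
                incl d u (i + 1) v := by
            simp only [mul_assoc]
          simp only [Nat.add_sub_cancel]
          rw [e1, e2, trace_succ (n := i + 1), trace_succ (n := i + 1), condExp_left, condExp_right,
            ← comp_apply,
            ← comp_apply, trace_comp_comm ih, ih]
      · rcases Nat.lt_or_ge j n with hin | hin
        · rw [← incl_tN hin]; exact hincl _
        obtain ⟨rfl⟩ : n = j := by omega
        intro y
        let P : Submodule ℂ (Yokonuma d u (n + 1)) :=
          LinearMap.eqLocus
            (traceAux d u z x (n + 1) ∘ₗ LinearMap.mulRight ℂ (tN d u (n + 1) n))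
            (traceAux d u z x (n + 1) ∘ₗ LinearMap.mulLeft ℂ (tN d u (n + 1) n))
        refine span_induction P (fun w k => ?_) (fun hn w v => ?_) y
        · show traceAux d u z x (n + 1) (_ * tN d u (n + 1) n) =
            traceAux d u z x (n + 1) (tN d u (n + 1) n * _)
          rw [← mul_assoc, t_comm_incl, mul_assoc, mul_assoc, ← pow_succ, ← pow_succ']
        · obtain ⟨m, rfl⟩ : ∃ m, n = m + 1 := ⟨n - 1, by omega⟩
          show traceAux d u z x (m + 2) (_ * tN d u (m + 2) (m + 1)) =
            traceAux d u z x (m + 2) (tN d u (m + 2) (m + 1) * _)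
          have h := isYok d u (m + 2)
          simp only [Nat.add_sub_cancel]
          have e1 : incl d u (m + 1) w * gN d u (m + 2) m * incl d u (m + 1) v *
              tN d u (m + 2) (m + 1) = incl d u (m + 1) (w * tN d u (m + 1) m) *
                gN d u (m + 2) m * incl d u (m + 1) v := by
            rw [map_mul, incl_tN (by omega), mul_assoc _ _ (gN d u (m + 2) m), h.tg1 m (by omega)]
            simp only [mul_assoc]
            rw [t_comm_incl]
          have e2 : tN d u (m + 2) (m + 1) * (incl d u (m + 1) w * gN d u (m + 2) m *
              incl d u (m + 1) v) = incl d u (m + 1) w * gN d u (m + 2) m *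
                incl d u (m + 1) (tN d u (m + 1) m * v) := by
            rw [map_mul, incl_tN (by omega), ← mul_assoc, ← mul_assoc, t_comm_incl,
              mul_assoc _ _ (gN d u (m + 2) m), h.tg2 m (by omega)]
            simp only [mul_assoc]
          rw [e1, e2, trace_mul_g_mul, trace_mul_g_mul, mul_assoc]
    intro a b
    have hb : b ∈ S := hS ▸ Algebra.mem_top
    exact hb a

end Cyclic

end Yokonuma

namespace Yokonuma

section Juyumaya

variable {d : ℕ} [NeZero d] {u z : ℂ} {x : ZMod d → ℂ}

/-- The rules that define the Juyumaya trace with parameters `z` and `x_1, …, x_{d-1}` on the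
tower `Y_{d,0}(u) → Y_{d,1}(u) → Y_{d,2}(u) → ⋯`. -/
structure IsJuyumayaTrace (d : ℕ) (u z : ℂ) (x : ZMod d → ℂ)
    (T : (n : ℕ) → Yokonuma d u n →ₗ[ℂ] ℂ) : Prop where
  incl : ∀ (n : ℕ) (a : Yokonuma d u n), T (n + 1) (incl d u n a) = T n a
  comm : ∀ (n : ℕ) (a b : Yokonuma d u n), T n (a * b) = T n (b * a)
  one : ∀ n : ℕ, T n 1 = 1
  markov : ∀ (n : ℕ) (a : Yokonuma d u (n + 1)),
    T (n + 2) (Yokonuma.incl d u (n + 1) a * g ⟨n, by omega⟩) = z * T (n + 1) a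
  framing : ∀ (n : ℕ) (a : Yokonuma d u n) (m : ℕ), 1 ≤ m → m < d →
    T (n + 1) (Yokonuma.incl d u n a * t (Fin.last n) ^ m) = x m * T n a

lemma isJuyumayaTrace_traceAux (hx : x 0 = 1) : IsJuyumayaTrace d u z x (traceAux d u z x) := by
  have hincl : ∀ (n : ℕ) (a : Yokonuma d u n),
      traceAux d u z x (n + 1) (incl d u n a) = traceAux d u z x n a := fun n a => by
    have := trace_mul_t_pow (z := z) (x := x) a 0
    rwa [pow_zero, mul_one, Nat.cast_zero, hx, one_mul] at this
  refine ⟨hincl, traceAux_comm, fun n => ?_, fun n a => ?_, fun n a m _ _ => ?_⟩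
  · induction n with
    | zero =>
      show AlgHom.toLinearMap _ _ = _
      rw [AlgHom.toLinearMap_apply, map_one]
    | succ n ih => rw [← map_one (incl d u n), hincl, ih]
  · have := trace_mul_g_mul (z := z) (x := x) a 1
    rwa [map_one, mul_one, mul_one, gN_of (by omega)] at this
  · have := trace_mul_t_pow (z := z) (x := x) a m
    rwa [tN_of (by omega)] at this

/-- Existence and uniqueness of the Juyumaya trace. -/
theorem existsUnique_juyumayaTrace (d : ℕ) [NeZero d] (u z : ℂ) (x : ZMod d → ℂ) :
    ∃! T : (n : ℕ) → Yokonuma d u n →ₗ[ℂ] ℂ, IsJuyumayaTrace d u z x T := by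
  classical
  have hmod : ∀ (n k : ℕ), tN d u (n + 1) n ^ k = tN d u (n + 1) n ^ (k % d) := fun n k => by
    conv_lhs => rw [← Nat.mod_add_div k d]
    rw [pow_add, pow_mul, (isYok d u (n + 1)).tpow n (by omega), one_pow, mul_one]
  refine ⟨traceAux d u z (Function.update x 0 1), ?_, fun T hT => ?_⟩
  · have h := isJuyumayaTrace_traceAux (d := d) (u := u) (z := z)
      (Function.update_self (0 : ZMod d) (1 : ℂ) x)
    refine ⟨h.incl, h.comm, h.one, h.markov, fun n a m h1 h2 => ?_⟩
    rw [h.framing n a m h1 h2, Function.update_of_ne]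
    rw [Ne, ZMod.natCast_eq_zero_iff]
    exact Nat.not_dvd_of_pos_of_lt h1 h2
  · have h := isJuyumayaTrace_traceAux (d := d) (u := u) (z := z)
      (Function.update_self (0 : ZMod d) (1 : ℂ) x)
    have huniq : ∀ T' : (n : ℕ) → Yokonuma d u n →ₗ[ℂ] ℂ, IsJuyumayaTrace d u z x T' →
        ∀ n, T' n = traceAux d u z (Function.update x 0 1) n := by
      intro T' hT' n
      induction n with
      | zero =>
        ext y
        refine right_induction (LinearMap.eqLocus (T' 0) _) ?_ (fun i hi => by omega)
          (fun j hj => by omega) y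
        exact (hT'.one 0).trans (h.one 0).symm
      | succ n ih =>
        ext y
        refine span_induction (LinearMap.eqLocus (T' (n + 1)) _) (fun w k => ?_)
          (fun hn w v => ?_) y
        · rw [LinearMap.mem_eqLocus, hmod]
          have hlt := Nat.mod_lt k (NeZero.pos d)
          rcases Nat.eq_zero_or_pos (k % d) with h0 | h0
          · rw [h0, pow_zero, mul_one, hT'.incl, h.incl, ih]
          · have e1 := hT'.framing n w _ h0 hlt
            have e2 := trace_mul_t_pow (z := z) (x := Function.update x 0 1) w (k % d)
            rw [tN_of (by omega)] at e2 ⊢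
            refine e1.trans (e2.trans ?_).symm
            rw [Function.update_of_ne, ih]
            rw [Ne, ZMod.natCast_eq_zero_iff]
            exact Nat.not_dvd_of_pos_of_lt h0 hlt
        · obtain ⟨m, rfl⟩ : ∃ m, n = m + 1 := ⟨n - 1, by omega⟩
          rw [LinearMap.mem_eqLocus, hT'.comm, h.comm, ← mul_assoc, ← map_mul,
            Nat.add_sub_cancel, gN_of (by omega)]
          exact (hT'.markov m _).trans ((h.markov m _).trans (by rw [ih])).symm
    funext n
    exact huniq T hT n

/-- The Juyumaya trace with parameters `z` and `x_1, …, x_{d-1}`. -/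
def juyumayaTrace (d : ℕ) [NeZero d] (u z : ℂ) (x : ZMod d → ℂ) (n : ℕ) : Yokonuma d u n →ₗ[ℂ] ℂ :=
  (existsUnique_juyumayaTrace d u z x).choose n

lemma isJuyumayaTrace (d : ℕ) [NeZero d] (u z : ℂ) (x : ZMod d → ℂ) :
    IsJuyumayaTrace d u z x (juyumayaTrace d u z x) :=
  (existsUnique_juyumayaTrace d u z x).choose_spec.1

end Juyumaya

/-- Homomorphisms out of `Y_{d,n}(u)` are determined by their values on the generators. -/
lemma algHom_ext {d : ℕ} {u : ℂ} {n : ℕ} {A : Type*} [Ring A] [Algebra ℂ A]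
    {f f' : Yokonuma d u n →ₐ[ℂ] A} (hg : ∀ i, f (g i) = f' (g i)) (ht : ∀ j, f (t j) = f' (t j)) :
    f = f' := by
  refine RingQuot.ringQuot_ext' _ _ _ (FreeAlgebra.hom_ext ?_)
  funext i
  rcases i with i | j
  · exact hg i
  · exact ht j

end Yokonuma

namespace Hecke

variable {q : ℂ} {n : ℕ}

lemma mk_rel {a b : FreeAlgebra ℂ (Fin (n - 1))} (h : HeckeRel q n a b) :
    RingQuot.mkAlgHom ℂ (HeckeRel q n) a = RingQuot.mkAlgHom ℂ (HeckeRel q n) b :=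
  RingQuot.mkAlgHom_rel ℂ h

lemma G_far (i j : Fin (n - 1)) (h : (i : ℕ) + 1 < j) : (G i * G j : Hecke q n) = G j * G i := by
  have := mk_rel (q := q) (HeckeRel.far i j h)
  rwa [map_mul, map_mul] at this

lemma G_braid (i j : Fin (n - 1)) (h : (j : ℕ) = i + 1) :
    (G j * G i * G j : Hecke q n) = G i * G j * G i := by
  have := mk_rel (q := q) (HeckeRel.braid i j h)
  simp only [map_mul] at this
  exact this

lemma G_sq (i : Fin (n - 1)) : (G i * G i : Hecke q n) = (q - 1) • G i + q • 1 := by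
  have := mk_rel (q := q) (HeckeRel.quad i)
  simp only [map_pow, map_add, map_mul, map_smul, map_one, sq] at this
  exact this

/-- Homomorphisms out of `H_n(q)` are determined by their values on the generators. -/
lemma algHom_ext {A : Type*} [Ring A] [Algebra ℂ A] {f f' : Hecke q n →ₐ[ℂ] A}
    (h : ∀ i, f (G i) = f' (G i)) : f = f' := by
  refine RingQuot.ringQuot_ext' _ _ _ (FreeAlgebra.hom_ext ?_)
  funext i
  exact h i

/-- The universal property of `H_n(q)`. -/
def lift {A : Type*} [Ring A] [Algebra ℂ A] (f : Fin (n - 1) → A)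
    (hfar : ∀ i j : Fin (n - 1), (i : ℕ) + 1 < j → f i * f j = f j * f i)
    (hbraid : ∀ i j : Fin (n - 1), (j : ℕ) = i + 1 → f j * f i * f j = f i * f j * f i)
    (hquad : ∀ i : Fin (n - 1), f i * f i = (q - 1) • f i + q • 1) : Hecke q n →ₐ[ℂ] A :=
  RingQuot.liftAlgHom ℂ ⟨FreeAlgebra.lift ℂ f, by
    intro a b hab
    induction hab with
    | far i j h => simpa using hfar i j h
    | braid i j h => simpa using hbraid i j h
    | quad i => simpa [sq] using hquad i⟩

lemma lift_G {A : Type*} [Ring A] [Algebra ℂ A] {f : Fin (n - 1) → A}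
    {hfar : ∀ i j : Fin (n - 1), (i : ℕ) + 1 < j → f i * f j = f j * f i}
    {hbraid : ∀ i j : Fin (n - 1), (j : ℕ) = i + 1 → f j * f i * f j = f i * f j * f i}
    {hquad : ∀ i : Fin (n - 1), f i * f i = (q - 1) • f i + q • 1} (i : Fin (n - 1)) :
    lift f hfar hbraid hquad (G i) = f i := by
  refine (RingQuot.liftAlgHom_mkAlgHom_apply ℂ _ _ _).trans ?_
  simp

/-- The natural homomorphism `H_n(q) → H_{n+1}(q)`, given by `G_i ↦ G_i`. -/
def incl (q : ℂ) (n : ℕ) : Hecke q n →ₐ[ℂ] Hecke q (n + 1) :=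
  lift (fun i => G ⟨i, by omega⟩) (fun i j h => G_far _ _ h) (fun i j h => G_braid _ _ h)
    (fun i => G_sq _)

/-- The rules that define the Ocneanu trace with parameter `ζ` on the tower
`H_0(q) → H_1(q) → H_2(q) → ⋯`. -/
structure IsOcneanuTrace (q ζ : ℂ) (T : (n : ℕ) → Hecke q n →ₗ[ℂ] ℂ) : Prop where
  incl : ∀ (n : ℕ) (h : Hecke q n), T (n + 1) (incl q n h) = T n h
  comm : ∀ (n : ℕ) (h h' : Hecke q n), T n (h * h') = T n (h' * h)
  one : ∀ n : ℕ, T n 1 = 1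
  markov : ∀ (n : ℕ) (h : Hecke q (n + 1)),
    T (n + 2) (Hecke.incl q (n + 1) h * G ⟨n, by omega⟩) = ζ * T (n + 1) h

/-- The framing generators are trivial in `Y_{1,n}(q)`. -/
lemma t_one (j : Fin n) : (Yokonuma.t j : Yokonuma 1 q n) = 1 := by
  have := (Yokonuma.isYok 1 q n).tpow j j.2
  rwa [pow_one, Yokonuma.tN_of j.2] at this

lemma avgIdem_one {A : Type*} [Ring A] [Algebra ℂ A] : avgIdem 1 (1 : A) 1 = 1 := by
  simp [avgIdem]

/-- `H_n(q) → Y_{1,n}(q)`. -/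
def toYokonuma (q : ℂ) (n : ℕ) : Hecke q n →ₐ[ℂ] Yokonuma 1 q n :=
  lift (fun i => Yokonuma.g i)
    (fun i j h => by
      have := (Yokonuma.isYok 1 q n).far i j h (by omega)
      rwa [Yokonuma.gN_of i.2, Yokonuma.gN_of j.2] at this)
    (fun i j h => by
      have := (Yokonuma.isYok 1 q n).braid i (by omega)
      rw [← h, Yokonuma.gN_of i.2, Yokonuma.gN_of j.2] at this
      exact this.symm)
    (fun i => by
      have := (Yokonuma.isYok 1 q n).quad i (by omega)
      rw [Yokonuma.gN_of i.2, Yokonuma.tN_of (by omega), Yokonuma.tN_of (by omega), t_one, t_one,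
        avgIdem_one, one_mul] at this
      rw [this, sub_smul q 1 (1 : Yokonuma 1 q n), one_smul]
      abel)

/-- `Y_{1,n}(q) → H_n(q)`. -/
def ofYokonuma (q : ℂ) (n : ℕ) : Yokonuma 1 q n →ₐ[ℂ] Hecke q n :=
  Yokonuma.lift (G := fun i => if h : i < n - 1 then G ⟨i, h⟩ else 0) (T := fun _ => 1)
    { far := fun i j h1 h2 => by
        rw [dif_pos (by omega), dif_pos (by omega)]; exact G_far _ _ h1
      braid := fun i h => by
        rw [dif_pos (by omega), dif_pos (by omega)]; exact (G_braid _ _ rfl).symm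
      tcomm := fun _ _ _ _ => rfl
      tg1 := fun _ _ => by rw [one_mul, mul_one]
      tg2 := fun _ _ => by rw [one_mul, mul_one]
      tg3 := fun _ _ _ _ _ _ => by rw [one_mul, mul_one]
      tpow := fun _ _ => one_pow _
      quad := fun i h => by
        rw [dif_pos (by omega), avgIdem_one, one_mul, G_sq, sub_smul q 1 (1 : Hecke q n), one_smul]
        abel }

lemma toYokonuma_G (i : Fin (n - 1)) : toYokonuma q n (G i) = Yokonuma.g i := lift_G i

lemma ofYokonuma_g (i : Fin (n - 1)) : ofYokonuma q n (Yokonuma.g i) = G i :=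
  (Yokonuma.lift_g _ i).trans (dif_pos i.2)

lemma ofYokonuma_t (j : Fin n) : ofYokonuma q n (Yokonuma.t j) = 1 := Yokonuma.lift_t _ j

lemma ofYokonuma_toYokonuma (a : Hecke q n) : ofYokonuma q n (toYokonuma q n a) = a := by
  have : (ofYokonuma q n).comp (toYokonuma q n) = AlgHom.id ℂ _ := algHom_ext fun i => by
    rw [AlgHom.comp_apply, toYokonuma_G, ofYokonuma_g, AlgHom.id_apply]
  exact DFunLike.congr_fun this a

lemma toYokonuma_incl (a : Hecke q n) :
    toYokonuma q (n + 1) (incl q n a) = Yokonuma.incl 1 q n (toYokonuma q n a) := by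
  have : (toYokonuma q (n + 1)).comp (incl q n) = (Yokonuma.incl 1 q n).comp (toYokonuma q n) :=
    algHom_ext fun i => by
      rw [AlgHom.comp_apply, AlgHom.comp_apply, toYokonuma_G, incl, lift_G, toYokonuma_G,
        ← Yokonuma.gN_of, ← Yokonuma.gN_of, Yokonuma.incl_gN (by omega)]
  exact DFunLike.congr_fun this a

lemma ofYokonuma_incl (a : Yokonuma 1 q n) :
    ofYokonuma q (n + 1) (Yokonuma.incl 1 q n a) = incl q n (ofYokonuma q n a) := by
  have : (ofYokonuma q (n + 1)).comp (Yokonuma.incl 1 q n) = (incl q n).comp (ofYokonuma q n) :=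
    Yokonuma.algHom_ext (fun i => by
      rw [AlgHom.comp_apply, AlgHom.comp_apply, ofYokonuma_g, incl, lift_G,
        ← Yokonuma.gN_of, Yokonuma.incl_gN (by omega), Yokonuma.gN_of (by omega), ofYokonuma_g])
      (fun j => by
        rw [AlgHom.comp_apply, AlgHom.comp_apply, t_one, map_one, map_one, map_one, map_one])
  exact DFunLike.congr_fun this a

/-- Existence and uniqueness of the Ocneanu trace. -/
theorem existsUnique_ocneanuTrace (q ζ : ℂ) :
    ∃! T : (n : ℕ) → Hecke q n →ₗ[ℂ] ℂ, IsOcneanuTrace q ζ T := by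
  obtain ⟨T, hT, hU⟩ := Yokonuma.existsUnique_juyumayaTrace 1 q ζ 1
  refine ⟨fun n => T n ∘ₗ (toYokonuma q n).toLinearMap, ⟨fun n h => ?_, fun n h h' => ?_,
    fun n => ?_, fun n h => ?_⟩, fun T' hT' => ?_⟩
  · show T (n + 1) (toYokonuma q (n + 1) (incl q n h)) = T n (toYokonuma q n h)
    rw [toYokonuma_incl, hT.incl]
  · show T n (toYokonuma q n (h * h')) = T n (toYokonuma q n (h' * h))
    rw [map_mul (toYokonuma q n), map_mul (toYokonuma q n), hT.comm]
  · show T n (toYokonuma q n 1) = 1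
    rw [map_one, hT.one]
  · show T (n + 2) (toYokonuma q (n + 2) _) = ζ * T (n + 1) (toYokonuma q (n + 1) h)
    rw [map_mul, toYokonuma_incl, toYokonuma_G, hT.markov]
  · have : (fun n => T' n ∘ₗ (ofYokonuma q n).toLinearMap) = T := by
      refine hU _ ⟨fun n h => ?_, fun n h h' => ?_, fun n => ?_, fun n h => ?_,
        fun n a m h1 h2 => by omega⟩
      · show T' (n + 1) (ofYokonuma q (n + 1) (Yokonuma.incl 1 q n h)) = T' n (ofYokonuma q n h)
        rw [ofYokonuma_incl, hT'.incl]
      · show T' n (ofYokonuma q n (h * h')) = T' n (ofYokonuma q n (h' * h))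
        rw [map_mul (ofYokonuma q n), map_mul (ofYokonuma q n), hT'.comm]
      · show T' n (ofYokonuma q n 1) = 1
        rw [map_one, hT'.one]
      · show T' (n + 2) (ofYokonuma q (n + 2) _) = ζ * T' (n + 1) (ofYokonuma q (n + 1) h)
        rw [map_mul, ofYokonuma_incl, ofYokonuma_g, hT'.markov]
    funext n
    ext a
    show T' n a = T n (toYokonuma q n a)
    rw [← this]
    show T' n a = T' n (ofYokonuma q n (toYokonuma q n a))
    rw [ofYokonuma_toYokonuma]

/-- The Ocneanu trace with parameter `ζ`. -/
def ocneanuTrace (q ζ : ℂ) (n : ℕ) : Hecke q n →ₗ[ℂ] ℂ :=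
  (existsUnique_ocneanuTrace q ζ).choose n

lemma isOcneanuTrace (q ζ : ℂ) : IsOcneanuTrace q ζ (ocneanuTrace q ζ) :=
  (existsUnique_ocneanuTrace q ζ).choose_spec.1

end Hecke

/-! ### Braid group representations and the invariants of closed braids -/

/-- The sum `ε(α)` of the exponents of the braid generators. -/
def expSumHom (n : ℕ) : BraidGroup n →* Multiplicative ℤ :=
  PresentedGroup.toGroup (f := fun _ => Multiplicative.ofAdd 1) (by
    rintro r (⟨i, j, -, rfl⟩ | ⟨i, j, -, rfl⟩) <;>
    simp only [map_mul, map_inv, FreeGroup.lift_apply_of, mul_inv_cancel])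

/-- The sum `ε(α)` of the exponents of the braid generators. -/
def expSum {n : ℕ} (α : BraidGroup n) : ℤ := (expSumHom n α).toAdd

/-- The generator `G_i` of `H_n(q)` as a unit. -/
def Hecke.unitG {q : ℂ} (hq : q ≠ 0) {n : ℕ} (i : Fin (n - 1)) : (Hecke q n)ˣ where
  val := Hecke.G i
  inv := q⁻¹ • Hecke.G i + (q⁻¹ - 1) • 1
  val_inv := by
    rw [mul_add, mul_smul_comm, mul_smul_comm, Hecke.G_sq, mul_one, smul_add, smul_smul, smul_smul,
      inv_mul_cancel₀ hq, one_smul, add_right_comm, ← add_smul,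
      show q⁻¹ * (q - 1) + (q⁻¹ - 1) = 0 by field_simp; ring, zero_smul, zero_add]
  inv_val := by
    rw [add_mul, smul_mul_assoc, smul_mul_assoc, Hecke.G_sq, one_mul, smul_add, smul_smul, smul_smul,
      inv_mul_cancel₀ hq, one_smul, add_right_comm, ← add_smul,
      show q⁻¹ * (q - 1) + (q⁻¹ - 1) = 0 by field_simp; ring, zero_smul, zero_add]

/-- The restriction `π : B_n → H_n(q)`, `σ_i ↦ G_i`, of the natural algebra epimorphism
`ℂ B_n → H_n(q)`. -/
def heckeRep {q : ℂ} (hq : q ≠ 0) (n : ℕ) : BraidGroup n →* (Hecke q n)ˣ :=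
  PresentedGroup.toGroup (f := fun i => Hecke.unitG hq i) (by
    rintro r (⟨i, j, h, rfl⟩ | ⟨i, j, h, rfl⟩)
    · simp only [map_mul, map_inv, FreeGroup.lift_apply_of, mul_inv_eq_one]
      exact Units.ext (Hecke.G_far i j h)
    · simp only [map_mul, map_inv, FreeGroup.lift_apply_of, mul_inv_eq_one]
      exact Units.ext (Hecke.G_braid i j h))

namespace Yokonuma

variable {d : ℕ} {u : ℂ} {n : ℕ}

lemma g_far (i j : Fin (n - 1)) (h : (i : ℕ) + 1 < j) :
    (g i * g j : Yokonuma d u n) = g j * g i := by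
  have := (isYok d u n).far i j h (by omega)
  rwa [gN_of i.2, gN_of j.2] at this

lemma g_braid (i j : Fin (n - 1)) (h : (j : ℕ) = i + 1) :
    (g j * g i * g j : Yokonuma d u n) = g i * g j * g i := by
  have := (isYok d u n).braid i (by omega)
  rw [← h, gN_of i.2, gN_of j.2] at this
  exact this.symm

lemma g_sq (i : Fin (n - 1)) :
    (g i * g i : Yokonuma d u n) = 1 + (u - 1) • e i + (u - 1) • (e i * g i) := by
  have := (isYok d u n).quad i (by omega)
  rwa [gN_of i.2, tN_of (by omega), tN_of (by omega)] at this

lemma t_comm (i j : Fin n) : (t i * t j : Yokonuma d u n) = t j * t i := by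
  have := (isYok d u n).tcomm i j i.2 j.2
  rwa [tN_of i.2, tN_of j.2] at this

lemma t_pow (j : Fin n) : (t j ^ d : Yokonuma d u n) = 1 := by
  have := (isYok d u n).tpow j j.2
  rwa [tN_of j.2] at this

lemma e_mul_e [NeZero d] (i : Fin (n - 1)) : (e i * e i : Yokonuma d u n) = e i :=
  avgIdem_mul_self (t_comm _ _) (t_pow _) (t_pow _)

lemma e_mul_g (i : Fin (n - 1)) : (e i * g i : Yokonuma d u n) = g i * e i := by
  refine (avgIdem_conj (a' := t (strandR i)) (b' := t (strandL i)) ?_ ?_).trans ?_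
  · rw [tN_mul_g, Equiv.swap_apply_left]
  · rw [tN_mul_g, Equiv.swap_apply_right]
  · rw [e, avgIdem_symm (t_comm _ _) (t_pow _) (t_pow _)]

/-- The generator `g_i` of `Y_{d,n}(u)` as a unit. -/
def unitG [NeZero d] (hu : u ≠ 0) (i : Fin (n - 1)) : (Yokonuma d u n)ˣ where
  val := g i
  inv := g i + (u⁻¹ - 1) • e i + (u⁻¹ - 1) • (e i * g i)
  val_inv := by
    have h1 : g i * (e i * g i) = (u • e i + (u - 1) • (e i * g i) : Yokonuma d u n) := by
      rw [← mul_assoc, ← e_mul_g, mul_assoc, g_sq, mul_add, mul_add, mul_one, mul_smul_comm,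
        mul_smul_comm, ← mul_assoc, e_mul_e, sub_smul u 1 (e i), one_smul]
      abel
    rw [mul_add, mul_add, mul_smul_comm, mul_smul_comm, h1, g_sq, ← e_mul_g]
    have h2 : (u⁻¹ - 1) * u = -(u - 1) := by field_simp; ring
    have h3 : (u⁻¹ - 1) * (u - 1) = -(u - 1) - (u⁻¹ - 1) := by field_simp; ring
    rw [smul_add, smul_smul, smul_smul, h2, h3]
    module
  inv_val := by
    have h1 : e i * g i * g i = (u • e i + (u - 1) • (e i * g i) : Yokonuma d u n) := by
      rw [mul_assoc, g_sq, mul_add, mul_add, mul_one, mul_smul_comm,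
        mul_smul_comm, ← mul_assoc, e_mul_e, sub_smul u 1 (e i), one_smul]
      abel
    rw [add_mul, add_mul, smul_mul_assoc, smul_mul_assoc, h1, g_sq]
    have h2 : (u⁻¹ - 1) * u = -(u - 1) := by field_simp; ring
    have h3 : (u⁻¹ - 1) * (u - 1) = -(u - 1) - (u⁻¹ - 1) := by field_simp; ring
    rw [smul_add, smul_smul, smul_smul, h2, h3]
    module

end Yokonuma

/-- The restriction `δ : B_n → Y_{d,n}(u)`, `σ_i ↦ g_i`, of the natural algebra homomorphism
`ℂ B_n → Y_{d,n}(u)`. -/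
def yokonumaRep (d : ℕ) [NeZero d] {u : ℂ} (hu : u ≠ 0) (n : ℕ) :
    BraidGroup n →* (Yokonuma d u n)ˣ :=
  PresentedGroup.toGroup (f := fun i => Yokonuma.unitG hu i) (by
    rintro r (⟨i, j, h, rfl⟩ | ⟨i, j, h, rfl⟩)
    · simp only [map_mul, map_inv, FreeGroup.lift_apply_of, mul_inv_eq_one]
      exact Units.ext (Yokonuma.g_far i j h)
    · simp only [map_mul, map_inv, FreeGroup.lift_apply_of, mul_inv_eq_one]
      exact Units.ext (Yokonuma.g_braid i j h))

/-- The re-scaling factor `λ_H = (ζ + (1 - q)) / (q ζ)`. -/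
def lambdaH (q ζ : ℂ) : ℂ := (ζ + (1 - q)) / (q * ζ)

/-- The re-scaling factor `λ_Y = (z + (1 - u) E) / (u z)`. -/
def lambdaY (u z E : ℂ) : ℂ := (z + (1 - u) * E) / (u * z)

/-- The value `P(α̂) = D_H^(n-1) (√λ_H)^ε(α) τ(π(α))` of the HOMFLYPT polynomial on the closure
of the braid `α ∈ B_n`, where `s` is the square root of `λ_H` that is used, and
`D_H = 1 / (ζ √λ_H)`. -/
def homflypt {q : ℂ} (hq : q ≠ 0) (ζ s : ℂ) {n : ℕ} (α : BraidGroup n) : ℂ :=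
  (1 / (ζ * s)) ^ (n - 1) * s ^ expSum α *
    Hecke.ocneanuTrace q ζ n (heckeRep hq n α : Hecke q n)

/-- The value `Δ_S(α̂) = D_Y^(n-1) (√λ_Y)^ε(α) tr_S(δ(α))` of the invariant `Δ_S` on the closure
of the braid `α ∈ B_n`, where `x` is the solution of the E-system, `s` is the square root of `λ_Y`
that is used, and `D_Y = 1 / (z √λ_Y)`. -/
def deltaS (d : ℕ) [NeZero d] {u : ℂ} (hu : u ≠ 0) (x : ZMod d → ℂ) (z s : ℂ) {n : ℕ}
    (α : BraidGroup n) : ℂ :=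
  (1 / (z * s)) ^ (n - 1) * s ^ expSum α *
    Yokonuma.juyumayaTrace d u z x n (yokonumaRep d hu n α : Yokonuma d u n)

/-- The E-system for `x_1, …, x_{d-1}`, with indices modulo `d` and `x_0 = 1`. -/
structure IsESolution (d : ℕ) [NeZero d] (x : ZMod d → ℂ) : Prop where
  zero : x 0 = 1
  system : ∀ m : ZMod d, m ≠ 0 → ∑ s, x (m + s) * x (-s) = x m * ∑ s, x s * x (-s)

/-- `E = (1/d) ∑_s x_s x_{-s}`. -/
def eValue (d : ℕ) [NeZero d] (x : ZMod d → ℂ) : ℂ := 1 / (d : ℂ) * ∑ s, x s * x (-s)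

/-- The 14 cases in which `P` and `Δ_S` coincide. -/
def CoincidenceCase (q ζ u z E : ℂ) : Prop :=
  (q = 1 ∧ ζ = z ∧ u = 1) ∨
  (q = 1 ∧ ζ = -z ∧ u = 1) ∨
  (ζ = q ∧ u = 1 ∧ z = 1) ∨
  (ζ = q ∧ u = 1 ∧ z = -1) ∨
  (ζ = -1 ∧ u = 1 ∧ z = 1) ∨
  (ζ = -1 ∧ u = 1 ∧ z = -1) ∨
  (q = 1 ∧ ζ = E ∧ z = -E) ∨
  (q = 1 ∧ ζ = -E ∧ z = -E) ∨
  (ζ = q ∧ z = -1 ∧ E = 1) ∨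
  (ζ = q ∧ z = u ∧ E = 1) ∨
  (ζ = -1 ∧ z = -1 ∧ E = 1) ∨
  (ζ = -1 ∧ z = u ∧ E = 1) ∨
  (q = u ∧ ζ = z ∧ E = 1) ∨
  (q = 1 / u ∧ ζ = -z / u ∧ E = 1)

end

end YokonumaHecke

open YokonumaHecke

/-!
The unlink of two components, as the closure of `1 ∈ B_2`, shows that `P = Δ_S` forces
`ζ √λ_H = z √λ_Y`. Conversely this equality suffices in each of the 14 cases, because `Δ_S` is
then itself a HOMFLYPT polynomial, in two ways.

* For `E = 1`, the Fourier transform of the solution of the E-system is supported in one point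
  (`IsESolution.exists_finset`), so that the parameters `x_m = c ^ m` form a character. The trace
  factors through the homomorphism `Y_{d,n}(u) → H_n(u)` with `t_j ↦ c`, and `Δ_S` is the
  HOMFLYPT polynomial with parameters `u, z` (`deltaS_eq_homflypt_of_eValue_eq_one`).
* For `u = 1` or `z = -E`, the element `g_i ^ 2 - 1 = (u - 1) e_i (1 + g_i)` lies in the radical
  of the trace (`Yokonuma.trace_mul_g_sq`). The algebra `H_n(1)` therefore acts on the quotient of
  `Y_{d,n}(u)` by the radical, and `Δ_S` is the HOMFLYPT polynomial with parameters `1, z`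
  (`deltaS_eq_homflypt_one`).

It remains to compare HOMFLYPT polynomials: the parameters `q, ζ` can be replaced by
`1 / q, -ζ / q` through `G_i ↦ -q G_i`, and for `ζ = q` or `ζ = -1` the Ocneanu trace is a
one-dimensional representation (`homflypt_eq_homflypt`).

For the necessity of the cases, the two invariants are compared on the unlink, the Hopf link, the
trefoil and the figure-eight knot. The invariant `P` is `Δ_S` for `d = 1`, so that only values of
`Δ_S` have to be computed; the main tool is `tr (w e_n) = E tr w` for `w ∈ Y_{d,n}(u)`, which the
E-system yields (`Yokonuma.trace_mul_e`). The resulting equations are solved in terms of the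
scaled eigenvalues `a = q √λ_H`, `b = -√λ_H` of `G_i` and `u √λ_Y`, `±√λ_Y` of `g_i`
(`coincidenceCase_of_equations`). The braids on two strands leave exactly one spurious family of
solutions, with `{a, b} = {u √λ_Y, √λ_Y}`, and the figure-eight knot excludes it. The Fourier
transform also gives that `1 / E` is a positive integer, which excludes `E = 0` and `E = -1`.
-/

namespace YokonumaHecke

noncomputable section

/-! ### The Juyumaya trace and the E-system -/

section Residues

variable {d : ℕ} [NeZero d]

lemma sum_range_natCast {M : Type*} [AddCommMonoid M] (f : ZMod d → M) :
    ∑ s ∈ Finset.range d, f (s : ZMod d) = ∑ s, f s := by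
  obtain ⟨k, rfl⟩ : ∃ k, d = k + 1 := ⟨d - 1, (Nat.succ_pred (NeZero.ne d)).symm⟩
  rw [Finset.sum_range]
  exact Finset.sum_congr rfl fun s _ => congrArg f (Fin.cast_val_eq_self s)

lemma natCast_sub_self {s : ℕ} (hs : s ≤ d) : ((d - s : ℕ) : ZMod d) = -(s : ZMod d) := by
  rw [Nat.cast_sub hs, ZMod.natCast_self, zero_sub]

lemma IsESolution.sum_eq {x : ZMod d → ℂ} (hx : IsESolution d x) (m : ZMod d) :
    ∑ s, x (m + s) * x (-s) = x m * ∑ s, x s * x (-s) := by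
  rcases eq_or_ne m 0 with rfl | hm
  · simp [hx.zero]
  · exact hx.system m hm

end Residues

namespace Yokonuma

variable {d : ℕ} [NeZero d] {u z : ℂ} {x : ZMod d → ℂ} {n : ℕ}

lemma juyumayaTrace_eq (hx : x 0 = 1) : juyumayaTrace d u z x = traceAux d u z x :=
  (existsUnique_juyumayaTrace d u z x).unique (isJuyumayaTrace d u z x)
    (isJuyumayaTrace_traceAux hx)

/-- The idempotent `e i` for a natural number `i`. -/
def eN (d : ℕ) (u : ℂ) (n i : ℕ) : Yokonuma d u n :=
  avgIdem d (tN d u n i) (tN d u n (i + 1))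

lemma e_eq_eN (i : Fin (n - 1)) : (e i : Yokonuma d u n) = eN d u n i := by
  rw [eN, tN_of (by omega), tN_of (by omega)]
  rfl

lemma incl_eN {i : ℕ} (hi : i + 1 < n) : incl d u n (eN d u n i) = eN d u (n + 1) i := by
  rw [eN, map_avgIdem, incl_tN (by omega), incl_tN (by omega), eN]

/-- The form of `tr (w e_n) = E tr w` that only involves the strands of `w`. -/
lemma trace_sum_t_pow (hx : IsESolution d x) (n : ℕ) (w : Yokonuma d u (n + 1)) :
    ∑ s ∈ Finset.range d, x (-(s : ZMod d)) *
        traceAux d u z x (n + 1) (w * tN d u (n + 1) n ^ s) =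
      (∑ s, x s * x (-s)) * traceAux d u z x (n + 1) w := by
  let Φ : (n : ℕ) → Yokonuma d u (n + 1) →ₗ[ℂ] ℂ := fun n =>
    ∑ s ∈ Finset.range d, x (-(s : ZMod d)) •
      (traceAux d u z x (n + 1) ∘ₗ LinearMap.mulRight ℂ (tN d u (n + 1) n ^ s))
  have hΦ : ∀ n w, Φ n w = ∑ s ∈ Finset.range d, x (-(s : ZMod d)) *
      traceAux d u z x (n + 1) (w * tN d u (n + 1) n ^ s) := fun n w => by
    simp [Φ, LinearMap.sum_apply]
  have hcomm := @traceAux_comm d _ u z x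
  have htop : ∀ (n : ℕ) (v : Yokonuma d u n) (k : ℕ),
      Φ n (incl d u n v * tN d u (n + 1) n ^ k) = (∑ s, x s * x (-s)) *
        traceAux d u z x (n + 1) (incl d u n v * tN d u (n + 1) n ^ k) := fun n v k => by
    simp only [hΦ, mul_assoc, ← pow_add]
    simp only [trace_mul_t_pow, ← mul_assoc]
    rw [← Finset.sum_mul, mul_comm _ (x k), ← hx.sum_eq k,
      ← sum_range_natCast fun s : ZMod d => x (k + s) * x (-s)]
    congr 1
    refine Finset.sum_congr rfl fun s _ => ?_
    rw [Nat.cast_add, mul_comm]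
  suffices H : ∀ n w, Φ n w = (∑ s, x s * x (-s)) * traceAux d u z x (n + 1) w by
    rw [← hΦ, H]
  intro n
  induction n with
  | zero =>
    exact fun w => span_induction
      (LinearMap.eqLocus (Φ 0) ((∑ s, x s * x (-s)) • traceAux d u z x 1)) (fun v k => htop 0 v k)
      (fun h => absurd h (lt_irrefl _)) w
  | succ n ih =>
    refine fun w => span_induction
      (LinearMap.eqLocus (Φ (n + 1)) ((∑ s, x s * x (-s)) • traceAux d u z x (n + 2)))
      (fun v k => htop (n + 1) v k) (fun _ a b => ?_) w
    show Φ (n + 1) (incl d u (n + 1) a * gN d u (n + 2) n * incl d u (n + 1) b) =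
      _ * traceAux d u z x (n + 2) (incl d u (n + 1) a * gN d u (n + 2) n * incl d u (n + 1) b)
    -- The framing moves through `g`, to a strand that the induction hypothesis reaches.
    have key : ∀ s : ℕ, incl d u (n + 1) a * gN d u (n + 2) n * incl d u (n + 1) b *
        tN d u (n + 2) (n + 1) ^ s = incl d u (n + 1) (a * tN d u (n + 1) n ^ s) *
          gN d u (n + 2) n * incl d u (n + 1) b := fun s => by
      rw [mul_assoc, ← t_pow_comm_incl, ← mul_assoc, mul_assoc _ (gN d u (n + 2) n),
        ← t_pow_mul_g, map_mul, map_pow, incl_tN (by omega), ← mul_assoc]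
    have hcyc : ∀ s : ℕ, traceAux d u z x (n + 1) (a * tN d u (n + 1) n ^ s * b) =
        traceAux d u z x (n + 1) (b * a * tN d u (n + 1) n ^ s) := fun s => by
      rw [hcomm, mul_assoc]
    rw [hΦ]
    simp only [key, trace_mul_g_mul, hcyc]
    have := ih (b * a)
    rw [hΦ] at this
    simp only [mul_left_comm _ z, ← Finset.mul_sum]
    rw [this, hcomm _ b a]

lemma trace_incl (hx : x 0 = 1) (a : Yokonuma d u n) :
    traceAux d u z x (n + 1) (incl d u n a) = traceAux d u z x n a :=
  (isJuyumayaTrace_traceAux hx).incl n a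

/-- The E-system makes the idempotent of the last two strands multiplicative for the trace. -/
lemma trace_mul_e (hx : IsESolution d x) (w : Yokonuma d u (n + 1)) :
    traceAux d u z x (n + 2) (incl d u (n + 1) w * eN d u (n + 2) n) =
      eValue d x * traceAux d u z x (n + 1) w := by
  rw [eN, avgIdem, mul_smul_comm, map_smul, Finset.mul_sum, map_sum, eValue, mul_assoc,
    ← trace_sum_t_pow hx, smul_eq_mul]
  congr 1
  refine Finset.sum_congr rfl fun s hs => ?_
  rw [← natCast_sub_self (Finset.mem_range.mp hs).le, ← trace_mul_t_pow,
    map_mul (incl d u (n + 1)), map_pow, incl_tN (by omega), mul_assoc]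

lemma trace_mul_e_mul_g (w : Yokonuma d u (n + 1)) :
    traceAux d u z x (n + 2) (incl d u (n + 1) w * (eN d u (n + 2) n * gN d u (n + 2) n)) =
      z * traceAux d u z x (n + 1) w := by
  have hd : (d : ℂ) ≠ 0 := by exact_mod_cast NeZero.ne d
  rw [eN, avgIdem, smul_mul_assoc, mul_smul_comm, map_smul, Finset.sum_mul, Finset.mul_sum, map_sum]
  have key : ∀ s ∈ Finset.range d, traceAux d u z x (n + 2) (incl d u (n + 1) w *
      (tN d u (n + 2) n ^ s * tN d u (n + 2) (n + 1) ^ (d - s) * gN d u (n + 2) n)) =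
        z * traceAux d u z x (n + 1) w := fun s hs => by
    have := Finset.mem_range.mp hs
    rw [mul_assoc, t_pow_mul_g', ← incl_tN (by omega), ← map_pow, ← map_pow, ← mul_assoc,
      ← mul_assoc, ← map_mul, trace_mul_g_mul, mul_assoc, ← pow_add,
      show s + (d - s) = d by omega, (isYok d u (n + 1)).tpow n (by omega), mul_one]
  rw [Finset.sum_congr rfl key, Finset.sum_const, Finset.card_range, nsmul_eq_mul, smul_eq_mul]
  field_simp

lemma trace_eN (hx : IsESolution d x) {i : ℕ} (hi : i + 1 < n) :
    traceAux d u z x n (eN d u n i) = eValue d x := by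
  obtain ⟨k, rfl⟩ : ∃ k, n = i + 2 + k := ⟨n - (i + 2), by omega⟩
  clear hi
  induction k with
  | zero =>
    have h := trace_mul_e (u := u) (z := z) hx (1 : Yokonuma d u (i + 1))
    rwa [map_one, one_mul, (isJuyumayaTrace_traceAux hx.zero).one, mul_one] at h
  | succ k ih =>
    rw [← ih, ← add_assoc, ← incl_eN (by omega), trace_incl hx.zero]
end Yokonuma

/-! ### The case `E = 1` -/

section ESystem

variable {d : ℕ} [NeZero d] {x : ZMod d → ℂ}

lemma card_mul_eValue (x : ZMod d → ℂ) : (d : ℂ) * eValue d x = ∑ s, x s * x (-s) := by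
  have hd : (d : ℂ) ≠ 0 := by exact_mod_cast NeZero.ne d
  rw [eValue]
  field_simp

/-- The Fourier transform of a solution of the E-system is a multiple of an indicator function,
because the E-system says that the convolution square of `x` is a multiple of `x`. -/
lemma IsESolution.exists_finset (hx : IsESolution d x) : ∃ S : Finset (ZMod d),
    (S.card : ℂ) * eValue d x = 1 ∧
      ∀ j, x j = eValue d x * ∑ k ∈ S, ZMod.stdAddChar (j * k) := by
  classical
  have hd : (d : ℂ) ≠ 0 := by exact_mod_cast NeZero.ne d
  set y : ZMod d → ℂ := fun k => ∑ j : ZMod d, ZMod.stdAddChar (-(j * k)) * x j with hy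
  have hinv : ∀ j, x j = (d : ℂ)⁻¹ * ∑ k, ZMod.stdAddChar (k * j) * y k := fun j => by
    have h := congrFun (LinearEquiv.symm_apply_apply (ZMod.dft (N := d) (E := ℂ)) x) j
    rw [ZMod.invDFT_apply] at h
    simpa only [ZMod.dft_apply, smul_eq_mul] using h.symm
  have hsq : ∀ k, y k * y k = d * eValue d x * y k := fun k => by
    rw [card_mul_eValue, hy]
    simp only
    rw [Finset.sum_mul_sum, Finset.sum_comm, ← Equiv.sum_comp (Equiv.neg (ZMod d)), Finset.mul_sum]
    have h1 : ∀ s : ZMod d, ∑ i, ZMod.stdAddChar (-(i * k)) * x i *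
        (ZMod.stdAddChar (-(Equiv.neg (ZMod d) s * k)) * x (Equiv.neg (ZMod d) s)) =
        ∑ m, ZMod.stdAddChar (-(m * k)) * (x (m + s) * x (-s)) := fun s => by
      rw [← Equiv.sum_comp (Equiv.addRight s)]
      refine Finset.sum_congr rfl fun m _ => ?_
      rw [Equiv.coe_addRight, Equiv.neg_apply, mul_mul_mul_comm, ← AddChar.map_add_eq_mul]
      congr 3
      ring
    rw [Finset.sum_congr rfl fun s _ => h1 s, Finset.sum_comm]
    refine Finset.sum_congr rfl fun m _ => ?_
    rw [← Finset.mul_sum, hx.sum_eq]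
    ring
  have hval : ∀ j, x j = eValue d x *
      ∑ k ∈ Finset.univ.filter (fun k => y k ≠ 0), ZMod.stdAddChar (j * k) := fun j => by
    rw [Finset.sum_filter, Finset.mul_sum, hinv j, Finset.mul_sum]
    refine Finset.sum_congr rfl fun k _ => ?_
    by_cases hk : y k = 0
    · simp [hk]
    · rw [if_pos hk, mul_right_cancel₀ hk (hsq k), mul_comm k j]
      field_simp
  refine ⟨_, ?_, hval⟩
  have h0 := hval 0
  simp only [hx.zero, zero_mul, AddChar.map_zero_eq_one, Finset.sum_const, nsmul_eq_mul,
    mul_one] at h0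
  rw [mul_comm, ← h0]

lemma IsESolution.eValue_ne_zero (hx : IsESolution d x) : eValue d x ≠ 0 := by
  obtain ⟨S, hS, -⟩ := hx.exists_finset
  exact right_ne_zero_of_mul_eq_one hS

lemma IsESolution.eValue_ne_neg_one (hx : IsESolution d x) : eValue d x ≠ -1 := by
  obtain ⟨S, hS, -⟩ := hx.exists_finset
  intro h
  rw [h, mul_neg, mul_one, neg_eq_iff_add_eq_zero] at hS
  exact Nat.cast_add_one_ne_zero S.card hS

/-- A solution of the E-system with `E = 1` is a character of `ℤ/d`. -/
lemma IsESolution.exists_eq_pow (hx : IsESolution d x) (hE : eValue d x = 1) :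
    ∃ c : ℂ, c ^ d = 1 ∧ ∀ m : ℕ, x m = c ^ m := by
  obtain ⟨S, hS, hval⟩ := hx.exists_finset
  rw [hE, mul_one, Nat.cast_eq_one, Finset.card_eq_one] at hS
  obtain ⟨k, rfl⟩ := hS
  have hm : ∀ m : ℕ, x m = ZMod.stdAddChar k ^ m := fun m => by
    rw [hval, hE, one_mul, Finset.sum_singleton, ← AddChar.map_nsmul_eq_pow, nsmul_eq_mul]
  refine ⟨ZMod.stdAddChar k, ?_, hm⟩
  rw [← hm, ZMod.natCast_self, hx.zero]

end ESystem

namespace Yokonuma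

variable {d : ℕ} [NeZero d] {u z : ℂ} {x : ZMod d → ℂ} {n : ℕ}

/-- The homomorphism `Y_{d,n}(u) → H_n(u)` with `g_i ↦ G_i` and `t_j ↦ c`, for a `d`-th root of
unity `c`. -/
def toHecke (u : ℂ) (n : ℕ) {c : ℂ} (hc : c ^ d = 1) : Yokonuma d u n →ₐ[ℂ] Hecke u n :=
  Yokonuma.lift (G := fun i => if h : i < n - 1 then Hecke.G ⟨i, h⟩ else 0)
    (T := fun _ => algebraMap ℂ _ c)
    { far := fun i j h1 h2 => by
        rw [dif_pos (by omega), dif_pos (by omega)]; exact Hecke.G_far _ _ h1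
      braid := fun i h => by
        rw [dif_pos (by omega), dif_pos (by omega)]; exact (Hecke.G_braid _ _ rfl).symm
      tcomm := fun _ _ _ _ => rfl
      tg1 := fun _ _ => Algebra.commutes _ _
      tg2 := fun _ _ => Algebra.commutes _ _
      tg3 := fun _ _ _ _ _ _ => Algebra.commutes _ _
      tpow := fun _ _ => by rw [← map_pow, hc, map_one]
      quad := fun i h => by
        rw [dif_pos (by omega), avgIdem_self (by rw [← map_pow, hc, map_one]), one_mul,
          Hecke.G_sq, sub_smul u 1 (1 : Hecke u n), one_smul]
        abel }

lemma toHecke_g {c : ℂ} (hc : c ^ d = 1) (i : Fin (n - 1)) :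
    toHecke u n hc (g i : Yokonuma d u n) = Hecke.G i :=
  (lift_g _ i).trans (dif_pos i.2)

lemma toHecke_t {c : ℂ} (hc : c ^ d = 1) (j : Fin n) :
    toHecke u n hc (t j : Yokonuma d u n) = algebraMap ℂ _ c :=
  lift_t _ j

lemma toHecke_incl {c : ℂ} (hc : c ^ d = 1) (a : Yokonuma d u n) :
    toHecke u (n + 1) hc (incl d u n a) = Hecke.incl u n (toHecke u n hc a) := by
  have : (toHecke u (n + 1) hc).comp (incl d u n) = (Hecke.incl u n).comp (toHecke u n hc) :=
    algHom_ext (fun i => by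
      rw [AlgHom.comp_apply, AlgHom.comp_apply, toHecke_g, Hecke.incl, Hecke.lift_G,
        ← gN_of, incl_gN (by omega), gN_of (by omega), toHecke_g])
      (fun j => by
        rw [AlgHom.comp_apply, AlgHom.comp_apply, ← tN_of, incl_tN (by omega), tN_of (by omega),
          tN_of (by omega), toHecke_t, toHecke_t, AlgHom.commutes])
  exact DFunLike.congr_fun this a

/-- When the parameters form a character, the Juyumaya trace is the pull-back of an Ocneanu
trace. -/
lemma juyumayaTrace_eq_ocneanuTrace {c : ℂ} (hc : c ^ d = 1) (hx : ∀ m : ℕ, x m = c ^ m)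
    (a : Yokonuma d u n) :
    juyumayaTrace d u z x n a = Hecke.ocneanuTrace u z n (toHecke u n hc a) := by
  have hO := Hecke.isOcneanuTrace u z
  have : juyumayaTrace d u z x =
      fun n => Hecke.ocneanuTrace u z n ∘ₗ (toHecke u n hc).toLinearMap := by
    refine (existsUnique_juyumayaTrace d u z x).unique (isJuyumayaTrace d u z x)
      ⟨fun n a => ?_, fun n a b => ?_, fun n => ?_, fun n a => ?_, fun n a m _ _ => ?_⟩
    · show Hecke.ocneanuTrace u z (n + 1) (toHecke u (n + 1) hc _) = _
      rw [toHecke_incl, hO.incl]; rfl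
    · show Hecke.ocneanuTrace u z n (toHecke u n hc _) =
        Hecke.ocneanuTrace u z n (toHecke u n hc _)
      rw [map_mul (toHecke u n hc), map_mul (toHecke u n hc), hO.comm]
    · show Hecke.ocneanuTrace u z n (toHecke u n hc _) = _
      rw [map_one, hO.one]
    · show Hecke.ocneanuTrace u z (n + 2) (toHecke u (n + 2) hc _) = _
      rw [map_mul, toHecke_incl, toHecke_g, hO.markov]; rfl
    · show Hecke.ocneanuTrace u z (n + 1) (toHecke u (n + 1) hc _) = _
      rw [map_mul, map_pow, toHecke_incl, toHecke_t, ← map_pow, ← Algebra.commutes,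
        ← Algebra.smul_def, map_smul, hO.incl, hx]; rfl
  rw [this]; rfl

end Yokonuma

lemma heckeRep_of {q : ℂ} (hq : q ≠ 0) {n : ℕ} (i : Fin (n - 1)) :
    heckeRep hq n (PresentedGroup.of i) = Hecke.unitG hq i :=
  PresentedGroup.toGroup.of _

lemma yokonumaRep_of {d : ℕ} [NeZero d] {u : ℂ} (hu : u ≠ 0) {n : ℕ} (i : Fin (n - 1)) :
    yokonumaRep d hu n (PresentedGroup.of i) = Yokonuma.unitG hu i :=
  PresentedGroup.toGroup.of _

/-- For `E = 1`, the invariant `Δ_S` is a HOMFLYPT polynomial. -/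
lemma deltaS_eq_homflypt_of_eValue_eq_one {d : ℕ} [NeZero d] {x : ZMod d → ℂ}
    (hx : IsESolution d x) (hE : eValue d x = 1) {u : ℂ} (hu : u ≠ 0) (z s : ℂ) {n : ℕ}
    (α : BraidGroup n) : deltaS d hu x z s α = homflypt hu z s α := by
  obtain ⟨c, hc, hxc⟩ := hx.exists_eq_pow hE
  have : (Units.map (Yokonuma.toHecke u n hc : Yokonuma d u n →* Hecke u n)).comp
      (yokonumaRep d hu n) = heckeRep hu n := PresentedGroup.ext fun i => by
    rw [MonoidHom.comp_apply, yokonumaRep_of, heckeRep_of]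
    exact Units.ext (Yokonuma.toHecke_g hc i)
  rw [deltaS, homflypt, Yokonuma.juyumayaTrace_eq_ocneanuTrace hc hxc, ← this]
  rfl

lemma isESolution_one : IsESolution 1 (1 : ZMod 1 → ℂ) where
  zero := rfl
  system m hm := absurd (Subsingleton.elim m 0) hm

lemma eValue_one : eValue 1 (1 : ZMod 1 → ℂ) = 1 := by
  simp [eValue]

/-! ### The radical of the trace for `z = -E` -/

namespace Yokonuma

section Radical

variable {d : ℕ} [NeZero d] {u z : ℂ} {x : ZMod d → ℂ} {n : ℕ}

lemma eN_mul_gN {i : ℕ} (hi : i + 1 < n) :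
    eN d u n i * gN d u n i = gN d u n i * eN d u n i := by
  have h := e_mul_g (d := d) (u := u) (n := n) ⟨i, by omega⟩
  rwa [e_eq_eN, ← gN_of] at h

lemma eN_mul_eN {i : ℕ} (hi : i + 1 < n) : eN d u n i * eN d u n i = eN d u n i := by
  have h := e_mul_e (d := d) (u := u) (n := n) ⟨i, by omega⟩
  rwa [e_eq_eN] at h

lemma gN_sq {i : ℕ} (hi : i + 1 < n) : gN d u n i * gN d u n i =
    1 + (u - 1) • eN d u n i + (u - 1) • (eN d u n i * gN d u n i) :=
  (isYok d u n).quad i hi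

/-- The element `e_i (1 + g_i)`, which measures how far `g_i ^ 2` is from `1`. -/
def defect (d : ℕ) (u : ℂ) (n i : ℕ) : Yokonuma d u n := eN d u n i * (1 + gN d u n i)

lemma gN_sq_eq_defect {i : ℕ} (hi : i + 1 < n) :
    gN d u n i * gN d u n i = 1 + (u - 1) • defect d u n i := by
  rw [gN_sq hi, defect, mul_add, mul_one, smul_add, add_assoc]

lemma gN_mul_defect {i : ℕ} (hi : i + 1 < n) :
    gN d u n i * defect d u n i = u • defect d u n i := by
  have h : eN d u n i * (gN d u n i * gN d u n i) =
      u • eN d u n i + (u - 1) • (eN d u n i * gN d u n i) := by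
    rw [gN_sq hi, mul_add, mul_add, mul_one, mul_smul_comm, mul_smul_comm, ← mul_assoc,
      eN_mul_eN hi, sub_smul u 1 (eN d u n i), one_smul]
    abel
  rw [defect, ← mul_assoc, ← eN_mul_gN hi, mul_assoc, mul_add, mul_one, mul_add, h, mul_add,
    mul_one, smul_add, sub_smul, one_smul]
  abel

lemma tN_pow_mul_defect {i : ℕ} (hi : i + 1 < n) (k : ℕ) :
    tN d u n (i + 1) ^ k * defect d u n i = tN d u n i ^ k * defect d u n i := by
  have h := isYok d u n
  rw [defect, ← mul_assoc, ← mul_assoc, eN,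
    mul_avgIdem_pow (h.tcomm _ _ (by omega) hi) (h.tpow _ (by omega)) (h.tpow _ hi)]

/-- Conjugation by `g_i g_{i+1}` moves `g_i` to `g_{i+1}` and `e_i` to `e_{i+1}`. -/
lemma defect_succ_mul {i : ℕ} (hi : i + 2 < n) :
    defect d u n (i + 1) * (gN d u n i * gN d u n (i + 1)) =
      gN d u n i * gN d u n (i + 1) * defect d u n i := by
  have h := isYok d u n
  have h1 : tN d u n (i + 1) * (gN d u n i * gN d u n (i + 1)) =
      gN d u n i * gN d u n (i + 1) * tN d u n i := by
    rw [← mul_assoc, h.tg2 i (by omega), mul_assoc,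
      h.tg3 (i + 1) i (by omega) (by omega) (by omega) (by omega), mul_assoc]
  have h2 : tN d u n (i + 1 + 1) * (gN d u n i * gN d u n (i + 1)) =
      gN d u n i * gN d u n (i + 1) * tN d u n (i + 1) := by
    rw [← mul_assoc, h.tg3 i (i + 1 + 1) (by omega) (by omega) (by omega) (by omega), mul_assoc,
      h.tg2 (i + 1) (by omega), mul_assoc]
  have h3 : gN d u n (i + 1) * (gN d u n i * gN d u n (i + 1)) =
      gN d u n i * gN d u n (i + 1) * gN d u n i := by
    rw [← mul_assoc, h.braid i hi]
  rw [defect, defect, mul_assoc, add_mul, h3, one_mul, ← mul_one_add, ← mul_assoc, eN,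
    avgIdem_conj h1 h2, eN, mul_assoc]

lemma trace_mul_defect_two (hx : IsESolution d x) (hz : z = -eValue d x) (a : Yokonuma d u 2) :
    traceAux d u z x 2 (a * defect d u 2 0) = 0 := by
  have h := isYok d u 2
  -- The left ideal of `defect` is spanned by its multiples by powers of the first framing.
  let Q : Submodule ℂ (Yokonuma d u 2) :=
    Submodule.span ℂ (Set.range fun m : ℕ => tN d u 2 0 ^ m * defect d u 2 0)
  have hQ : ∀ m : ℕ, tN d u 2 0 ^ m * defect d u 2 0 ∈ Q := fun m =>
    Submodule.subset_span ⟨m, rfl⟩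
  let S : Subalgebra ℂ (Yokonuma d u 2) :=
    { carrier := {a | ∀ y ∈ Q, a * y ∈ Q}
      mul_mem' := fun {a b} ha hb y hy => by rw [mul_assoc]; exact ha _ (hb _ hy)
      add_mem' := fun {a b} ha hb y hy => by rw [add_mul]; exact Q.add_mem (ha _ hy) (hb _ hy)
      algebraMap_mem' := fun r y hy => by rw [← Algebra.smul_def]; exact Q.smul_mem r hy }
  have hmem : ∀ a : Yokonuma d u 2, (∀ m : ℕ, a * (tN d u 2 0 ^ m * defect d u 2 0) ∈ Q) →
      a ∈ S := fun a ha y hy => by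
    refine Submodule.span_induction (p := fun y _ => a * y ∈ Q) ?_ ?_ ?_ ?_ hy
    · rintro _ ⟨m, rfl⟩
      exact ha m
    · rw [mul_zero]; exact Q.zero_mem
    · intro y y' _ _ hy hy'
      rw [mul_add]; exact Q.add_mem hy hy'
    · intro r y _ hy
      rw [mul_smul_comm]; exact Q.smul_mem r hy
  have hS : S = ⊤ := by
    refine subalgebra_eq_top S (fun i hi => ?_) (fun j hj => ?_)
    · obtain rfl : i = 0 := by omega
      refine hmem _ fun m => ?_
      have h1 : gN d u 2 0 * tN d u 2 0 ^ m = tN d u 2 1 ^ m * gN d u 2 0 :=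
        (t_pow_mul_g' (n := 0) m).symm
      rw [← mul_assoc, h1, mul_assoc, gN_mul_defect (by omega), mul_smul_comm,
        tN_pow_mul_defect (by omega)]
      exact Q.smul_mem _ (hQ m)
    · refine hmem _ fun m => ?_
      obtain rfl | rfl : j = 0 ∨ j = 1 := by omega
      · rw [← mul_assoc, ← pow_succ']; exact hQ _
      · have h1 : Commute (tN d u 2 1) (tN d u 2 0) := h.tcomm 1 0 (by omega) (by omega)
        have h2 := tN_pow_mul_defect (d := d) (u := u) (n := 2) (i := 0) (by omega) 1
        rw [pow_one, pow_one] at h2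
        rw [← mul_assoc, (h1.pow_right m).eq, mul_assoc, h2, ← mul_assoc, ← pow_succ]
        exact hQ _
  have ha : a ∈ S := hS ▸ Algebra.mem_top
  have ha' : a * defect d u 2 0 ∈ Q := ha _ (by simpa using hQ 0)
  have hker : Q ≤ LinearMap.ker (traceAux d u z x 2) := by
    rw [Submodule.span_le]
    rintro _ ⟨m, rfl⟩
    show traceAux d u z x 2 (tN d u 2 0 ^ m * defect d u 2 0) = 0
    have h1 := trace_mul_e (u := u) (z := z) hx (tN d u 1 0 ^ m)
    have h2 := trace_mul_e_mul_g (u := u) (z := z) (x := x) (tN d u 1 0 ^ m)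
    rw [map_pow, incl_tN (by omega)] at h1 h2
    rw [defect, mul_add, mul_one, mul_add, map_add, h1, h2, hz]
    ring
  exact hker ha'

/-- For `z = -E`, the elements `e_i (1 + g_i)` lie in the radical of the trace. -/
lemma trace_mul_defect (hx : IsESolution d x) (hz : z = -eValue d x) (hu : u ≠ 0) {i : ℕ}
    (hi : i + 1 < n) (a : Yokonuma d u n) : traceAux d u z x n (a * defect d u n i) = 0 := by
  induction i generalizing a with
  | zero =>
    obtain ⟨k, rfl⟩ : ∃ k, n = 2 + k := ⟨n - 2, by omega⟩
    clear hi
    induction k with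
    | zero => exact trace_mul_defect_two hx hz a
    | succ k ih =>
      have h : defect d u (2 + k + 1) 0 = incl d u (2 + k) (defect d u (2 + k) 0) := by
        rw [defect, defect, map_mul, map_add, map_one, incl_eN (by omega), incl_gN (by omega)]
      show traceAux d u z x (2 + k + 1) (a * defect d u (2 + k + 1) 0) = 0
      rw [h, trace_succ, condExp_right, ih]
  | succ i ih =>
    have hg : ∀ j, j + 1 < n → IsUnit (gN d u n j) := fun j hj => by
      rw [gN_of (by omega)]; exact (unitG hu _).isUnit
    obtain ⟨b, hb⟩ := (hg i (by omega)).mul (hg (i + 1) hi)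
    have h := defect_succ_mul (d := d) (u := u) hi
    rw [← hb, ← Units.eq_mul_inv_iff_mul_eq] at h
    rw [h, ← mul_assoc, traceAux_comm, ← mul_assoc, ← mul_assoc]
    exact ih (by omega) _

lemma trace_mul_g_sq (hx : IsESolution d x) (h : u = 1 ∨ z = -eValue d x) (hu : u ≠ 0) {i : ℕ}
    (hi : i + 1 < n) (a : Yokonuma d u n) :
    traceAux d u z x n (a * (gN d u n i * gN d u n i)) = traceAux d u z x n a := by
  rw [gN_sq_eq_defect hi, mul_add, mul_one, mul_smul_comm, map_add, map_smul]
  rcases h with rfl | hz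
  · simp
  · rw [trace_mul_defect hx hz hu hi, smul_zero, add_zero]

end Radical

end Yokonuma

/-! ### The Hecke algebra acts on the quotient by the radical -/

namespace Yokonuma

section Quotient


variable {d : ℕ} [NeZero d] {u z : ℂ} {x : ZMod d → ℂ} {n : ℕ}

/-- The radical `{y | ∀ a, tr (a y) = 0}` of the Juyumaya trace, as a left ideal. -/
def radical (d : ℕ) [NeZero d] (u z : ℂ) (x : ZMod d → ℂ) (n : ℕ) :
    Submodule (Yokonuma d u n) (Yokonuma d u n) where
  carrier := {y | ∀ a, traceAux d u z x n (a * y) = 0}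
  zero_mem' := fun a => by rw [mul_zero, map_zero]
  add_mem' := fun {y y'} hy hy' a => by rw [mul_add, map_add, hy, hy', add_zero]
  smul_mem' := fun c y hy a => by rw [smul_eq_mul, ← mul_assoc, hy]

/-- The functional that the trace induces on the quotient by its radical. -/
def traceQuot (d : ℕ) [NeZero d] (u z : ℂ) (x : ZMod d → ℂ) (n : ℕ) :
    (Yokonuma d u n ⧸ radical d u z x n) →ₗ[ℂ] ℂ :=
  ((radical d u z x n).restrictScalars ℂ).liftQ (traceAux d u z x n)
      (fun y hy => by simpa using hy 1) ∘ₗ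
    (Submodule.Quotient.restrictScalarsEquiv ℂ (radical d u z x n)).symm.toLinearMap

lemma traceQuot_mk (y : Yokonuma d u n) :
    traceQuot d u z x n (Submodule.Quotient.mk y) = traceAux d u z x n y := rfl

lemma hecke_quad_mem_radical {q : ℂ} {b : Yokonuma d u n}
    (hb : ∀ a, traceAux d u z x n (a * (b * b)) =
      (q - 1) * traceAux d u z x n (a * b) + q * traceAux d u z x n a) (y : Yokonuma d u n) :
    b * b * y - ((q - 1) • (b * y) + q • y) ∈ radical d u z x n := by
  intro a
  have h1 : a * (b * b * y - ((q - 1) • (b * y) + q • y)) =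
      a * (b * b) * y - ((q - 1) • (a * b * y) + q • (a * y)) := by
    simp only [mul_sub, mul_add, mul_smul_comm, mul_assoc]
  have h2 : y * (a * (b * b)) = y * a * (b * b) := by rw [mul_assoc]
  have h3 : y * (a * b) = y * a * b := by rw [mul_assoc]
  rw [h1, map_sub, map_add, map_smul, map_smul, traceAux_comm _ _ y, traceAux_comm _ _ y,
    traceAux_comm _ a y, h2, h3, hb, smul_eq_mul, smul_eq_mul, sub_self]

/-- The action of `Y_{d,n}(u)` on its quotient by the radical of the trace. -/
def quotAction (d : ℕ) [NeZero d] (u z : ℂ) (x : ZMod d → ℂ) (n : ℕ) :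
    Yokonuma d u n →ₐ[ℂ] Module.End ℂ (Yokonuma d u n ⧸ radical d u z x n) :=
  Algebra.lsmul ℂ ℂ (Yokonuma d u n ⧸ radical d u z x n)

lemma quotAction_mk (a y : Yokonuma d u n) :
    quotAction d u z x n a (Submodule.Quotient.mk y) = Submodule.Quotient.mk (a * y) := rfl

lemma quotAction_quad {q : ℂ} {b : Yokonuma d u n}
    (hb : ∀ a, traceAux d u z x n (a * (b * b)) =
      (q - 1) * traceAux d u z x n (a * b) + q * traceAux d u z x n a) :
    quotAction d u z x n b * quotAction d u z x n b =
      (q - 1) • quotAction d u z x n b + q • 1 := by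
  refine LinearMap.ext fun y => ?_
  obtain ⟨y, rfl⟩ := Submodule.Quotient.mk_surjective _ y
  rw [← map_mul, quotAction_mk, LinearMap.add_apply, LinearMap.smul_apply, LinearMap.smul_apply,
    quotAction_mk, Module.End.one_apply]
  exact (Submodule.Quotient.eq _).mpr (hecke_quad_mem_radical hb y)

/-- If the generators satisfy the quadratic Hecke relation under the trace, then the Hecke algebra
acts on the quotient by the radical. -/
def heckeAction {q : ℂ} (hT : ∀ (i : Fin (n - 1)) (a : Yokonuma d u n),
    traceAux d u z x n (a * (g i * g i)) =
      (q - 1) * traceAux d u z x n (a * g i) + q * traceAux d u z x n a) :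
    Hecke q n →ₐ[ℂ] Module.End ℂ (Yokonuma d u n ⧸ radical d u z x n) :=
  Hecke.lift (fun i => quotAction d u z x n (g i))
    (fun i j h => by rw [← map_mul, g_far i j h, map_mul])
    (fun i j h => by rw [← map_mul, ← map_mul, g_braid i j h, map_mul, map_mul])
    (fun i => quotAction_quad (hT i))

/-- The homomorphism from the free algebra to `Y_{d,n}(u)` with `σ_i ↦ g_i`. -/
def freeRep (d : ℕ) (u : ℂ) (n : ℕ) : FreeAlgebra ℂ (Fin (n - 1)) →ₐ[ℂ] Yokonuma d u n :=
  FreeAlgebra.lift ℂ g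

/-- The homomorphism from the free algebra to `H_n(q)` with `σ_i ↦ G_i`. -/
def freeHecke (q : ℂ) (n : ℕ) : FreeAlgebra ℂ (Fin (n - 1)) →ₐ[ℂ] Hecke q n :=
  FreeAlgebra.lift ℂ Hecke.G

/-- The inclusion of free algebras with `σ_i ↦ σ_i`. -/
def freeIncl (n : ℕ) : FreeAlgebra ℂ (Fin (n - 1)) →ₐ[ℂ] FreeAlgebra ℂ (Fin (n + 1 - 1)) :=
  FreeAlgebra.lift ℂ fun i => FreeAlgebra.ι ℂ ⟨i, by omega⟩

lemma freeRep_ι (i : Fin (n - 1)) : freeRep d u n (FreeAlgebra.ι ℂ i) = g i :=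
  FreeAlgebra.lift_ι_apply _ _

lemma freeHecke_ι {q : ℂ} (i : Fin (n - 1)) :
    freeHecke q n (FreeAlgebra.ι ℂ i) = Hecke.G i :=
  FreeAlgebra.lift_ι_apply _ _

lemma freeIncl_ι (i : Fin (n - 1)) :
    freeIncl n (FreeAlgebra.ι ℂ i) = FreeAlgebra.ι ℂ ⟨i, by omega⟩ :=
  FreeAlgebra.lift_ι_apply _ _

lemma freeHecke_surjective (q : ℂ) (n : ℕ) : Function.Surjective (freeHecke q n) := by
  have : freeHecke q n = RingQuot.mkAlgHom ℂ (HeckeRel q n) :=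
    FreeAlgebra.hom_ext (funext fun i => freeHecke_ι i)
  rw [this]
  exact RingQuot.mkAlgHom_surjective ℂ _

lemma freeRep_freeIncl (f : FreeAlgebra ℂ (Fin (n - 1))) :
    freeRep d u (n + 1) (freeIncl n f) = incl d u n (freeRep d u n f) := by
  have : (freeRep d u (n + 1)).comp (freeIncl n) = (incl d u n).comp (freeRep d u n) := by
    refine FreeAlgebra.hom_ext (funext fun i => ?_)
    simp only [Function.comp_apply, AlgHom.comp_apply]
    rw [freeIncl_ι, freeRep_ι, freeRep_ι, ← gN_of, ← gN_of, incl_gN (by omega)]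
  exact DFunLike.congr_fun this f

lemma freeHecke_freeIncl {q : ℂ} (f : FreeAlgebra ℂ (Fin (n - 1))) :
    freeHecke q (n + 1) (freeIncl n f) = Hecke.incl q n (freeHecke q n f) := by
  have : (freeHecke q (n + 1)).comp (freeIncl n) = (Hecke.incl q n).comp (freeHecke q n) := by
    refine FreeAlgebra.hom_ext (funext fun i => ?_)
    simp only [Function.comp_apply, AlgHom.comp_apply]
    rw [freeIncl_ι, freeHecke_ι, freeHecke_ι, Hecke.incl, Hecke.lift_G]
  exact DFunLike.congr_fun this f

lemma heckeAction_freeHecke {q : ℂ} (hT : ∀ (i : Fin (n - 1)) (a : Yokonuma d u n),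
    traceAux d u z x n (a * (g i * g i)) =
      (q - 1) * traceAux d u z x n (a * g i) + q * traceAux d u z x n a)
    (f : FreeAlgebra ℂ (Fin (n - 1))) :
    heckeAction hT (freeHecke q n f) = quotAction d u z x n (freeRep d u n f) := by
  have : (heckeAction hT).comp (freeHecke q n) = (quotAction d u z x n).comp (freeRep d u n) := by
    refine FreeAlgebra.hom_ext (funext fun i => ?_)
    simp only [Function.comp_apply, AlgHom.comp_apply]
    rw [freeHecke_ι, freeRep_ι, heckeAction, Hecke.lift_G]
  exact DFunLike.congr_fun this f

/-- If the generators satisfy the quadratic Hecke relation under the Juyumaya trace, then the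
functional that this trace induces on the Hecke algebra is an Ocneanu trace. -/
lemma ocneanuTrace_eq_traceQuot (hx : x 0 = 1) {q : ℂ}
    (hT : ∀ (n : ℕ) (i : Fin (n - 1)) (a : Yokonuma d u n),
      traceAux d u z x n (a * (g i * g i)) =
        (q - 1) * traceAux d u z x n (a * g i) + q * traceAux d u z x n a)
    (n : ℕ) (h : Hecke q n) :
    Hecke.ocneanuTrace q z n h =
      traceQuot d u z x n (heckeAction (hT n) h (Submodule.Quotient.mk 1)) := by
  have hJ := isJuyumayaTrace_traceAux (d := d) (u := u) (z := z) hx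
  let τ : (n : ℕ) → Hecke q n →ₗ[ℂ] ℂ := fun n =>
    traceQuot d u z x n ∘ₗ LinearMap.applyₗ (Submodule.Quotient.mk 1) ∘ₗ
      (heckeAction (hT n)).toLinearMap
  -- On words in the generators, `τ` is the Juyumaya trace of the corresponding word.
  have hτ : ∀ n f, τ n (freeHecke q n f) = traceAux d u z x n (freeRep d u n f) := fun n f => by
    show traceQuot d u z x n (heckeAction (hT n) (freeHecke q n f) (Submodule.Quotient.mk 1)) = _
    rw [heckeAction_freeHecke, quotAction_mk, mul_one, traceQuot_mk]
  have hτO : Hecke.IsOcneanuTrace q z τ := by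
    refine ⟨fun n h => ?_, fun n h h' => ?_, fun n => ?_, fun n h => ?_⟩
    · obtain ⟨f, rfl⟩ := freeHecke_surjective q n h
      rw [← freeHecke_freeIncl, hτ, hτ, freeRep_freeIncl, hJ.incl]
    · obtain ⟨f, rfl⟩ := freeHecke_surjective q n h
      obtain ⟨f', rfl⟩ := freeHecke_surjective q n h'
      rw [← map_mul (freeHecke q n), ← map_mul (freeHecke q n), hτ, hτ,
        map_mul (freeRep d u n), map_mul (freeRep d u n), hJ.comm]
    · rw [← map_one (freeHecke q n), hτ, map_one, hJ.one]
    · obtain ⟨f, rfl⟩ := freeHecke_surjective q (n + 1) h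
      rw [← freeHecke_freeIncl, ← freeHecke_ι, ← map_mul (freeHecke q (n + 2)), hτ, hτ,
        map_mul (freeRep d u (n + 2)), freeRep_freeIncl, freeRep_ι, hJ.markov]
  have : Hecke.ocneanuTrace q z = τ :=
    (Hecke.existsUnique_ocneanuTrace q z).unique (Hecke.isOcneanuTrace q z) hτO
  rw [this]
  rfl

end Quotient

end Yokonuma

/-- If the generators satisfy the quadratic Hecke relation under the Juyumaya trace, then `Δ_S` is
a HOMFLYPT polynomial. -/
lemma deltaS_eq_homflypt_of_trace_quad {d : ℕ} [NeZero d] {u z : ℂ} {x : ZMod d → ℂ}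
    (hx : x 0 = 1) {q : ℂ} (hq : q ≠ 0) (hu : u ≠ 0)
    (hT : ∀ (n : ℕ) (i : Fin (n - 1)) (a : Yokonuma d u n),
      Yokonuma.traceAux d u z x n (a * (Yokonuma.g i * Yokonuma.g i)) =
        (q - 1) * Yokonuma.traceAux d u z x n (a * Yokonuma.g i) +
          q * Yokonuma.traceAux d u z x n a) (s : ℂ) {n : ℕ} (α : BraidGroup n) :
    deltaS d hu x z s α = homflypt hq z s α := by
  have h : (Units.map (Yokonuma.heckeAction (hT n) : Hecke q n →*
      Module.End ℂ (Yokonuma d u n ⧸ Yokonuma.radical d u z x n))).comp (heckeRep hq n) =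
      (Units.map (Yokonuma.quotAction d u z x n : Yokonuma d u n →*
      Module.End ℂ (Yokonuma d u n ⧸ Yokonuma.radical d u z x n))).comp
        (yokonumaRep d hu n) := PresentedGroup.ext fun i => by
    rw [MonoidHom.comp_apply, MonoidHom.comp_apply, yokonumaRep_of, heckeRep_of]
    exact Units.ext (Hecke.lift_G i)
  have h1 : Yokonuma.heckeAction (hT n) (heckeRep hq n α : Hecke q n) =
      Yokonuma.quotAction d u z x n (yokonumaRep d hu n α : Yokonuma d u n) :=
    congrArg Units.val (DFunLike.congr_fun h α)
  rw [deltaS, homflypt, Yokonuma.ocneanuTrace_eq_traceQuot hx hT, h1, Yokonuma.quotAction_mk,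
    mul_one, Yokonuma.traceQuot_mk, Yokonuma.juyumayaTrace_eq hx]

/-- For `u = 1` or `z = -E`, the elements `g_i ^ 2 - 1` are invisible to the trace, and `Δ_S` is
the HOMFLYPT polynomial with `q = 1`. -/
lemma deltaS_eq_homflypt_one {d : ℕ} [NeZero d] {u z : ℂ} {x : ZMod d → ℂ}
    (hx : IsESolution d x) (hu : u ≠ 0) (h : u = 1 ∨ z = -eValue d x) (s : ℂ) {n : ℕ}
    (α : BraidGroup n) : deltaS d hu x z s α = homflypt one_ne_zero z s α := by
  refine deltaS_eq_homflypt_of_trace_quad hx.zero one_ne_zero hu (fun n i a => ?_) s α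
  have := Yokonuma.trace_mul_g_sq (n := n) (i := i) hx h hu (by omega) a
  rw [Yokonuma.gN_of i.2] at this
  rw [this]
  ring

/-! ### Comparison of HOMFLYPT polynomials, and sufficiency of the 14 cases -/

lemma expSum_of {n : ℕ} (i : Fin (n - 1)) :
    expSum (PresentedGroup.of i : BraidGroup n) = 1 :=
  congrArg Multiplicative.toAdd (PresentedGroup.toGroup.of _)

/-- Two representations of the braid group whose values on the generators differ by the scalar `c`
differ by `c ^ ε(α)` on `α`. -/
lemma map_eq_zpow_expSum_smul {A : Type*} [Ring A] [Algebra ℂ A] {n : ℕ}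
    (ρ ρ' : BraidGroup n →* Aˣ) {c : ℂ} (hc : c ≠ 0)
    (h : ∀ i, (ρ' (PresentedGroup.of i) : A) = c • (ρ (PresentedGroup.of i) : A))
    (α : BraidGroup n) : (ρ' α : A) = c ^ expSum α • (ρ α : A) := by
  let κ : ℂˣ →* Aˣ := Units.map (algebraMap ℂ A : ℂ →* A)
  have hκ : ∀ (m : ℂˣ) (a : Aˣ), Commute (κ m) (MonoidHom.id Aˣ a) := fun m a =>
    Units.ext (Algebra.commutes (m : ℂ) (a : A))
  let ψ : BraidGroup n →* Aˣ := (MonoidHom.noncommCoprod κ (MonoidHom.id Aˣ) hκ).comp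
    (((zpowersHom ℂˣ (Units.mk0 c hc)).comp (expSumHom n)).prod ρ)
  have hψ : ∀ α, (ψ α : A) = c ^ expSum α • (ρ α : A) := fun α => by
    rw [Algebra.smul_def]
    show ((κ (Units.mk0 c hc ^ expSum α) * ρ α : Aˣ) : A) = _
    rw [Units.val_mul, Units.coe_map, Units.val_zpow_eq_zpow_val]
    rfl
  have : ρ' = ψ := PresentedGroup.ext fun i => Units.ext (by
    rw [h, hψ, expSum_of, zpow_one])
  rw [this, hψ]

/-- For `ζ = q` and for `ζ = -1`, the Ocneanu trace is the one-dimensional representation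
`G_i ↦ ζ`, which gives an explicit HOMFLYPT polynomial. -/
lemma homflypt_eq_of_scalar {q ζ : ℂ} (hq : q ≠ 0) (hζ : ζ ≠ 0) (h : ζ = q ∨ ζ = -1) (s : ℂ)
    {n : ℕ} (α : BraidGroup n) :
    homflypt hq ζ s α = (1 / (ζ * s)) ^ (n - 1) * (ζ * s) ^ expSum α := by
  let χ : (n : ℕ) → Hecke q n →ₐ[ℂ] ℂ := fun n => Hecke.lift (fun _ => ζ) (fun _ _ _ => rfl)
    (fun _ _ _ => rfl) (fun _ => by
      rcases h with rfl | rfl <;> simp only [smul_eq_mul] <;> ring)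
  have hχ : ∀ n i, χ n (Hecke.G i) = ζ := fun n i => Hecke.lift_G i
  have hincl : ∀ n a, χ (n + 1) (Hecke.incl q n a) = χ n a := fun n a => by
    have : (χ (n + 1)).comp (Hecke.incl q n) = χ n := Hecke.algHom_ext fun i => by
      rw [AlgHom.comp_apply, Hecke.incl, Hecke.lift_G, hχ, hχ]
    exact DFunLike.congr_fun this a
  have hO : Hecke.ocneanuTrace q ζ = fun n => (χ n).toLinearMap :=
    (Hecke.existsUnique_ocneanuTrace q ζ).unique (Hecke.isOcneanuTrace q ζ)
      ⟨fun n a => hincl n a, fun n a b => by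
        simp only [AlgHom.toLinearMap_apply, map_mul, mul_comm], fun n => map_one (χ n),
        fun n a => by
          simp only [AlgHom.toLinearMap_apply, map_mul]
          rw [hχ, hincl, mul_comm]⟩
  have hα := map_eq_zpow_expSum_smul (A := ℂ) 1
    ((Units.map (χ n : Hecke q n →* ℂ)).comp (heckeRep hq n)) hζ (fun i => by
      rw [MonoidHom.comp_apply, heckeRep_of]
      exact (hχ n i).trans (by simp)) α
  have hα' : χ n (heckeRep hq n α : Hecke q n) = ζ ^ expSum α := by simpa using hα
  rw [homflypt, hO]
  simp only [AlgHom.toLinearMap_apply]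
  rw [hα', mul_assoc, ← mul_zpow, mul_comm s]

/-- The isomorphism `G_i ↦ -u G_i` of Hecke algebras exchanges the parameters `u` and `1 / u`. -/
lemma homflypt_inv {u z : ℂ} (hu : u ≠ 0) (hq : 1 / u ≠ 0) (s : ℂ) {n : ℕ} (α : BraidGroup n) :
    homflypt hq (-z / u) (-u * s) α = homflypt hu z s α := by
  let φ : (n : ℕ) → Hecke u n →ₐ[ℂ] Hecke (1 / u) n := fun n =>
    Hecke.lift (fun i => (-u) • Hecke.G i)
      (fun i j h => by
        simp only [smul_mul_assoc, mul_smul_comm, Hecke.G_far i j h])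
      (fun i j h => by
        simp only [smul_mul_assoc, mul_smul_comm, Hecke.G_braid i j h])
      (fun i => by
        rw [smul_mul_assoc, mul_smul_comm, Hecke.G_sq, smul_add, smul_add, smul_smul, smul_smul,
          smul_smul, smul_smul, smul_smul]
        congr 2 <;> field_simp
        ring)
  have hφ : ∀ n i, φ n (Hecke.G i) = (-u) • Hecke.G i := fun n i => Hecke.lift_G i
  have hincl : ∀ n a, φ (n + 1) (Hecke.incl u n a) = Hecke.incl (1 / u) n (φ n a) := fun n a => by
    have : (φ (n + 1)).comp (Hecke.incl u n) = (Hecke.incl (1 / u) n).comp (φ n) :=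
      Hecke.algHom_ext fun i => by
        rw [AlgHom.comp_apply, AlgHom.comp_apply, hφ, map_smul, Hecke.incl, Hecke.incl,
          Hecke.lift_G, hφ, Hecke.lift_G]
    exact DFunLike.congr_fun this a
  have hT := Hecke.isOcneanuTrace (1 / u) (-z / u)
  have hO : Hecke.ocneanuTrace u z = fun n =>
      Hecke.ocneanuTrace (1 / u) (-z / u) n ∘ₗ (φ n).toLinearMap :=
    (Hecke.existsUnique_ocneanuTrace u z).unique (Hecke.isOcneanuTrace u z)
      ⟨fun n a => by
        simp only [LinearMap.comp_apply, AlgHom.toLinearMap_apply]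
        rw [hincl, hT.incl], fun n a b => by
        simp only [LinearMap.comp_apply, AlgHom.toLinearMap_apply, map_mul]
        rw [hT.comm], fun n => by
        simp only [LinearMap.comp_apply, AlgHom.toLinearMap_apply, map_one]
        rw [hT.one], fun n a => by
        simp only [LinearMap.comp_apply, AlgHom.toLinearMap_apply, map_mul]
        rw [hincl, hφ, mul_smul_comm, map_smul, hT.markov, smul_eq_mul]
        field_simp⟩
  have hα := map_eq_zpow_expSum_smul (heckeRep hq n)
    ((Units.map (φ n : Hecke u n →* Hecke (1 / u) n)).comp (heckeRep hu n)) (neg_ne_zero.mpr hu)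
    (fun i => by
      rw [MonoidHom.comp_apply, heckeRep_of, heckeRep_of]
      exact hφ n i) α
  have hα' : φ n (heckeRep hu n α : Hecke u n) =
      (-u) ^ expSum α • (heckeRep hq n α : Hecke (1 / u) n) := hα
  rw [homflypt, homflypt, hO]
  simp only [LinearMap.comp_apply, AlgHom.toLinearMap_apply]
  rw [hα', map_smul, smul_eq_mul, mul_zpow, show -z / u * (-u * s) = z * s by field_simp]
  ring

/-- Three ways in which HOMFLYPT polynomials with different parameters coincide. -/
lemma homflypt_eq_homflypt {q ζ u z s r : ℂ} (hq : q ≠ 0) (hζ : ζ ≠ 0) (hu : u ≠ 0) (hz : z ≠ 0)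
    (h : (q = u ∧ ζ = z) ∨ (q = 1 / u ∧ ζ = -z / u) ∨
      ((ζ = q ∨ ζ = -1) ∧ (z = u ∨ z = -1))) (hD : ζ * s = z * r) {n : ℕ} (α : BraidGroup n) :
    homflypt hq ζ s α = homflypt hu z r α := by
  rcases h with ⟨rfl, rfl⟩ | ⟨rfl, rfl⟩ | ⟨h1, h2⟩
  · rw [mul_left_cancel₀ hζ hD]
  · have : s = -u * r := by
      field_simp at hD
      linear_combination -hD
    rw [this, homflypt_inv]
  · rw [homflypt_eq_of_scalar hq hζ h1, homflypt_eq_of_scalar hu hz h2, hD]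

/-- In each of the 14 cases, equality of the two normalisations suffices. -/
lemma homflypt_eq_deltaS_of_case {d : ℕ} [NeZero d] {x : ZMod d → ℂ} (hx : IsESolution d x)
    {q ζ u z s r : ℂ} (hq : q ≠ 0) (hζ : ζ ≠ 0) (hu : u ≠ 0) (hz : z ≠ 0)
    (h : CoincidenceCase q ζ u z (eValue d x)) (hD : ζ * s = z * r) {n : ℕ} (α : BraidGroup n) :
    homflypt hq ζ s α = deltaS d hu x z r α := by
  have h1 : u = 1 ∨ z = -eValue d x →
      ((q = 1 ∧ ζ = z) ∨ (q = 1 / 1 ∧ ζ = -z / 1) ∨ ((ζ = q ∨ ζ = -1) ∧ (z = 1 ∨ z = -1))) →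
        homflypt hq ζ s α = deltaS d hu x z r α := fun hu1 hc => by
    rw [deltaS_eq_homflypt_one hx hu hu1]
    exact homflypt_eq_homflypt hq hζ one_ne_zero hz hc hD α
  have h2 : eValue d x = 1 →
      ((q = u ∧ ζ = z) ∨ (q = 1 / u ∧ ζ = -z / u) ∨ ((ζ = q ∨ ζ = -1) ∧ (z = u ∨ z = -1))) →
        homflypt hq ζ s α = deltaS d hu x z r α := fun hE hc => by
    rw [deltaS_eq_homflypt_of_eValue_eq_one hx hE hu]
    exact homflypt_eq_homflypt hq hζ hu hz hc hD α
  simp only [div_one] at h1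
  rcases h with ⟨a, b, c⟩ | ⟨a, b, c⟩ | ⟨a, b, c⟩ | ⟨a, b, c⟩ | ⟨a, b, c⟩ | ⟨a, b, c⟩ | ⟨a, b, c⟩ |
    ⟨a, b, c⟩ | ⟨a, b, c⟩ | ⟨a, b, c⟩ | ⟨a, b, c⟩ | ⟨a, b, c⟩ | ⟨a, b, c⟩ | ⟨a, b, c⟩
  · exact h1 (.inl c) (.inl ⟨a, b⟩)
  · exact h1 (.inl c) (.inr (.inl ⟨a, b⟩))
  · exact h1 (.inl b) (.inr (.inr ⟨.inl a, .inl c⟩))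
  · exact h1 (.inl b) (.inr (.inr ⟨.inl a, .inr c⟩))
  · exact h1 (.inl b) (.inr (.inr ⟨.inr a, .inl c⟩))
  · exact h1 (.inl b) (.inr (.inr ⟨.inr a, .inr c⟩))
  · exact h1 (.inr c) (.inr (.inl ⟨a, by rw [b, c, neg_neg]⟩))
  · exact h1 (.inr c) (.inl ⟨a, by rw [b, c]⟩)
  · exact h2 c (.inr (.inr ⟨.inl a, .inr b⟩))
  · exact h2 c (.inr (.inr ⟨.inl a, .inl b⟩))
  · exact h2 c (.inr (.inr ⟨.inr a, .inr b⟩))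
  · exact h2 c (.inr (.inr ⟨.inr a, .inl b⟩))
  · exact h2 c (.inl ⟨a, b⟩)
  · exact h2 c (.inr (.inl ⟨a, b⟩))

lemma deltaS_two_one {d : ℕ} [NeZero d] (x : ZMod d → ℂ) {u : ℂ} (hu : u ≠ 0) (z s : ℂ) :
    deltaS d hu x z s (1 : BraidGroup 2) = 1 / (z * s) := by
  rw [deltaS, map_one, Units.val_one, (Yokonuma.isJuyumayaTrace d u z x).one, expSum, map_one]
  simp

/-- The HOMFLYPT polynomial is the invariant `Δ_S` for `d = 1`, so that its values are special cases
of those of `Δ_S`. -/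
lemma homflypt_eq_deltaS {q : ℂ} (hq : q ≠ 0) (ζ s : ℂ) {n : ℕ} (α : BraidGroup n) :
    homflypt hq ζ s α = deltaS 1 hq 1 ζ s α :=
  (deltaS_eq_homflypt_of_eValue_eq_one isESolution_one eValue_one hq ζ s α).symm

/-- The unlink with two components compares the two normalisations. -/
lemma mul_eq_mul_of_unlink {d : ℕ} [NeZero d] {x : ZMod d → ℂ} {q ζ u z s r : ℂ} (hq : q ≠ 0)
    (hu : u ≠ 0) (h : homflypt hq ζ s (1 : BraidGroup 2) = deltaS d hu x z r (1 : BraidGroup 2)) :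
    ζ * s = z * r := by
  rw [homflypt_eq_deltaS, deltaS_two_one, deltaS_two_one, one_div, one_div] at h
  exact inv_injective h

/-! ### Traces of some braids on two and three strands -/

namespace Yokonuma

variable {d : ℕ} [NeZero d] {u z : ℂ} {x : ZMod d → ℂ} {n : ℕ}

lemma eN_mul_gN_sq {i : ℕ} (hi : i + 1 < n) : eN d u n i * (gN d u n i * gN d u n i) =
    u • eN d u n i + (u - 1) • (eN d u n i * gN d u n i) := by
  rw [gN_sq hi, mul_add, mul_add, mul_one, mul_smul_comm, mul_smul_comm, ← mul_assoc,
    eN_mul_eN hi, sub_smul u 1 (eN d u n i), one_smul]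
  abel

lemma trace_mul_gN (w : Yokonuma d u (n + 1)) :
    traceAux d u z x (n + 2) (incl d u (n + 1) w * gN d u (n + 2) n) =
      z * traceAux d u z x (n + 1) w := by
  have h := trace_mul_g_mul (z := z) (x := x) w 1
  rwa [map_one, mul_one, mul_one] at h

lemma trace_one (hx : x 0 = 1) : traceAux d u z x n 1 = 1 := (isJuyumayaTrace_traceAux hx).one n

lemma trace_gN_two (hx : x 0 = 1) : traceAux d u z x 2 (gN d u 2 0) = z := by
  have h := trace_mul_gN (n := 0) (u := u) (z := z) (x := x) (1 : Yokonuma d u 1)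
  rwa [map_one, one_mul, trace_one hx, mul_one] at h

lemma trace_eN_mul_gN_two (hx : x 0 = 1) :
    traceAux d u z x 2 (eN d u 2 0 * gN d u 2 0) = z := by
  have h := trace_mul_e_mul_g (n := 0) (u := u) (z := z) (x := x) (1 : Yokonuma d u 1)
  rwa [map_one, one_mul, trace_one hx, mul_one] at h

lemma trace_gN_sq_two (hx : IsESolution d x) :
    traceAux d u z x 2 (gN d u 2 0 * gN d u 2 0) =
      1 + (u - 1) * eValue d x + (u - 1) * z := by
  rw [gN_sq (by omega), map_add, map_add, map_smul, map_smul, trace_one hx.zero,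
    trace_eN hx (by omega), trace_eN_mul_gN_two hx.zero, smul_eq_mul, smul_eq_mul]

lemma trace_eN_mul_gN_sq_two (hx : IsESolution d x) :
    traceAux d u z x 2 (eN d u 2 0 * (gN d u 2 0 * gN d u 2 0)) =
      u * eValue d x + (u - 1) * z := by
  rw [eN_mul_gN_sq (by omega), map_add, map_smul, map_smul,
    trace_eN hx (by omega), trace_eN_mul_gN_two hx.zero, smul_eq_mul, smul_eq_mul]

lemma trace_gN_cube_two (hx : IsESolution d x) :
    traceAux d u z x 2 (gN d u 2 0 * gN d u 2 0 * gN d u 2 0) =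
      (u ^ 2 - u + 1) * z + u * (u - 1) * eValue d x := by
  rw [gN_sq (by omega), add_mul, add_mul, one_mul, smul_mul_assoc, smul_mul_assoc, mul_assoc,
    map_add, map_add, map_smul, map_smul, trace_gN_two hx.zero, trace_eN_mul_gN_two hx.zero,
    trace_eN_mul_gN_sq_two hx, smul_eq_mul, smul_eq_mul]
  ring

/-- The inverse of `g_i`. -/
def gInv (d : ℕ) (u : ℂ) (n i : ℕ) : Yokonuma d u n :=
  gN d u n i + (u⁻¹ - 1) • eN d u n i + (u⁻¹ - 1) • (eN d u n i * gN d u n i)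

lemma val_inv_unitG (hu : u ≠ 0) (i : Fin (n - 1)) :
    (((unitG hu i)⁻¹ : (Yokonuma d u n)ˣ) : Yokonuma d u n) = gInv d u n i := by
  rw [gInv, gN_of i.2, ← e_eq_eN]
  rfl

lemma gN_mul_gInv (hu : u ≠ 0) {i : ℕ} (hi : i + 1 < n) : gN d u n i * gInv d u n i = 1 := by
  rw [gN_of (by omega)]
  rw [show gInv d u n i = _ from (val_inv_unitG hu ⟨i, by omega⟩).symm]
  exact (unitG hu _).mul_inv

lemma gInv_mul_gN (hu : u ≠ 0) {i : ℕ} (hi : i + 1 < n) : gInv d u n i * gN d u n i = 1 := by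
  rw [gN_of (by omega)]
  rw [show gInv d u n i = _ from (val_inv_unitG hu ⟨i, by omega⟩).symm]
  exact (unitG hu _).inv_mul

/-- The trace of the braid `σ_1 σ_2⁻¹ σ_1 σ_2⁻¹`, whose closure is the figure-eight knot. -/
lemma trace_figureEight (hx : IsESolution d x) (hu : u ≠ 0) :
    traceAux d u z x 3 (gN d u 3 0 * gInv d u 3 1 * gN d u 3 0 * gInv d u 3 1) =
      z ^ 2 + (u⁻¹ - 1) * ((u * eValue d x + (u - 1) * z) *
        (z + (u⁻¹ - 1) * (eValue d x + z)) + z ^ 2) := by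
  have h := isYok d u 3
  obtain ⟨a, ha⟩ : ∃ a, a = gN d u 3 0 := ⟨_, rfl⟩
  obtain ⟨b, hb⟩ : ∃ b, b = gN d u 3 1 := ⟨_, rfl⟩
  obtain ⟨a', ha'⟩ : ∃ a', a' = gInv d u 3 0 := ⟨_, rfl⟩
  obtain ⟨b', hb'⟩ : ∃ b', b' = gInv d u 3 1 := ⟨_, rfl⟩
  obtain ⟨f, hf⟩ : ∃ f, f = eN d u 3 0 := ⟨_, rfl⟩
  obtain ⟨e, he⟩ : ∃ e, e = eN d u 3 1 := ⟨_, rfl⟩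
  obtain ⟨k, hk⟩ : ∃ k, k = avgIdem d (tN d u 3 0) (tN d u 3 2) := ⟨_, rfl⟩
  obtain ⟨E, hE⟩ : ∃ E, E = eValue d x := ⟨_, rfl⟩
  obtain ⟨c, hc⟩ : ∃ c, c = u⁻¹ - 1 := ⟨_, rfl⟩
  obtain ⟨T, hT⟩ : ∃ T, T = traceAux d u z x 3 := ⟨_, rfl⟩
  have hcyc : ∀ y y', T (y * y') = T (y' * y) := hT ▸ traceAux_comm 3
  -- The relations between the generators.
  have hbraid : a * b * a = b * a * b := by rw [ha, hb]; exact h.braid 0 (by omega)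
  have haa : a * a' = 1 := by rw [ha, ha']; exact gN_mul_gInv hu (by omega)
  have haa' : a' * a = 1 := by rw [ha, ha']; exact gInv_mul_gN hu (by omega)
  have hbb' : b' * b = 1 := by rw [hb, hb']; exact gInv_mul_gN hu (by omega)
  have hbb : b * b' = 1 := by rw [hb, hb']; exact gN_mul_gInv hu (by omega)
  have hb'e : b' = b + c • e + c • (e * b) := by rw [hb', hc, hb, he]; rfl
  have heb : e * b = b * e := by rw [he, hb]; exact eN_mul_gN (by omega)
  have hfa : f * a = a * f := by rw [hf, ha]; exact eN_mul_gN (by omega)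
  have hea : e * a = a * k := by
    rw [he, ha, hk]
    exact avgIdem_conj (h.tg2 0 (by omega)) (h.tg3 0 2 (by omega) (by omega) (by omega) (by omega))
  have hka : k * a = a * e := by
    rw [he, ha, hk]
    exact avgIdem_conj (h.tg1 0 (by omega)) (h.tg3 0 2 (by omega) (by omega) (by omega) (by omega))
  have hkb : k * b = b * f := by
    rw [hf, hb, hk]
    exact avgIdem_conj (h.tg3 1 0 (by omega) (by omega) (by omega) (by omega)) (h.tg2 1 (by omega))
  have hb'k : b' * k = f * b' := by
    calc b' * k = b' * (k * b) * b' := by rw [mul_assoc, mul_assoc, hbb, mul_one]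
      _ = f * b' := by rw [hkb, ← mul_assoc, hbb', one_mul]
  have hke : k * e = f * e := by
    have ht := fun i j (hi : i < 3) (hj : j < 3) => h.tcomm i j hi hj
    have h1 := avgIdem_mul_swap (ht 1 2 (by omega) (by omega)) (h.tpow 1 (by omega))
      (h.tpow 2 (by omega)) (ht 0 1 (by omega) (by omega)) (ht 0 2 (by omega) (by omega))
    rw [hk, hf, he, eN, eN, avgIdem_symm (ht 0 2 (by omega) (by omega)) (h.tpow 0 (by omega))
      (h.tpow 2 (by omega)), avgIdem_symm (ht 0 1 (by omega) (by omega)) (h.tpow 0 (by omega))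
      (h.tpow 1 (by omega))]
    exact h1.symm
  have hconj : b' * a * b = a * b * a' := by
    calc b' * a * b = b' * (a * b * a) * a' := by
          rw [mul_assoc b', mul_assoc b', mul_assoc _ a, haa, mul_one]
      _ = a * b * a' := by rw [hbraid, mul_assoc b, ← mul_assoc b', hbb', one_mul]
  have hebb : e * (b * b) = u • e + (u - 1) • (e * b) := by
    rw [he, hb]; exact eN_mul_gN_sq (by omega)
  -- The trace of words that contain at most one letter of the last strand.
  have hTb : ∀ w, T (incl d u 2 w * b) = z * traceAux d u z x 2 w := fun w => by
    rw [hT, hb]; exact trace_mul_gN w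
  have hTe : ∀ w, T (incl d u 2 w * e) = E * traceAux d u z x 2 w := fun w => by
    rw [hT, he, hE]; exact trace_mul_e hx w
  have hTeb : ∀ w, T (incl d u 2 w * (e * b)) = z * traceAux d u z x 2 w := fun w => by
    rw [hT, he, hb]; exact trace_mul_e_mul_g w
  have hia : incl d u 2 (gN d u 2 0) = a := by rw [ha]; exact incl_gN (by omega)
  have hif : incl d u 2 (eN d u 2 0) = f := by rw [hf]; exact incl_eN (by omega)
  have hg : traceAux d u z x 2 (gN d u 2 0) = z := trace_gN_two hx.zero
  have hfg : traceAux d u z x 2 (eN d u 2 0 * gN d u 2 0) = z := trace_eN_mul_gN_two hx.zero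
  have hfgg : traceAux d u z x 2 (eN d u 2 0 * (gN d u 2 0 * gN d u 2 0)) =
      u * E + (u - 1) * z := hE ▸ trace_eN_mul_gN_sq_two hx
  have hfaa : f * (a * a) = a * a * f := by rw [← mul_assoc, hfa, mul_assoc, hfa, ← mul_assoc]
  have h1 : T (a * b' * a * b) = z ^ 2 := by
    rw [mul_assoc a, mul_assoc a, hconj, ← mul_assoc, hcyc, ← mul_assoc, ← mul_assoc, haa',
      one_mul, ← hia, hTb, hg, sq]
  have h2 : T (a * b * a * e) = z * (u * E + (u - 1) * z) := by
    rw [hbraid, mul_assoc (b * a), ← heb, mul_assoc b, hcyc, mul_assoc, mul_assoc, hebb, mul_add,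
      mul_smul_comm, mul_smul_comm, map_add, map_smul, map_smul, ← hia, hTe, hTeb, hg, smul_eq_mul,
      smul_eq_mul]
    ring
  have h3 : T (a * e * a * e) = E * (u * E + (u - 1) * z) := by
    rw [mul_assoc a, hea, ← mul_assoc, mul_assoc, hke, ← mul_assoc, ← hfaa, ← hia, ← hif,
      ← map_mul, ← map_mul, hTe, hfgg]
  have h4 : T (a * (e * b) * a * e) = z * (u * E + (u - 1) * z) := by
    rw [mul_assoc, hcyc]
    have : a * e * (a * (e * b)) = f * (a * a) * (e * b) := by
      rw [hfaa, mul_assoc, ← mul_assoc e, hea, mul_assoc a k, ← mul_assoc k, hke]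
      simp only [mul_assoc]
    rw [this, ← hia, ← hif, ← map_mul, ← map_mul, hTeb, hfgg]
  have h5 : T (a * b' * a * (e * b)) = z ^ 2 := by
    have : a * b' * a * (e * b) = a * f * a * b * a' := by
      rw [mul_assoc _ a, ← mul_assoc a e, ← hka, mul_assoc k, mul_assoc a, ← mul_assoc b', hb'k,
        mul_assoc f, ← mul_assoc b', hconj]
      simp only [mul_assoc]
    rw [this, hcyc, ← mul_assoc, ← mul_assoc, ← mul_assoc, haa', one_mul, ← hia, ← hif,
      ← map_mul, hTb, hfg, sq]
  have h6 : T (a * b' * a * e) = (u * E + (u - 1) * z) * (z + c * (E + z)) := by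
    rw [hb'e, mul_add, mul_add, mul_smul_comm, mul_smul_comm, add_mul, add_mul, add_mul, add_mul,
      smul_mul_assoc, smul_mul_assoc, smul_mul_assoc, smul_mul_assoc, map_add, map_add, map_smul,
      map_smul, h2, h3, h4, smul_eq_mul, smul_eq_mul]
    ring
  rw [← ha, ← hb', ← hE, ← hc, ← hT]
  have h7 : a * b' * a * b' = a * b' * a * b + c • (a * b' * a * e) +
      c • (a * b' * a * (e * b)) := by
    nth_rewrite 2 [hb'e]
    rw [mul_add, mul_add, mul_smul_comm, mul_smul_comm]
  rw [h7, map_add, map_add, map_smul, map_smul, h1, h5, h6, smul_eq_mul, smul_eq_mul]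
  ring

end Yokonuma

/-! ### The equations between the parameters -/

section Values

variable {d : ℕ} [NeZero d] {x : ZMod d → ℂ}

lemma expSum_mul {n : ℕ} (α β : BraidGroup n) : expSum (α * β) = expSum α + expSum β := by
  rw [expSum, map_mul]; rfl

lemma expSum_inv {n : ℕ} (α : BraidGroup n) : expSum α⁻¹ = -expSum α := by
  rw [expSum, map_inv]; rfl

/-- The generator `σ_{i+1}` of the braid group. -/
def sigma {n : ℕ} (i : Fin (n - 1)) : BraidGroup n := PresentedGroup.of i

lemma yokonumaRep_sigma {u : ℂ} (hu : u ≠ 0) {n : ℕ} (i : Fin (n - 1)) :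
    (yokonumaRep d hu n (sigma i) : Yokonuma d u n) = Yokonuma.gN d u n i := by
  rw [sigma, yokonumaRep_of, Yokonuma.gN_of i.2]
  rfl

lemma yokonumaRep_sigma_inv {u : ℂ} (hu : u ≠ 0) {n : ℕ} (i : Fin (n - 1)) :
    (((yokonumaRep d hu n (sigma i))⁻¹ : (Yokonuma d u n)ˣ) : Yokonuma d u n) =
      Yokonuma.gInv d u n i := by
  rw [sigma, yokonumaRep_of, Yokonuma.val_inv_unitG]

lemma expSum_sigma {n : ℕ} (i : Fin (n - 1)) : expSum (sigma i) = 1 := expSum_of i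

/-- The braid `σ_1 σ_2⁻¹ σ_1 σ_2⁻¹`, whose closure is the figure-eight knot. -/
def figureEight : BraidGroup 3 :=
  sigma ⟨0, by omega⟩ * (sigma ⟨1, by omega⟩)⁻¹ * sigma ⟨0, by omega⟩ * (sigma ⟨1, by omega⟩)⁻¹

lemma deltaS_hopf (hx : IsESolution d x) {u : ℂ} (hu : u ≠ 0) (z s : ℂ) :
    deltaS d hu x z s (sigma (n := 2) 0 * sigma 0) =
      1 / (z * s) * (s ^ 2 * (1 + (u - 1) * eValue d x + (u - 1) * z)) := by
  rw [deltaS, expSum_mul, expSum_sigma, map_mul, Units.val_mul, yokonumaRep_sigma,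
    Yokonuma.juyumayaTrace_eq hx.zero]
  erw [Yokonuma.trace_gN_sq_two hx]
  rw [show (1 : ℤ) + 1 = (2 : ℕ) from rfl, zpow_natCast, mul_assoc, show 2 - 1 = 1 from rfl,
    pow_one]

lemma deltaS_trefoil (hx : IsESolution d x) {u : ℂ} (hu : u ≠ 0) (z s : ℂ) :
    deltaS d hu x z s (sigma (n := 2) 0 * sigma 0 * sigma 0) =
      1 / (z * s) * (s ^ 3 * ((u ^ 2 - u + 1) * z + u * (u - 1) * eValue d x)) := by
  rw [deltaS, expSum_mul, expSum_mul, expSum_sigma, map_mul, map_mul, Units.val_mul, Units.val_mul,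
    yokonumaRep_sigma, Yokonuma.juyumayaTrace_eq hx.zero]
  erw [Yokonuma.trace_gN_cube_two hx]
  rw [show (1 : ℤ) + 1 + 1 = (3 : ℕ) from rfl, zpow_natCast, mul_assoc, show 2 - 1 = 1 from rfl,
    pow_one]

lemma deltaS_figureEight (hx : IsESolution d x) {u : ℂ} (hu : u ≠ 0) (z s : ℂ) :
    deltaS d hu x z s figureEight = (1 / (z * s)) ^ 2 *
      (z ^ 2 + (u⁻¹ - 1) * ((u * eValue d x + (u - 1) * z) *
        (z + (u⁻¹ - 1) * (eValue d x + z)) + z ^ 2)) := by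
  rw [deltaS, figureEight, expSum_mul, expSum_mul, expSum_mul, expSum_inv, expSum_sigma,
    expSum_sigma, map_mul, map_mul, map_mul, map_inv, Units.val_mul, Units.val_mul, Units.val_mul,
    yokonumaRep_sigma, yokonumaRep_sigma_inv, Yokonuma.juyumayaTrace_eq hx.zero,
    Yokonuma.trace_figureEight hx hu, show (1 : ℤ) + -1 + 1 + -1 = 0 from rfl, zpow_zero, mul_one]

end Values

/-- In terms of the scaled eigenvalue `u r` and of `r`, the trace of the figure-eight braid is a
symmetric expression once `E` is eliminated by the definition of `λ_Y = r ^ 2`. -/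
lemma figureEight_value {u z E r : ℂ} (hu : u ≠ 0) (hr : r ^ 2 * (u * z) = z + (1 - u) * E) :
    (z ^ 2 + (u⁻¹ - 1) * ((u * E + (u - 1) * z) * (z + (u⁻¹ - 1) * (E + z)) + z ^ 2)) * u =
      z ^ 2 * (1 + u * r ^ 2 + u ^ 2 * r ^ 4 - r ^ 2 - u ^ 2 * r ^ 2) := by
  have h1 : (u⁻¹ - 1) * (E + z) = z * (r ^ 2 - 1) := by
    field_simp
    linear_combination -hr
  rw [h1]
  have h2 : (u⁻¹ - 1) * u = 1 - u := by field_simp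
  linear_combination ((u * E + (u - 1) * z) * (z + z * (r ^ 2 - 1)) + z ^ 2) * h2 -
    z * r ^ 2 * u * hr

/-- The relation `k1` says `D (1 + a b) = a + b` for the eigenvalues `a = q s` and `b = -s` of
`s G_i`. For `D = ±1` it follows that `D` is one of them. -/
lemma eq_or_eq_neg_one_of_sq_eq_one {q ζ s D B : ℂ} (hs0 : s ≠ 0) (hDζ : D = ζ * s)
    (hB : B = 1 - q * s ^ 2) (k1 : D * B = q * s - s) (h : D ^ 2 = 1) : ζ = q ∨ ζ = -1 := by
  have h1 : (D - q * s) * (D + s) = 0 := by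
    subst hB
    linear_combination D * k1 + (D ^ 2 * 0 + q * s ^ 2) * h
  rcases mul_eq_zero.mp h1 with h2 | h2
  · exact .inl (mul_right_cancel₀ hs0 (by linear_combination h2 - hDζ))
  · exact .inr (mul_right_cancel₀ hs0 (by linear_combination h2 - hDζ))

/-- The solutions of the equations for the unlink and the Hopf link with `λ_Y = r ^ 2 = 1`. -/
lemma coincidenceCase_of_sq_eq_one {q ζ u z E s r D B v : ℂ} (hE1 : E ≠ -1) (hs0 : s ≠ 0)
    (hr : r ^ 2 * (u * z) = z + (1 - u) * E) (hD : ζ * s = z * r) (hDz : D = z * r)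
    (hB : B = 1 - q * s ^ 2) (k1 : D * B = q * s - s)
    (k2 : (D ^ 2 - 1) * B = (1 - r ^ 2) * (D * v - 1)) (hC : r ^ 2 = 1) :
    CoincidenceCase q ζ u z E := by
  have hsc := eq_or_eq_neg_one_of_sq_eq_one hs0 (hDz.trans hD.symm) hB k1
  have huz : u = 1 ∨ z = -E := by
    have : (u - 1) * (z + E) = 0 := by rw [hC] at hr; linear_combination hr
    rcases mul_eq_zero.mp this with h | h
    · exact .inl (by linear_combination h)
    · exact .inr (by linear_combination h)
  rw [hC, sub_self, zero_mul] at k2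
  rcases mul_eq_zero.mp k2 with hA | hB0
  · have hD2 : D ^ 2 = 1 := by linear_combination hA
    have hz2 : z ^ 2 = 1 := by
      rw [hDz, mul_pow, hC, mul_one] at hD2; exact hD2
    have hz1 : z = 1 ∨ z = -1 := sq_eq_sq_iff_eq_or_eq_neg.mp (by rw [hz2, one_pow])
    rcases huz with h | h
    · rcases hsc hD2 with h1 | h1 <;> rcases hz1 with h2 | h2 <;>
        simp [CoincidenceCase, h, h1, h2]
    · rcases hz1 with h2 | h2
      · exact absurd (by rw [← h2, h, neg_neg]) hE1
      · have hE : E = 1 := by linear_combination h - h2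
        rcases hsc hD2 with h1 | h1 <;> simp [CoincidenceCase, h1, h2, hE]
  · rw [hB0, mul_zero] at k1
    have hq1 : q = 1 := mul_right_cancel₀ hs0 (by linear_combination -k1)
    have hs2 : s ^ 2 = 1 := by rw [hq1] at hB; linear_combination hB - hB0
    have hζz : ζ ^ 2 = z ^ 2 := by
      have := congrArg (· ^ 2) hD
      simpa only [mul_pow, hs2, hC, mul_one] using this
    rcases sq_eq_sq_iff_eq_or_eq_neg.mp hζz with h1 | h1 <;> rcases huz with h | h <;>
      simp [CoincidenceCase, hq1, h1, h]

/-- The solutions of the equations for the unlink, the Hopf link, the trefoil and the figure-eight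
knot with `λ_Y = r ^ 2 ≠ 1`. -/
lemma coincidenceCase_of_sq_ne_one {q ζ u z E s r D B v : ℂ} (hu : u ≠ 0) (hz : z ≠ 0)
    (hE0 : E ≠ 0) (hs0 : s ≠ 0) (hr0 : r ≠ 0)
    (hr : r ^ 2 * (u * z) = z + (1 - u) * E) (hD : ζ * s = z * r) (hDz : D = z * r)
    (hB : B = 1 - q * s ^ 2) (hv : v = u * r) (k1 : D * B = q * s - s)
    (k2 : (D ^ 2 - 1) * B = (1 - r ^ 2) * (D * v - 1))
    (k3 : (D ^ 2 - 1) * B ^ 2 = (1 - r ^ 2) * (v ^ 2 - 1)) (k4 : E * (r - v) = D * (r * v - 1))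
    (k8 : u * r ^ 2 * (1 + q * s ^ 2 + q ^ 2 * s ^ 4 - s ^ 2 - q ^ 2 * s ^ 2) =
      q * s ^ 2 * (1 + u * r ^ 2 + u ^ 2 * r ^ 4 - r ^ 2 - u ^ 2 * r ^ 2)) (hC : r ^ 2 ≠ 1) :
    CoincidenceCase q ζ u z E := by
  have hsc := eq_or_eq_neg_one_of_sq_eq_one hs0 (hDz.trans hD.symm) hB k1
  have hC' : 1 - r ^ 2 ≠ 0 := fun h => hC (by linear_combination -h)
  have hrv : r - v ≠ 0 := fun h => by
    have : u = 1 := mul_right_cancel₀ hr0 (by linear_combination -h - hv)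
    rw [this] at hr
    exact hC (mul_right_cancel₀ hz (by linear_combination hr))
  have hrv1 : r * v - 1 ≠ 0 := fun h => by
    rw [h, mul_zero] at k4
    exact mul_ne_zero hE0 hrv k4
  have hv0 : v ≠ 0 := hv ▸ mul_ne_zero hu hr0
  by_cases hDv : D * v - 1 = 0
  · rw [hDv, mul_zero] at k2
    have hv2 : v ^ 2 = 1 := by
      have : (1 - r ^ 2) * (v ^ 2 - 1) = 0 := by rw [← k3]; linear_combination B * k2
      have := (mul_eq_zero.mp this).resolve_left hC'
      linear_combination this
    have hDv' : D = v := by linear_combination v * hDv - D * hv2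
    have hzu : z = u := mul_right_cancel₀ hr0 (by rw [← hDz, ← hv, hDv'])
    have hE : E = 1 := mul_right_cancel₀ hrv (by
      linear_combination k4 + r * hDv - hDv')
    rcases hsc (by rw [hDv', hv2]) with h1 | h1 <;> simp [CoincidenceCase, h1, hzu, hE]
  have k5 : B * (D * v - 1) = v ^ 2 - 1 := mul_left_cancel₀ hC' (by
    linear_combination k3 - B * k2)
  have k6 : (v ^ 2 - 1) * (D ^ 2 - 1) = (1 - r ^ 2) * (D * v - 1) ^ 2 := by
    linear_combination (D * v - 1) * k2 - (D ^ 2 - 1) * k5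
  have k7 : (E - 1) * (E * (r - v) * (r * v + 1) - (r * v - 1) * (r + v)) = 0 := by
    refine (mul_eq_zero.mp (?_ : ((r - v) * (r * v - 1)) * _ = 0)).resolve_left
      (mul_ne_zero hrv hrv1)
    have e1 : (r * v - 1) ^ 2 * ((v ^ 2 - 1) * (D ^ 2 - 1)) =
        (v ^ 2 - 1) * ((E * (r - v)) ^ 2 - (r * v - 1) ^ 2) := by rw [k4]; ring
    have e2 : (r * v - 1) ^ 2 * ((1 - r ^ 2) * (D * v - 1) ^ 2) =
        (1 - r ^ 2) * (E * (r - v) * v - (r * v - 1)) ^ 2 := by rw [k4]; ring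
    linear_combination (r * v - 1) ^ 2 * k6 - e1 + e2
  rcases mul_eq_zero.mp k7 with hE | hE
  · have hE : E = 1 := by linear_combination hE
    rw [hE, one_mul] at k4
    have h1 : (D * v - 1) * (r * v - 1) = 1 - v ^ 2 := by linear_combination -v * k4
    have hBv : B = 1 - r * v := by
      have h2 : (D * v - 1) * (B - (1 - r * v)) = 0 := by linear_combination k5 + h1
      linear_combination (mul_eq_zero.mp h2).resolve_left hDv
    have hdiff : q * s - s = v - r := by rw [← k1, hBv]; linear_combination k4
    have hprod : q * s ^ 2 = r * v := by linear_combination hB - hBv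
    have h3 : (s - r) * (s + v) = 0 := by linear_combination -s * hdiff + hprod
    rcases mul_eq_zero.mp h3 with h4 | h4
    · have hsr : s = r := by linear_combination h4
      have h5 : ζ = z := mul_right_cancel₀ hr0 (by rw [← hD, hsr])
      have h6 : q = u := mul_right_cancel₀ hr0 (by
        rw [hsr, hv] at hdiff; linear_combination hdiff)
      simp [CoincidenceCase, h5, h6, hE]
    · have hsv : s = -v := by linear_combination h4
      have h5 : ζ = -z / u := by
        rw [eq_div_iff hu]
        refine mul_right_cancel₀ hr0 ?_
        rw [hsv, hv] at hD
        linear_combination -hD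
      have h6 : q = 1 / u := by
        rw [eq_div_iff hu]
        refine mul_right_cancel₀ hr0 ?_
        rw [hsv, hv] at hdiff
        linear_combination -hdiff
      iterate 13 refine Or.inr ?_
      exact ⟨h6, h5, hE⟩
  · -- The Hopf link and the trefoil allow the scaled eigenvalues `u r` and `r` on the Hecke side;
    -- the figure-eight knot rules them out.
    exfalso
    have hD' : D * (r * v + 1) = r + v := mul_left_cancel₀ hrv1 (by
      linear_combination hE - (r * v + 1) * k4)
    have h1 : (D * v - 1) * (r * v + 1) = v ^ 2 - 1 := by linear_combination v * hD'
    have hBv : B = r * v + 1 := mul_left_cancel₀ hDv (by linear_combination k5 - h1)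
    have hdiff : q * s - s = r + v := by rw [← k1, hBv, hD']
    have hprod : q * s ^ 2 = -(r * v) := by linear_combination hB - hBv
    have h2 : s ^ 2 + q ^ 2 * s ^ 2 = r ^ 2 + v ^ 2 := by
      linear_combination (q * s - s + r + v) * hdiff + 2 * hprod
    have h3 : (r * v) * ((1 - r ^ 2) * (1 - v ^ 2)) = 0 := by
      have h4 : (r * v) * (1 + q * s ^ 2 + (q * s ^ 2) ^ 2 - (s ^ 2 + q ^ 2 * s ^ 2)) =
          q * s ^ 2 * (1 + r * v + (r * v) ^ 2 - (r ^ 2 + v ^ 2)) := by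
        rw [hv]; linear_combination k8
      rw [hprod, h2] at h4
      linear_combination h4 / 2
    have h4 : 1 - v ^ 2 = 0 := (mul_eq_zero.mp ((mul_eq_zero.mp h3).resolve_left
      (mul_ne_zero hr0 hv0))).resolve_left hC'
    have h5 : r * v + 1 = 0 :=
      (mul_eq_zero.mp (h1.trans (by linear_combination -h4))).resolve_left hDv
    exact hC (by linear_combination (r * v - 1) * h5 + r ^ 2 * h4)

/-- The equations that come from the unlink, the Hopf link, the trefoil and the figure-eight knot
have no other solutions than the 14 cases. -/
lemma coincidenceCase_of_equations {q ζ u z E s r : ℂ} (hq : q ≠ 0) (hu : u ≠ 0)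
    (hz : z ≠ 0) (hE0 : E ≠ 0) (hE1 : E ≠ -1) (hs0 : s ≠ 0) (hr0 : r ≠ 0)
    (hs : s ^ 2 * (q * ζ) = ζ + (1 - q)) (hr : r ^ 2 * (u * z) = z + (1 - u) * E)
    (hD : ζ * s = z * r)
    (hhopf : s ^ 2 * (1 + (q - 1) * 1 + (q - 1) * ζ) = r ^ 2 * (1 + (u - 1) * E + (u - 1) * z))
    (htref : s ^ 3 * ((q ^ 2 - q + 1) * ζ + q * (q - 1) * 1) =
      r ^ 3 * ((u ^ 2 - u + 1) * z + u * (u - 1) * E))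
    (hfig : ζ ^ 2 + (q⁻¹ - 1) * ((q * 1 + (q - 1) * ζ) * (ζ + (q⁻¹ - 1) * (1 + ζ)) + ζ ^ 2) =
      z ^ 2 + (u⁻¹ - 1) * ((u * E + (u - 1) * z) * (z + (u⁻¹ - 1) * (E + z)) + z ^ 2)) :
    CoincidenceCase q ζ u z E := by
  -- `D` is the common normalisation. With the eigenvalues `a = q s` and `b = -s` of `s G_i`, the
  -- number `B` is `1 + a b`; the eigenvalues of `r g_i` are `v` and `±r`.
  obtain ⟨D, hDz⟩ : ∃ D, D = z * r := ⟨_, rfl⟩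
  obtain ⟨B, hB⟩ : ∃ B, B = 1 - q * s ^ 2 := ⟨_, rfl⟩
  obtain ⟨v, hv⟩ : ∃ v, v = u * r := ⟨_, rfl⟩
  have hDζ : D = ζ * s := hDz.trans hD.symm
  have hD0 : D ≠ 0 := hDz ▸ mul_ne_zero hz hr0
  have k1 : D * B = q * s - s := by
    rw [hDζ, hB]; linear_combination -s * hs
  have k4 : E * (r - v) = D * (r * v - 1) := by
    rw [hDz, hv]; linear_combination -r * hr
  have k2 : (D ^ 2 - 1) * B = (1 - r ^ 2) * (D * v - 1) := by
    have hl : s ^ 2 * (1 + (q - 1) * 1 + (q - 1) * ζ) = D ^ 2 * B + 1 - B := by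
      linear_combination (-D) * k1 - (q * s - s) * hDζ + hB
    have hr' : r ^ 2 * (1 + (u - 1) * E + (u - 1) * z) = r ^ 2 + D * v * (1 - r ^ 2) := by
      subst hv
      linear_combination (-r) * k4 - (u * r - r) * hDz
    linear_combination hhopf - hl + hr'
  have k3 : (D ^ 2 - 1) * B ^ 2 = (1 - r ^ 2) * (v ^ 2 - 1) := by
    have hl : s ^ 3 * ((q ^ 2 - q + 1) * ζ + q * (q - 1) * 1) = D + D * ((D ^ 2 - 1) * B ^ 2) := by
      subst hB
      linear_combination (-D * (D * (1 - q * s ^ 2) + q * s - s) - q * s ^ 2) * k1 -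
        s ^ 2 * (q ^ 2 - q + 1) * hDζ
    have hr' : r ^ 3 * ((u ^ 2 - u + 1) * z + u * (u - 1) * E) =
        D * (v ^ 2 + r ^ 2 - v ^ 2 * r ^ 2) := by
      subst hv
      linear_combination (-(u * r) * r) * k4 - r ^ 2 * (u ^ 2 - u + 1) * hDz
    refine mul_left_cancel₀ hD0 ?_
    linear_combination htref - hl + hr'
  have k8 : u * r ^ 2 * (1 + q * s ^ 2 + q ^ 2 * s ^ 4 - s ^ 2 - q ^ 2 * s ^ 2) =
      q * s ^ 2 * (1 + u * r ^ 2 + u ^ 2 * r ^ 4 - r ^ 2 - u ^ 2 * r ^ 2) := by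
    have f1 := figureEight_value (z := ζ) (E := 1) hq (by rw [mul_one]; exact hs)
    have f2 := figureEight_value hu hr
    rw [hfig] at f1
    have h1 : D ^ 2 = ζ ^ 2 * s ^ 2 := by rw [hDζ]; ring
    have h2 : D ^ 2 = z ^ 2 * r ^ 2 := by rw [hDz]; ring
    refine mul_left_cancel₀ (pow_ne_zero 2 hD0) ?_
    linear_combination
      u * r ^ 2 * (1 + q * s ^ 2 + q ^ 2 * s ^ 4 - s ^ 2 - q ^ 2 * s ^ 2) * h1 -
      q * s ^ 2 * (1 + u * r ^ 2 + u ^ 2 * r ^ 4 - r ^ 2 - u ^ 2 * r ^ 2) * h2 -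
      s ^ 2 * u * r ^ 2 * f1 + q * s ^ 2 * r ^ 2 * f2
  by_cases hC : r ^ 2 = 1
  · exact coincidenceCase_of_sq_eq_one hE1 hs0 hr hD hDz hB k1 k2 hC
  · exact coincidenceCase_of_sq_ne_one hu hz hE0 hs0 hr0 hr hD hDz hB hv k1 k2 k3 k4 k8 hC

/-! ### Necessity of the 14 cases -/

lemma coincidenceCase_of_homflypt_eq_deltaS {d : ℕ} [NeZero d] {x : ZMod d → ℂ}
    (hx : IsESolution d x) {q ζ u z s r : ℂ} (hq : q ≠ 0) (hζ : ζ ≠ 0) (hu : u ≠ 0) (hz : z ≠ 0)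
    (hH : lambdaH q ζ ≠ 0) (hY : lambdaY u z (eValue d x) ≠ 0) (hs : s ^ 2 = lambdaH q ζ)
    (hr : r ^ 2 = lambdaY u z (eValue d x))
    (h : ∀ n : ℕ, 1 ≤ n → ∀ α : BraidGroup n, homflypt hq ζ s α = deltaS d hu x z r α) :
    CoincidenceCase q ζ u z (eValue d x) := by
  have hs0 : s ≠ 0 := fun h0 => hH (by rw [← hs, h0, zero_pow two_ne_zero])
  have hr0 : r ≠ 0 := fun h0 => hY (by rw [← hr, h0, zero_pow two_ne_zero])
  have hD : ζ * s = z * r := mul_eq_mul_of_unlink hq hu (h 2 one_le_two 1)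
  have hp : 1 / (z * r) ≠ 0 := one_div_ne_zero (mul_ne_zero hz hr0)
  have hhopf := h 2 one_le_two (sigma 0 * sigma 0)
  have htref := h 2 one_le_two (sigma 0 * sigma 0 * sigma 0)
  have hfig := h 3 (by omega) figureEight
  rw [homflypt_eq_deltaS, deltaS_hopf isESolution_one, deltaS_hopf hx, hD, eValue_one] at hhopf
  rw [homflypt_eq_deltaS, deltaS_trefoil isESolution_one, deltaS_trefoil hx, hD,
    eValue_one] at htref
  rw [homflypt_eq_deltaS, deltaS_figureEight isESolution_one, deltaS_figureEight hx, hD,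
    eValue_one] at hfig
  refine coincidenceCase_of_equations hq hu hz hx.eValue_ne_zero hx.eValue_ne_neg_one hs0 hr0
    ?_ ?_ hD (mul_left_cancel₀ hp hhopf) (mul_left_cancel₀ hp htref)
    (mul_left_cancel₀ (pow_ne_zero 2 hp) hfig)
  · rw [hs, lambdaH, div_mul_cancel₀ _ (mul_ne_zero hq hζ)]
  · rw [hr, lambdaY, div_mul_cancel₀ _ (mul_ne_zero hu hz)]

/-- In each of the 14 cases there are square roots that satisfy `ζ √λ_H = z √λ_Y`. -/
lemma sq_mul_lambda_eq_of_case {q ζ u z E : ℂ} (hq : q ≠ 0) (hζ : ζ ≠ 0) (hu : u ≠ 0)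
    (hz : z ≠ 0) (h : CoincidenceCase q ζ u z E) :
    ζ ^ 2 * lambdaH q ζ = z ^ 2 * lambdaY u z E := by
  have h1 : ζ ^ 2 * lambdaH q ζ = ζ * (ζ + (1 - q)) / q := by rw [lambdaH]; field_simp
  have h2 : z ^ 2 * lambdaY u z E = z * (z + (1 - u) * E) / u := by rw [lambdaY]; field_simp
  rw [h1, h2, div_eq_div_iff hq hu]
  rcases h with ⟨rfl, rfl, rfl⟩ | ⟨rfl, rfl, rfl⟩ | ⟨rfl, rfl, rfl⟩ | ⟨rfl, rfl, rfl⟩ |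
    ⟨rfl, rfl, rfl⟩ | ⟨rfl, rfl, rfl⟩ | ⟨rfl, rfl, rfl⟩ | ⟨rfl, rfl, rfl⟩ | ⟨rfl, rfl, rfl⟩ |
    ⟨rfl, rfl, rfl⟩ | ⟨rfl, rfl, rfl⟩ | ⟨rfl, rfl, rfl⟩ | ⟨rfl, rfl, rfl⟩ | ⟨rfl, rfl, rfl⟩
  all_goals first
    | ring1
    | (field_simp; ring1)

end

end YokonumaHecke

theorem mainTheorem1 (d : ℕ) [NeZero d] (x : ZMod d → ℂ) (hx : IsESolution d x) (q ζ u z : ℂ)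
    (hq : q ≠ 0) (hζ : ζ ≠ 0) (hu : u ≠ 0) (hz : z ≠ 0)
    (hH : lambdaH q ζ ≠ 0) (hY : lambdaY u z (eValue d x) ≠ 0) :
    (∀ (n : ℕ) (i : Fin (n - 1)),
      Yokonuma.juyumayaTrace d u z x n (Yokonuma.e i) = eValue d x) ∧
    ((∃ sH sY : ℂ, sH ^ 2 = lambdaH q ζ ∧ sY ^ 2 = lambdaY u z (eValue d x) ∧
        ∀ n : ℕ, 1 ≤ n → ∀ α : BraidGroup n, homflypt hq ζ sH α = deltaS d hu x z sY α) ↔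
      CoincidenceCase q ζ u z (eValue d x)) ∧
    (CoincidenceCase q ζ u z (eValue d x) →
      ∀ sH sY : ℂ, sH ^ 2 = lambdaH q ζ → sY ^ 2 = lambdaY u z (eValue d x) →
        ((∀ n : ℕ, 1 ≤ n → ∀ α : BraidGroup n,
          homflypt hq ζ sH α = deltaS d hu x z sY α) ↔ ζ * sH = z * sY)) ∧
    (CoincidenceCase q ζ u z (eValue d x) → u = 1 ∨ q = 1 ∨ eValue d x = 1) := by
  refine ⟨fun n i => ?_, ⟨?_, fun hc => ?_⟩, fun hc sH sY _ _ => ⟨fun h => ?_, fun hD n _ α => ?_⟩,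
    fun hc => ?_⟩
  · rw [Yokonuma.juyumayaTrace_eq hx.zero, Yokonuma.e_eq_eN, Yokonuma.trace_eN hx (by omega)]
  · rintro ⟨sH, sY, hs, hr, h⟩
    exact coincidenceCase_of_homflypt_eq_deltaS hx hq hζ hu hz hH hY hs hr h
  · obtain ⟨sH, hs⟩ := IsAlgClosed.exists_pow_nat_eq (lambdaH q ζ) two_pos
    have hD : ζ * sH = z * (ζ * sH / z) := by field_simp
    refine ⟨sH, ζ * sH / z, hs, ?_, fun n _ α => homflypt_eq_deltaS_of_case hx hq hζ hu hz hc hD α⟩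
    rw [div_pow, mul_pow, hs, sq_mul_lambda_eq_of_case hq hζ hu hz hc]
    field_simp
  · exact mul_eq_mul_of_unlink hq hu (h 2 one_le_two 1)
  · exact homflypt_eq_deltaS_of_case hx hq hζ hu hz hc hD α
  · simp only [CoincidenceCase] at hc
    rcases hc with h | h | h | h | h | h | h | h | h | h | h | h | h | h <;> simp [h]
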